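/- Let $k$ be an algebraically closed field of characteristic $0$, $Y$ a nonempty $k$-scheme, and $\varphi\colon X\to Y$ a Gorenstein covering map of degree $6$, that is, a finite flat morphism with $\varphi_*\mathcal O_X$ locally free of rank $6$ all of whose fibres are Gorenstein. Let $M$ be a locally free $\mathcal O_Y$-module of rank $2$ and suppose given a decomposition of $\mathcal O_Y$-modules $$\varphi_*\mathcal O_X=\mathcal O_Y\oplus M\oplus M\oplus\wedge^2M$$ whose first inclusion is $\varphi^{\#}$; write $a,b\colon M\to\varphi_*\mathcal O_X$ for the inclusions of the two copies of $M$. For a frame $(m_1,m_2)$ of $M$ over an affine open $U\subseteq Y$ put $z_j=a(m_j)$, $w_j=b(m_j)$, $Z=(z_1,z_2)^t$, $W=(w_1,w_2)^t$, and $$S^2(Z)=\begin{pmatrix}z_1^2\\ z_1z_2\\ z_2^2\end{pmatrix},\quad S^2(Z,W)=\begin{pmatrix}z_1w_1\\ \tfrac12(z_1w_2+z_2w_1)\\ z_2w_2\end{pmatrix},\quad S^2(W)=\begin{pmatrix}w_1^2\\ w_1w_2\\ w_2^2\end{pmatrix}.$$ Assume that $\varphi$ is defined by a general linear cover homomorphism: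 there is $e=(e_0,e_1,e_2,e_3)\in k^4$ with $$\Delta_{tc}(e)=e_0^2e_3^2+4e_0e_2^3-3e_1^2e_2^2+4e_1^3e_3-6e_0e_1e_2e_3\neq0$$ such that every point of $Y$ has an affine open neighbourhood $U$ with a frame of $M$ and functions $c_0,\dots,c_3\in\mathcal O_Y(U)$ for which $z_1,z_2,w_1,w_2$ generate the $\mathcal O_Y(U)$-algebra $\mathcal O_X(\varphi^{-1}U)$, and the ideal $I_X\subset\mathcal O_Y(U)[z_1,z_2,w_1,w_2]$ of relations among them is generated by the nine entries of $$\begin{pmatrix}S^2(Z)-e_1\widetilde CZ-e_0\widetilde CW-d\\ S^2(Z,W)+e_2\widetilde CZ+e_1\widetilde CW-d'\\ S^2(W)-e_3\widetilde CZ-e_2\widetilde CW-d''\end{pmatrix},\qquad \widetilde C=\begin{pmatrix}c_1&c_0\\-c_2&-c_1\\c_3&c_2\end{pmatrix},$$ for some constant vectors $d,d',d''\in\mathcal O_Y(U)^3$. We call such a triple $(U,(m_j),(c_i))$ a linear chart. Then $X$ is an $S_3$-Galois branched cover of $Y$: there is a faithful action of $S_3$ on $X$ for which $\varphi$ is the quotient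 map $X\to X/S_3=Y$. Here, for a group $G$ acting on $X$, a morphism $\pi\colon X\to Q$ is the quotient $X\to X/G$ if it is $G$-invariant, is topologically the quotient map onto the space of $G$-orbits, and $\mathcal O_Q=(\pi_*\mathcal O_X)^G$. Furthermore, for this action: 1. There is $g\in\mathrm{GL}(2,k)$ such that, after the linear change of coordinates $(z_j,w_j)^t\mapsto g\,(z_j,w_j)^t$, $j=1,2$, in every linear chart the ideal $I_X$ is generated by the nine entries of $$\begin{pmatrix}S^2(Z)-\widetilde CW\\ 2\,S^2(Z,W)-\widetilde D\\ S^2(W)-\widetilde CZ\end{pmatrix},\qquad \widetilde D=\begin{pmatrix}2(-c_0c_2+c_1^2)\\ c_0c_3-c_1c_2\\ 2(-c_1c_3+c_2^2)\end{pmatrix},$$ with the same $c_i$. 2. For every subgroup $\mathbb Z_2\subset S_3$ of order $2$, the quotient $X/\mathbb Z_2$ exists as a scheme, and the induced $\varphi_2\colon X/\mathbb Z_2\to Y$ is a triple cover (a covering map of degree $3$) with $\varphi_{2*}\mathcal O_{X/\mathbb Z_2}=\mathcal O_Y\oplus M$, the first summand being embedded by $\varphi_2^{\#}$. 3. For the subgroup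 $\mathbb Z_3\subset S_3$ of order $3$, the quotient $X/\mathbb Z_3$ exists as a scheme, and the induced $\varphi_3\colon X/\mathbb Z_3\to Y$ is a double cover (a covering map of degree $2$) with $\varphi_{3*}\mathcal O_{X/\mathbb Z_3}=\mathcal O_Y\oplus\wedge^2M$, the first summand being embedded by $\varphi_3^{\#}$. -/

import Mathlib

open CategoryTheory Limits AlgebraicGeometry

universe u v w

noncomputable section

/-! ### Exterior powers of sheaves of modules -/

namespace ExteriorSheaf

section Algebra

variable {R S : Type u} [CommRing R] [CommRing S] (σ : R →+* S)
  {M N : Type u} [AddCommGroup M] [AddCommGroup N] [Module R M] [Module S N]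

/-- The map `⋀ⁿ_R M → ⋀ⁿ_S N`, `m₁ ∧ ⋯ ∧ mₙ ↦ f m₁ ∧ ⋯ ∧ f mₙ`, induced by a map `f : M → N`
which is semilinear along `σ : R → S`. -/
def semiMap (n : ℕ) (f : M →ₛₗ[σ] N) : ⋀[R]^n M →ₛₗ[σ] ⋀[S]^n N :=
  letI : Module R N := Module.compHom N σ
  letI : Module R (⋀[S]^n N) := Module.compHom _ σ
  let alt : M [⋀^Fin n]→ₗ[R] (⋀[S]^n N) :=
    { toFun := fun m => exteriorPower.ιMulti S n (fun i => f (m i))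
      map_update_add' := by
        intro inst m i x y
        have h : ∀ t : M, (fun j => f (Function.update m i t j)) =
            Function.update (fun j => f (m j)) i (f t) := by
          intro t; funext j; by_cases hj : j = i
          · subst hj; simp
          · simp [hj]
        rw [h, h, h, map_add, AlternatingMap.map_update_add]
      map_update_smul' := by
        intro inst m i r x
        have h : ∀ t : M, (fun j => f (Function.update m i t j)) =
            Function.update (fun j => f (m j)) i (f t) := by
          intro t; funext j; by_cases hj : j = i
          · subst hj; simp
          · simp [hj]
        rw [h, h, map_smulₛₗ, AlternatingMap.map_update_smul]
        rfl
      map_eq_zero_of_eq' := by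
        intro m i j hij hne
        exact AlternatingMap.map_eq_zero_of_eq _ _ (congrArg f hij) hne }
  { toFun := fun x => exteriorPower.alternatingMapLinearEquiv alt x
    map_add' := fun x y => map_add _ x y
    map_smul' := fun r x => map_smul (exteriorPower.alternatingMapLinearEquiv alt) r x }

theorem semiMap_ιMulti (n : ℕ) (f : M →ₛₗ[σ] N) (m : Fin n → M) :
    semiMap σ n f (exteriorPower.ιMulti R n m) =
      exteriorPower.ιMulti S n (fun i => f (m i)) := by
  let _ : Module R N := Module.compHom N σ
  let _ : Module R (⋀[S]^n N) := Module.compHom _ σ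
  exact exteriorPower.alternatingMapLinearEquiv_apply_ιMulti _ _

end Algebra

variable {Y : Scheme.{u}}

/-- The restriction map of a sheaf of modules, as a semilinear map. -/
def restr (M : Y.Modules) {U V : Y.Opens} (i : V ⟶ U) :
    Γ(M, U) →ₛₗ[(Y.presheaf.map i.op).hom] Γ(M, V) where
  toFun x := M.presheaf.map i.op x
  map_add' x y := map_add (M.presheaf.map i.op).hom x y
  map_smul' r x := Scheme.Modules.map_smul M i r x

/-- The presheaf of abelian groups `U ↦ ⋀ⁿ_{𝒪(U)} M(U)`. -/
def powerPresheafAb (n : ℕ) (M : Y.Modules) : (Y.Opens)ᵒᵖ ⥤ Ab.{u} where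
  obj U := AddCommGrpCat.of (⋀[Γ(Y, U.unop)]^n Γ(M, U.unop))
  map i := AddCommGrpCat.ofHom (semiMap _ n (restr M i.unop)).toAddMonoidHom
  map_id U := by
    refine AddCommGrpCat.hom_ext (AddMonoidHom.ext fun x => ?_)
    change semiMap _ n (restr M (𝟙 U.unop)) x = x
    induction (exteriorPower.ιMulti_span Γ(Y, U.unop) n Γ(M, U.unop) ▸ Submodule.mem_top :
        x ∈ Submodule.span Γ(Y, U.unop) (Set.range (exteriorPower.ιMulti Γ(Y, U.unop) n)))
      using Submodule.span_induction with
    | mem x hx =>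
      obtain ⟨m, rfl⟩ := hx
      rw [semiMap_ιMulti]
      congr 1
      funext i
      exact congr($(M.presheaf.map_id (.op U.unop)) (m i))
    | zero => exact map_zero _
    | add x y _ _ hx hy => rw [map_add, hx, hy]
    | smul r x _ hx =>
      rw [map_smulₛₗ, hx]
      exact congrArg (· • x) congr($(Y.presheaf.map_id (.op U.unop)) r)
  map_comp {U V W} i j := by
    refine AddCommGrpCat.hom_ext (AddMonoidHom.ext fun x => ?_)
    change semiMap _ n (restr M (i ≫ j).unop) x =
      semiMap _ n (restr M j.unop) (semiMap _ n (restr M i.unop) x)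
    induction (exteriorPower.ιMulti_span Γ(Y, U.unop) n Γ(M, U.unop) ▸ Submodule.mem_top :
        x ∈ Submodule.span Γ(Y, U.unop) (Set.range (exteriorPower.ιMulti Γ(Y, U.unop) n)))
      using Submodule.span_induction with
    | mem x hx =>
      obtain ⟨m, rfl⟩ := hx
      rw [semiMap_ιMulti, semiMap_ιMulti, semiMap_ιMulti]
      congr 1
      funext l
      exact congr($(M.presheaf.map_comp i j) (m l))
    | zero => simp only [map_zero]
    | add x y _ _ hx hy => simp only [map_add, hx, hy]
    | smul r x _ hx =>
      rw [map_smulₛₗ, map_smulₛₗ, map_smulₛₗ, hx]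
      exact congrArg (· • _) congr($(Y.presheaf.map_comp i j) r)

/-- The presheaf of modules `U ↦ ⋀ⁿ_{𝒪(U)} M(U)`. -/
def powerPresheaf (n : ℕ) (M : Y.Modules) : Y.PresheafOfModules :=
  letI (U : (Y.Opens)ᵒᵖ) : Module (Y.ringCatSheaf.obj.obj U) ((powerPresheafAb n M).obj U) :=
    inferInstanceAs (Module Γ(Y, U.unop) (⋀[Γ(Y, U.unop)]^n Γ(M, U.unop)))
  PresheafOfModules.ofPresheaf (R := Y.ringCatSheaf.obj) (powerPresheafAb n M)
    (fun _ _ i r x => (semiMap (Y.presheaf.map i.unop.op).hom n (restr M i.unop)).map_smulₛₗ r x)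

/-- The exterior power `⋀ⁿ M` of a sheaf of modules: the sheaf associated with
`U ↦ ⋀ⁿ_{𝒪(U)} M(U)`. -/
def power (n : ℕ) (M : Y.Modules) : Y.Modules :=
  (PresheafOfModules.sheafification (𝟙 Y.ringCatSheaf.obj)).obj (powerPresheaf n M)

end ExteriorSheaf

/-! ### Locally free sheaves and covering maps -/

namespace AlgCover

variable {X Y : Scheme.{u}}

/-- The structure sheaf `𝒪_Y` as a module over itself. -/
abbrev structureSheaf (Y : Scheme.{u}) : Y.Modules := SheafOfModules.unit Y.ringCatSheaf

/-- The direct image `φ_* 𝒪_X`. -/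
abbrev directImage (φ : X ⟶ Y) : Y.Modules :=
  (Scheme.Modules.pushforward φ).obj (structureSheaf X)

/-- The canonical map `φ^# : 𝒪_Y ⟶ φ_* 𝒪_X`. -/
def sharp (φ : X ⟶ Y) : structureSheaf Y ⟶ directImage φ :=
  SheafOfModules.unitToPushforwardObjUnit φ.toRingCatSheafHom

/-- A section of `φ_* 𝒪_X` over `U`, seen as a function on `φ⁻¹ U`. -/
def toFunction (φ : X ⟶ Y) {U : Y.Opens} (x : Γ(directImage φ, U)) : Γ(X, φ ⁻¹ᵁ U) := x

theorem toFunction_sharp (φ : X ⟶ Y) (U : Y.Opens) (r : Γ(Y, U)) :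
    toFunction φ ((sharp φ).app U r) = φ.app U r := rfl

/-- `b` is a frame of `M` over `U`: its restriction to each open `V ⊆ U` is a basis of the
`𝒪(V)`-module `M(V)`, i.e. `b` defines an isomorphism `𝒪_U^r ≅ M|_U`. -/
def IsFrame (M : Y.Modules) {r : ℕ} (U : Y.Opens) (b : Fin r → Γ(M, U)) : Prop :=
  ∀ (V : Y.Opens) (i : V ⟶ U),
    LinearIndependent Γ(Y, V) (fun j => M.presheaf.map i.op (b j)) ∧
    Submodule.span Γ(Y, V) (Set.range fun j => M.presheaf.map i.op (b j)) = ⊤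

/-- `M` is locally free of rank `r`. -/
def IsLocallyFreeOfRank (M : Y.Modules) (r : ℕ) : Prop :=
  ∀ y : Y, ∃ U : Y.Opens, y ∈ U ∧ ∃ b : Fin r → Γ(M, U), IsFrame M U b

/-- A covering map of degree `d`: a finite flat morphism `φ` such that `φ_* 𝒪_X` is locally free
of rank `d`. -/
structure IsCoveringMap (φ : X ⟶ Y) (d : ℕ) : Prop where
  finite : IsFinite φ
  flat : Flat φ
  locallyFree : IsLocallyFreeOfRank (directImage φ) d

/-- A Noetherian ring which has finite injective dimension as a module over itself; for local
rings this is the definition of a Gorenstein ring. -/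
def IsGorensteinRing (R : Type u) [CommRing R] : Prop :=
  IsNoetherianRing R ∧ ∃ n : ℕ, HasInjectiveDimensionLT (ModuleCat.of.{u} R R) n

/-- A Gorenstein scheme: all its local rings are Gorenstein. -/
def IsGorensteinScheme (Z : Scheme.{u}) : Prop :=
  ∀ z : Z, IsGorensteinRing (Z.presheaf.stalk z)

/-- A Gorenstein covering map: a covering map all whose fibres are Gorenstein. -/
structure IsGorensteinCoveringMap (φ : X ⟶ Y) (d : ℕ) : Prop extends IsCoveringMap φ d where
  gorenstein : ∀ y : Y, IsGorensteinScheme (φ.fiber y)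

/-! ### Quotients and Galois branched covers -/

theorem preimage_le_of_invariant {Q : Scheme.{u}} {α : X ⟶ X} {π : X ⟶ Q} (h : α ≫ π = π)
    (U : Q.Opens) : π ⁻¹ᵁ U ≤ α ⁻¹ᵁ (π ⁻¹ᵁ U) := by
  rw [← Scheme.Hom.comp_preimage, h]

/-- `π : X ⟶ Q` is the quotient of `X` by the action `ρ` of `G`: it is invariant, topologically
it is the quotient map onto the space of orbits, and `𝒪_Q` is the sheaf `(π_* 𝒪_X)^G` of invariant
functions. -/
structure IsQuotientBy {Q : Scheme.{u}} {G : Type w} [Group G] (ρ : G →* Aut X) (π : X ⟶ Q) :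
    Prop where
  invariant : ∀ g : G, (ρ g).hom ≫ π = π
  isQuotientMap : Topology.IsQuotientMap π
  orbit : ∀ x x' : X, π x = π x' → ∃ g : G, (ρ g).hom x = x'
  injective : ∀ U : Q.Opens, Function.Injective (π.app U)
  mem_range : ∀ (U : Q.Opens) (f : Γ(X, π ⁻¹ᵁ U)),
    (∀ g : G, (ρ g).hom.appLE (π ⁻¹ᵁ U) (π ⁻¹ᵁ U)
      (preimage_le_of_invariant (invariant g) U) f = f) →
    f ∈ Set.range (π.app U)

/-- `φ : X ⟶ Y` is a `G`-Galois branched cover via the action `ρ`: it is a covering map of degree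
`|G|`, the action of `G` on `X` is faithful, and `φ` is the quotient of `X` by `G` (so that
`G` acts over `Y` and `Y = X / G`). -/
structure IsGaloisBranchedCover {G : Type w} [Group G] (ρ : G →* Aut X) (φ : X ⟶ Y) : Prop where
  isCoveringMap : IsCoveringMap φ (Nat.card G)
  faithful : Function.Injective ρ
  isQuotientBy : IsQuotientBy ρ φ

/-! ### Linear cover homomorphisms -/

section Algebra

variable {A : Type u} [CommRing A]

/-- The discriminant `Δ_tc`. -/
def discriminant (e : Fin 4 → A) : A :=
  e 0 ^ 2 * e 3 ^ 2 + 4 * e 0 * e 2 ^ 3 - 3 * e 1 ^ 2 * e 2 ^ 2 + 4 * e 1 ^ 3 * e 3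
    - 6 * e 0 * e 1 * e 2 * e 3

/-- The triple cover block with parameters `c₀, c₁, c₂, c₃`. -/
def tripleBlock (c : Fin 4 → A) : Matrix (Fin 3) (Fin 2) A :=
  !![c 1, c 0; -c 2, -c 1; c 3, c 2]

/-- The vector `(2(c₁² - c₀c₂), c₀c₃ - c₁c₂, 2(c₂² - c₁c₃))`. -/
def constantVector (c : Fin 4 → A) : Fin 3 → A :=
  ![2 * (-(c 0 * c 2) + c 1 ^ 2), c 0 * c 3 - c 1 * c 2, 2 * (-(c 1 * c 3) + c 2 ^ 2)]

/-- The ring `A[z₁, z₂, w₁, w₂]`; the variable `(0, j)` is `z_{j+1}`, and `(1, j)` is `w_{j+1}`. -/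
abbrev CoordRing (A : Type u) [CommRing A] := MvPolynomial (Fin 2 × Fin 2) A

/-- The column vector `Z = (z₁, z₂)` (for `p = 0`) or `W = (w₁, w₂)` (for `p = 1`). -/
def coordVector (A : Type u) [CommRing A] (p : Fin 2) : Fin 2 → CoordRing A :=
  fun j => MvPolynomial.X (p, j)

variable {k : Type u} [Field k] (κ : k →+* A)

/-- `S²(V, V') = (v₁v'₁, (v₁v'₂ + v₂v'₁)/2, v₂v'₂)`. -/
def symSq (v v' : Fin 2 → CoordRing A) : Fin 3 → CoordRing A :=
  ![v 0 * v' 0, MvPolynomial.C (κ 2⁻¹) * (v 0 * v' 1 + v 1 * v' 0), v 1 * v' 1]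

/-- The nine quadrics: the vectors `S²(Z)`, `S²(Z, W)`, `S²(W)`. -/
def quadrics : Fin 3 → Fin 3 → CoordRing A :=
  ![symSq κ (coordVector A 0) (coordVector A 0), symSq κ (coordVector A 0) (coordVector A 1),
    symSq κ (coordVector A 1) (coordVector A 1)]

/-- The vector `C̃ V`, for `V = Z` or `V = W`. -/
def blockMul (c : Fin 4 → A) (p : Fin 2) : Fin 3 → CoordRing A :=
  ((tripleBlock c).map MvPolynomial.C).mulVec (coordVector A p)

/-- The nine polynomials
`S²(Z) - (e₁ C̃ Z + e₀ C̃ W) - d₀`, `S²(Z, W) - (-e₂ C̃ Z - e₁ C̃ W) - d₁`,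
`S²(W) - (e₃ C̃ Z + e₂ C̃ W) - d₂`, with `e ∈ k⁴` and constant terms `d_p ∈ A³`. -/
def linearEquations (e : Fin 4 → k) (c : Fin 4 → A) (d : Fin 3 → Fin 3 → A)
    (i : Fin 3 × Fin 3) : CoordRing A :=
  quadrics κ i.1 i.2
    - (MvPolynomial.C (κ (tripleBlock e i.1 0)) * blockMul c 0 i.2
      + MvPolynomial.C (κ (tripleBlock e i.1 1)) * blockMul c 1 i.2)
    - MvPolynomial.C (d i.1 i.2)

/-- The nine polynomials `S²(Z) - C̃ W`, `2 S²(Z, W) - D̃`, `S²(W) - C̃ Z`. -/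
def normalEquations (c : Fin 4 → A) (i : Fin 3 × Fin 3) : CoordRing A :=
  ![quadrics κ 0 i.2 - blockMul c 1 i.2,
    2 * quadrics κ 1 i.2 - MvPolynomial.C (constantVector c i.2),
    quadrics κ 2 i.2 - blockMul c 0 i.2] i.1

/-- The `A`-algebra `B` (via `ψ`) is generated by the elements `x`, and the ideal of all relations
among them is generated by the polynomials `f`. -/
def IsPresentedBy {B : Type u} [CommRing B] (ψ : A →+* B) (x : Fin 2 × Fin 2 → B)
    {ι : Type v} (f : ι → CoordRing A) : Prop :=
  Function.Surjective (MvPolynomial.eval₂Hom ψ x) ∧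
    RingHom.ker (MvPolynomial.eval₂Hom ψ x) = Ideal.span (Set.range f)

end Algebra

section Charts

variable {k : Type u} [Field k] (s : Y ⟶ Spec (.of k)) (φ : X ⟶ Y) {M : Y.Modules}
  (a b : M ⟶ directImage φ)

/-- The constants `k → 𝒪_Y(U)` of the `k`-scheme `Y`. -/
def constants (U : Y.Opens) : k →+* Γ(Y, U) :=
  (Y.presheaf.map (homOfLE le_top).op).hom.comp
    (s.appTop.hom.comp (Scheme.ΓSpecIso (.of k)).inv.hom)

/-- The functions `z_j = a(m_j)` and `w_j = b(m_j)` on `φ⁻¹ U` defined by two sections `m₁, m₂` of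
`M` over `U`, for maps `a, b : M ⟶ φ_* 𝒪_X`. -/
def coordinates (U : Y.Opens) (m : Fin 2 → Γ(M, U)) (p : Fin 2 × Fin 2) : Γ(X, φ ⁻¹ᵁ U) :=
  ![toFunction φ (a.app U (m p.2)), toFunction φ (b.app U (m p.2))] p.1

/-- The linear change of coordinates `(z_j, w_j)ᵗ ↦ g (z_j, w_j)ᵗ`, `j = 1, 2`. -/
def changeCoordinates (g : GL (Fin 2) k) (U : Y.Opens) (x : Fin 2 × Fin 2 → Γ(X, φ ⁻¹ᵁ U))
    (p : Fin 2 × Fin 2) : Γ(X, φ ⁻¹ᵁ U) :=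
  ∑ q : Fin 2, φ.app U (constants s U (g.val p.1 q)) * x (q, p.2)

/-- Over the open set `U` with frame `m` of `M`, the cover `φ` is defined by the linear cover
homomorphism with parameters `e ∈ k⁴` and `c ∈ 𝒪_Y(U)⁴`: in the coordinates `z_j, w_j` the ideal
of `X` is generated by the nine polynomials `q - Φ(q) - d`, for suitable constant terms
`d ∈ 𝒪_Y(U)`. -/
def IsLinearChart (e : Fin 4 → k) (U : Y.Opens) (m : Fin 2 → Γ(M, U)) (c : Fin 4 → Γ(Y, U)) :
    Prop :=
  IsAffineOpen U ∧ IsFrame M U m ∧ ∃ d : Fin 3 → Fin 3 → Γ(Y, U),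
    IsPresentedBy (φ.app U).hom (coordinates φ a b U m)
      (linearEquations (constants s U) e c d)

/-- `φ` is defined by a linear morphism with parameters `e ∈ k⁴` in a neighbourhood of each point. -/
def IsLinearCover (e : Fin 4 → k) : Prop :=
  ∀ y : Y, ∃ (U : Y.Opens) (m : Fin 2 → Γ(M, U)) (c : Fin 4 → Γ(Y, U)),
    y ∈ U ∧ IsLinearChart s φ a b e U m c

end Charts

end AlgCover

end

/-! The vector `e` encodes the binary cubic f = e₀X³ - 3e₁X²Y + 3e₂XY² - e₃Y³, and `discriminant e`
is the discriminant of its Hessian. If it is nonzero, the Hessian has two independent zeros v and w.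
They satisfy f(v, w, ·) = 0, so in the basis v, w the cubic is a combination of X³ and Y³, and
rescaling normalizes it (`exists_diagonalization`). The matrix with rows v and w, applied to each
pair (z_j, w_j), takes the linear equations to the normal ones up to constant terms
(`substitution_normalEquations`). Those constants are forced: evaluating products such as z₁z₁z₂ in
two ways, and using that 1, z₁, z₂, w₁, w₂ are independent, determines them all (`constants_eq`).

The normal relations have a visible S₃ symmetry: z ↦ ωz, w ↦ ω²w for a primitive cube root of unity
ω, and the exchange of z and w. On the direct image it acts trivially on 𝒪, by the two-dimensional
representation on the two copies of M, and by the sign on ⋀²M (`matrixEnd`). For this action to be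
multiplicative, ⋀²M has to sit in the algebra by m ∧ n ↦ a(m)b(n) - a(n)b(m), whereas the given
embedding t is arbitrary. The relations show that 1, the z_j, the w_j and z₁w₂ - z₂w₁ span locally.
Replacing t by `wedge` therefore gives a surjection, and comparison with the given isomorphism turns
it into a surjective endomorphism of a finite module, hence an isomorphism (`isIso_decomposition`).
On a chart the action agrees with a ring homomorphism supplied by the presentation, which proves
multiplicativity (`matrixEnd_mul_mul`).

Invariants are now read off from the decomposition: 𝒪 for the whole group, 𝒪 and the graph of a
scalar M → M for a reflection, 𝒪 ⊕ ⋀²M for the rotations. A quotient is the relative spectrum of the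
invariants; its points are the orbits because a finite group permutes transitively the primes over a
given prime of the invariant ring (`isQuotientBy_of_cover`). The invariants are a direct summand of
a finite flat algebra, so the quotients are again covering maps (`exists_quotient_of_retraction`).
-/

noncomputable section

namespace AlgCover

/-! ### Diagonalization of a binary cubic form. -/

section BinaryCubic

variable {k : Type u} [Field k]

/-- A nondegenerate binary quadratic form over an algebraically closed field is a product of two
independent linear forms. -/
theorem exists_independent_roots [IsAlgClosed k] [CharZero k] (A B C : k)
    (h : B ^ 2 - 4 * A * C ≠ 0) : ∃ t p q r s : k, p * s - q * r ≠ 0 ∧ p * r = t * C ∧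
      p * s + q * r = -(t * B) ∧ q * s = t * A := by
  obtain ⟨δ, hδ⟩ := IsAlgClosed.exists_pow_nat_eq (B ^ 2 - 4 * A * C) (n := 2) two_pos
  have hδ0 : δ ≠ 0 := by
    rintro rfl
    exact h (by rw [← hδ]; ring)
  by_cases hA : A = 0
  · subst hA
    have hB : B ≠ 0 := by
      rintro rfl
      exact h (by ring)
    exact ⟨-1, 1, 0, -C, B, by simpa using hB, by ring, by ring, by ring⟩
  · refine ⟨4 * A, -B + δ, 2 * A, -B - δ, 2 * A, ?_, ?_, by ring, by ring⟩
    · have : (-B + δ) * (2 * A) - 2 * A * (-B - δ) = 4 * (A * δ) := by ring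
      rw [this]
      exact mul_ne_zero (by norm_num) (mul_ne_zero hA hδ0)
    · linear_combination -hδ

/-- A binary cubic with nonzero discriminant is, after a linear change of coordinates, the sum of
two cubes. -/
theorem exists_diagonalization [IsAlgClosed k] [CharZero k] (e : Fin 4 → k)
    (he : discriminant e ≠ 0) : ∃ p q r s : k, p * s - q * r ≠ 0 ∧
      p ^ 2 * e 1 - 2 * (p * q) * e 2 + q ^ 2 * e 3 = r ∧
      p ^ 2 * e 0 - 2 * (p * q) * e 1 + q ^ 2 * e 2 = s ∧
      p * r * e 1 - (p * s + q * r) * e 2 + q * s * e 3 = 0 ∧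
      p * r * e 0 - (p * s + q * r) * e 1 + q * s * e 2 = 0 ∧
      r ^ 2 * e 1 - 2 * (r * s) * e 2 + s ^ 2 * e 3 = p ∧
      r ^ 2 * e 0 - 2 * (r * s) * e 1 + s ^ 2 * e 2 = q := by
  rw [discriminant] at he
  generalize e 0 = e0, e 1 = e1, e 2 = e2, e 3 = e3 at *
  -- The two mixed conditions are linear in `(p * r, p * s + q * r, q * s)` and are solved by the
  -- cross product of their coefficient rows. Its entries are, up to sign, the coefficients of the
  -- Hessian, whose discriminant is `discriminant e`.
  obtain ⟨t, p, q, r, s, hdet, hpr, hmid, hqs⟩ := exists_independent_roots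
    (e0 * e2 - e1 ^ 2) (e1 * e2 - e0 * e3) (e1 * e3 - e2 ^ 2) (by
      intro h
      exact he (by linear_combination h))
  have hm₁ : p * r * e1 - (p * s + q * r) * e2 + q * s * e3 = 0 := by
    rw [hpr, hmid, hqs]
    ring
  have hm₂ : p * r * e0 - (p * s + q * r) * e1 + q * s * e2 = 0 := by
    rw [hpr, hmid, hqs]
    ring
  clear hpr hmid hqs
  -- For v = (p, q) and w = (r, s), the left sides `b₁, b₂` represent the linear form f(v, v, ·). It
  -- vanishes on w because f(v, w, ·) = 0, so `(b₁, b₂)` is a multiple α of w.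
  have key : ∀ p q r s : k, p * s - q * r ≠ 0 →
      p * r * e1 - (p * s + q * r) * e2 + q * s * e3 = 0 →
      p * r * e0 - (p * s + q * r) * e1 + q * s * e2 = 0 →
      ∃ α : k, α ≠ 0 ∧ p ^ 2 * e1 - 2 * (p * q) * e2 + q ^ 2 * e3 = α * r ∧
        p ^ 2 * e0 - 2 * (p * q) * e1 + q ^ 2 * e2 = α * s := by
    intro p q r s hdet hm₁ hm₂
    set b₁ := p ^ 2 * e1 - 2 * (p * q) * e2 + q ^ 2 * e3 with hb₁
    set b₂ := p ^ 2 * e0 - 2 * (p * q) * e1 + q ^ 2 * e2 with hb₂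
    have hb : b₁ * s - b₂ * r = 0 := by
      rw [hb₁, hb₂]
      linear_combination q * hm₁ - p * hm₂
    refine ⟨(b₂ * p - b₁ * q) / (p * s - q * r), ?_, ?_, ?_⟩
    -- If α = 0 then f(v, ·, ·) = 0. The pairs (e₀, e₁), (e₁, e₂), (e₂, e₃) are then all annihilated
    -- by (p, -q), so the minors of these pairs vanish, and with them the discriminant.
    · refine div_ne_zero (fun h0 => ?_) hdet
      have h₁ : b₁ = 0 := (mul_eq_zero.mp
        (by linear_combination p * hb + r * h0 : (p * s - q * r) * b₁ = 0)).resolve_left hdet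
      have h₂ : b₂ = 0 := (mul_eq_zero.mp
        (by linear_combination q * hb + s * h0 : (p * s - q * r) * b₂ = 0)).resolve_left hdet
      have l₁ : p * e1 - q * e2 = 0 := (mul_eq_zero.mp
        (by linear_combination s * (hb₁.symm.trans h₁) - q * hm₁ :
          (p * s - q * r) * (p * e1 - q * e2) = 0)).resolve_left hdet
      have l₂ : p * e2 - q * e3 = 0 := (mul_eq_zero.mp
        (by linear_combination r * (hb₁.symm.trans h₁) - p * hm₁ :
          (p * s - q * r) * (p * e2 - q * e3) = 0)).resolve_left hdet
      have l₀ : p * e0 - q * e1 = 0 := (mul_eq_zero.mp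
        (by linear_combination s * (hb₂.symm.trans h₂) - q * hm₂ :
          (p * s - q * r) * (p * e0 - q * e1) = 0)).resolve_left hdet
      have hA : e0 * e2 - e1 ^ 2 = 0 := (mul_eq_zero.mp
        (by linear_combination r * (e0 * l₁ - e1 * l₀) - s * (e1 * l₁ - e2 * l₀) :
          (p * s - q * r) * (e0 * e2 - e1 ^ 2) = 0)).resolve_left hdet
      have hB : e1 * e2 - e0 * e3 = 0 := (mul_eq_zero.mp
        (by linear_combination s * (e1 * l₂ - e3 * l₀) - r * (e0 * l₂ - e2 * l₀) :
          (p * s - q * r) * (e1 * e2 - e0 * e3) = 0)).resolve_left hdet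
      exact he (by linear_combination (e1 * e2 - e0 * e3) * hB - 4 * (e1 * e3 - e2 ^ 2) * hA)
    · field_simp
      linear_combination p * hb
    · field_simp
      linear_combination q * hb
  obtain ⟨α, hα, hα₁, hα₂⟩ := key p q r s hdet hm₁ hm₂
  obtain ⟨β, hβ, hβ₁, hβ₂⟩ := key r s p q
    (fun h => hdet (by linear_combination -h)) (by linear_combination hm₁)
    (by linear_combination hm₂)
  -- Replacing v by xv forces w to become x²αw; the remaining condition f(w, w, ·) ~ v then reads
  -- x⁴α²β = x.
  obtain ⟨x, hx⟩ := IsAlgClosed.exists_pow_nat_eq (1 / (α ^ 2 * β)) (n := 3) (by norm_num)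
  have hx' : x ^ 3 * (α ^ 2 * β) = 1 := by
    rw [hx]
    field_simp
  have hx0 : x ≠ 0 := by
    rintro rfl
    simp at hx'
  refine ⟨x * p, x * q, x ^ 2 * α * r, x ^ 2 * α * s, ?_, ?_, ?_, ?_, ?_, ?_, ?_⟩
  · intro h
    refine mul_ne_zero (mul_ne_zero (pow_ne_zero 3 hx0) hα) hdet ?_
    linear_combination h
  · linear_combination x ^ 2 * hα₁
  · linear_combination x ^ 2 * hα₂
  · linear_combination x ^ 3 * α * hm₁
  · linear_combination x ^ 3 * α * hm₂
  · linear_combination x ^ 4 * α ^ 2 * hβ₁ + x * p * hx'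
  · linear_combination x ^ 4 * α ^ 2 * hβ₂ + x * q * hx'

end BinaryCubic

/-! ### The algebra defined by the normal relations. -/

section Presentation

variable {A B : Type u} [CommRing A] [CommRing B] (ψ : A →+* B)

/-- The nine relations which hold in the normal form of a linear cover. -/
structure NormalRelations (c : Fin 4 → A) (z₁ z₂ w₁ w₂ : B) : Prop where
  zz₀ : z₁ * z₁ = ψ (c 1) * w₁ + ψ (c 0) * w₂
  zz₁ : z₁ * z₂ = -ψ (c 2) * w₁ - ψ (c 1) * w₂
  zz₂ : z₂ * z₂ = ψ (c 3) * w₁ + ψ (c 2) * w₂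
  zw₀ : z₁ * w₁ = ψ (-(c 0 * c 2) + c 1 ^ 2)
  zw₁ : z₁ * w₂ + z₂ * w₁ = ψ (c 0 * c 3 - c 1 * c 2)
  zw₂ : z₂ * w₂ = ψ (-(c 1 * c 3) + c 2 ^ 2)
  ww₀ : w₁ * w₁ = ψ (c 1) * z₁ + ψ (c 0) * z₂
  ww₁ : w₁ * w₂ = -ψ (c 2) * z₁ - ψ (c 1) * z₂
  ww₂ : w₂ * w₂ = ψ (c 3) * z₁ + ψ (c 2) * z₂

/-- `1, z₁, z₂, w₁, w₂` are linearly independent. -/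
def Independent (z₁ z₂ w₁ w₂ : B) : Prop :=
  ∀ r₀ r₁ r₂ r₃ r₄ : A, ψ r₀ + ψ r₁ * z₁ + ψ r₂ * z₂ + ψ r₃ * w₁ + ψ r₄ * w₂ = 0 →
    r₀ = 0 ∧ r₁ = 0 ∧ r₂ = 0 ∧ r₃ = 0 ∧ r₄ = 0

variable {ψ}

/-- The constant terms of the nine relations are determined by associativity. -/
theorem constants_eq (h2 : IsUnit (2 : A)) {z₁ z₂ w₁ w₂ : B} (hind : Independent ψ z₁ z₂ w₁ w₂)
    (c : Fin 4 → A) (d E f : Fin 3 → A)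
    (hd₀ : z₁ * z₁ = ψ (c 1) * w₁ + ψ (c 0) * w₂ + ψ (d 0))
    (hd₁ : z₁ * z₂ = -ψ (c 2) * w₁ - ψ (c 1) * w₂ + ψ (d 1))
    (hd₂ : z₂ * z₂ = ψ (c 3) * w₁ + ψ (c 2) * w₂ + ψ (d 2))
    (hE₀ : 2 * (z₁ * w₁) = ψ (E 0)) (hE₁ : z₁ * w₂ + z₂ * w₁ = ψ (E 1))
    (hE₂ : 2 * (z₂ * w₂) = ψ (E 2))
    (hf₀ : w₁ * w₁ = ψ (c 1) * z₁ + ψ (c 0) * z₂ + ψ (f 0))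
    (hf₁ : w₁ * w₂ = -ψ (c 2) * z₁ - ψ (c 1) * z₂ + ψ (f 1))
    (hf₂ : w₂ * w₂ = ψ (c 3) * z₁ + ψ (c 2) * z₂ + ψ (f 2)) :
    d = 0 ∧ E = constantVector c ∧ f = 0 := by
  have hz : ∀ a : A, 2 * a = 0 → a = 0 := fun a ha => by
    simpa using (h2.mul_right_eq_zero.mp ha)
  have h2ψ : ψ 2 = 2 := map_ofNat ψ 2
  -- Associativity z₂(z₁z₁) = z₁(z₁z₂), with every mixed product z_i w_j absorbed in the constants
  -- `E`, is a linear relation among 1, z₁, z₂; its coefficients vanish. The next three steps treat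
  -- z₁z₂z₂, w₁w₁w₂ and w₁w₂w₂ in the same way.
  obtain ⟨-, a₁, a₂, -, -⟩ := hind (2 * (c 1 * E 1) + c 0 * E 2 + c 2 * E 0) (-(2 * d 1))
    (2 * d 0) 0 0 (by
      simp only [map_add, map_mul, map_neg, map_zero, h2ψ, ← hE₀, ← hE₁, ← hE₂]
      linear_combination (-2 * z₂) * hd₀ + (2 * z₁) * hd₁)
  obtain ⟨-, a₄, -, -, -⟩ := hind (-(2 * (c 2 * E 1) + c 3 * E 0 + c 1 * E 2)) (-(2 * d 2))
    (2 * d 1) 0 0 (by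
      simp only [map_add, map_mul, map_neg, map_zero, h2ψ, ← hE₀, ← hE₁, ← hE₂]
      linear_combination (-2 * z₂) * hd₁ + (2 * z₁) * hd₂)
  obtain ⟨-, -, -, b₁, b₂⟩ := hind (2 * (c 1 * E 1) + c 0 * E 2 + c 2 * E 0) 0 0 (-(2 * f 1))
    (2 * f 0) (by
      simp only [map_add, map_mul, map_neg, map_zero, h2ψ, ← hE₀, ← hE₁, ← hE₂]
      linear_combination (-2 * w₂) * hf₀ + (2 * w₁) * hf₁)
  obtain ⟨-, -, -, b₄, -⟩ := hind (-(2 * (c 2 * E 1) + c 3 * E 0 + c 1 * E 2)) 0 0 (-(2 * f 2))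
    (2 * f 1) (by
      simp only [map_add, map_mul, map_neg, map_zero, h2ψ, ← hE₀, ← hE₁, ← hE₂]
      linear_combination (-2 * w₂) * hf₁ + (2 * w₁) * hf₂)
  have d₀ := hz _ a₂
  have d₁ := hz _ (neg_eq_zero.mp a₁)
  have d₂ := hz _ (neg_eq_zero.mp a₄)
  have f₀ := hz _ b₂
  have f₁ := hz _ (neg_eq_zero.mp b₁)
  have f₂ := hz _ (neg_eq_zero.mp b₄)
  simp only [d₀, d₁, d₂, f₀, f₁, f₂, map_zero, add_zero] at hd₀ hd₁ hd₂ hf₀ hf₁ hf₂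
  -- Once `d` and `f` vanish, associativity of z₁z₁w₁ gives a relation that is a multiple of z₁,
  -- which determines `E 0`. The products z₂z₂w₂ and z₁(z₁w₂ + z₂w₁) determine `E 2` and `E 1`.
  obtain ⟨-, e₀, -, -, -⟩ := hind 0 (E 0 - 2 * (-(c 0 * c 2) + c 1 ^ 2)) 0 0 0 (by
    simp only [map_add, map_sub, map_mul, map_neg, map_zero, map_pow, h2ψ, ← hE₀]
    linear_combination (2 * w₁) * hd₀ + 2 * ψ (c 1) * hf₀ + 2 * ψ (c 0) * hf₁)
  obtain ⟨-, -, e₂, -, -⟩ := hind 0 0 (E 2 - 2 * (-(c 1 * c 3) + c 2 ^ 2)) 0 0 (by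
    simp only [map_add, map_sub, map_mul, map_neg, map_zero, map_pow, h2ψ, ← hE₂]
    linear_combination (2 * w₂) * hd₂ + 2 * ψ (c 3) * hf₁ + 2 * ψ (c 2) * hf₂)
  obtain ⟨-, e₁, -, -, -⟩ := hind 0 (E 1 - (c 0 * c 3 - c 1 * c 2)) 0 0 0 (by
    simp only [map_sub, map_mul, map_zero, ← hE₁]
    linear_combination w₂ * hd₀ + w₁ * hd₁ + ψ (c 0) * hf₂ - ψ (c 2) * hf₀)
  refine ⟨?_, ?_, ?_⟩
  · ext i
    fin_cases i <;> assumption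
  · ext i
    fin_cases i
    · exact sub_eq_zero.mp e₀
    · exact sub_eq_zero.mp e₁
    · exact sub_eq_zero.mp e₂
  · ext i
    fin_cases i <;> assumption

/-- The subalgebra generated by `z₁, z₂, w₁, w₂` is spanned by `1, z₁, z₂, w₁, w₂` and
`z₁ w₂ - z₂ w₁`. -/
theorem NormalRelations.exists_coeffs (h2 : IsUnit (2 : A)) {c : Fin 4 → A}
    {x : Fin 2 × Fin 2 → B} (h : NormalRelations ψ c (x (0, 0)) (x (0, 1)) (x (1, 0)) (x (1, 1)))
    (f : CoordRing A) : ∃ r : Fin 6 → A, MvPolynomial.eval₂Hom ψ x f =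
      ψ (r 0) + ψ (r 1) * x (0, 0) + ψ (r 2) * x (0, 1) + ψ (r 3) * x (1, 0) + ψ (r 4) * x (1, 1)
        + ψ (r 5) * (x (0, 0) * x (1, 1) - x (0, 1) * x (1, 0)) := by
  obtain ⟨η, hη⟩ := h2.exists_right_inv
  induction f using MvPolynomial.induction_on with
  | C a => exact ⟨![a, 0, 0, 0, 0, 0], by simp⟩
  | add f f' hf hf' =>
    obtain ⟨r, hr⟩ := hf
    obtain ⟨r', hr'⟩ := hf'
    refine ⟨r + r', ?_⟩
    simp only [map_add, hr, hr', Pi.add_apply]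
    ring
  | mul_X f p hf =>
    obtain ⟨r, hr⟩ := hf
    rw [map_mul, hr]
    simp only [MvPolynomial.coe_eval₂Hom, MvPolynomial.eval₂_X]
    generalize hz₁ : x (0, 0) = z₁ at *
    generalize hz₂ : x (0, 1) = z₂ at *
    generalize hw₁ : x (1, 0) = w₁ at *
    generalize hw₂ : x (1, 1) = w₂ at *
    have h2ψ : ψ 2 = 2 := map_ofNat ψ 2
    have hη' : 2 * ψ η = 1 := by simpa [h2ψ] using congrArg ψ hη
    obtain ⟨zz₀, zz₁, zz₂, zw₀, zw₁, zw₂, ww₀, ww₁, ww₂⟩ := h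
    simp only [map_add, map_sub, map_mul, map_neg, map_pow] at *
    -- The relations only give the sum of z₁w₂ and z₂w₁; their difference is the sixth generator,
    -- and halving recovers each of them.
    have v₁ : z₁ * w₂ = ψ η * (ψ (c 0) * ψ (c 3) - ψ (c 1) * ψ (c 2) + (z₁ * w₂ - z₂ * w₁)) := by
      linear_combination (-z₁ * w₂) * hη' + ψ η * zw₁
    have v₂ : z₂ * w₁ = ψ η * (ψ (c 0) * ψ (c 3) - ψ (c 1) * ψ (c 2) - (z₁ * w₂ - z₂ * w₁)) := by
      linear_combination (-z₂ * w₁) * hη' + ψ η * zw₁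
    have hp : p = (0, 0) ∨ p = (0, 1) ∨ p = (1, 0) ∨ p = (1, 1) := by
      revert p
      decide
    -- The sixth generator times a variable is reduced by regrouping, for example z₁(z₁w₂ - z₂w₁) =
    -- w₂(z₁z₁) - w₁(z₁z₂), so that the relations for zz and then for ww apply.
    rcases hp with rfl | rfl | rfl | rfl
    · rw [hz₁]
      refine ⟨![r 3 * (-(c 0 * c 2) + c 1 ^ 2) + r 4 * η * (c 0 * c 3 - c 1 * c 2),
        r 0 + r 5 * (c 0 * c 3 - c 1 * c 2), r 5 * (2 * (c 0 * c 2) - 2 * c 1 ^ 2),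
        r 1 * c 1 - r 2 * c 2, r 1 * c 0 - r 2 * c 1, r 4 * η], ?_⟩
      simp [h2ψ, -mul_eq_mul_left_iff, -mul_eq_mul_right_iff]
      linear_combination ψ (r 1) * zz₀ + ψ (r 2) * zz₁ + ψ (r 3) * zw₀ + ψ (r 4) * v₁ +
        ψ (r 5) * (w₂ * zz₀ - w₁ * zz₁ + 2 * ψ (c 1) * ww₁ + ψ (c 0) * ww₂ + ψ (c 2) * ww₀)
    · rw [hz₂]
      refine ⟨![r 3 * η * (c 0 * c 3 - c 1 * c 2) + r 4 * (-(c 1 * c 3) + c 2 ^ 2),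
        r 5 * (2 * c 2 ^ 2 - 2 * (c 1 * c 3)), r 0 + r 5 * (c 1 * c 2 - c 0 * c 3),
        r 2 * c 3 - r 1 * c 2, r 2 * c 2 - r 1 * c 1, -(r 3 * η)], ?_⟩
      simp [h2ψ, -mul_eq_mul_left_iff, -mul_eq_mul_right_iff]
      linear_combination ψ (r 1) * zz₁ + ψ (r 2) * zz₂ + ψ (r 3) * v₂ + ψ (r 4) * zw₂ +
        ψ (r 5) * (w₂ * zz₁ - w₁ * zz₂ - 2 * ψ (c 2) * ww₁ - ψ (c 1) * ww₂ - ψ (c 3) * ww₀)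
    · rw [hw₁]
      refine ⟨![r 1 * (-(c 0 * c 2) + c 1 ^ 2) + r 2 * η * (c 0 * c 3 - c 1 * c 2),
        r 3 * c 1 - r 4 * c 2, r 3 * c 0 - r 4 * c 1,
        r 0 + r 5 * (c 1 * c 2 - c 0 * c 3), r 5 * (2 * c 1 ^ 2 - 2 * (c 0 * c 2)),
        -(r 2 * η)], ?_⟩
      simp [h2ψ, -mul_eq_mul_left_iff, -mul_eq_mul_right_iff]
      linear_combination ψ (r 1) * zw₀ + ψ (r 2) * v₂ + ψ (r 3) * ww₀ + ψ (r 4) * ww₁ +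
        ψ (r 5) * (z₁ * ww₁ - z₂ * ww₀ - ψ (c 2) * zz₀ - 2 * ψ (c 1) * zz₁ - ψ (c 0) * zz₂)
    · rw [hw₂]
      refine ⟨![r 1 * η * (c 0 * c 3 - c 1 * c 2) + r 2 * (-(c 1 * c 3) + c 2 ^ 2),
        r 4 * c 3 - r 3 * c 2, r 4 * c 2 - r 3 * c 1,
        r 5 * (2 * (c 1 * c 3) - 2 * c 2 ^ 2), r 0 + r 5 * (c 0 * c 3 - c 1 * c 2),
        r 1 * η], ?_⟩
      simp [h2ψ, -mul_eq_mul_left_iff, -mul_eq_mul_right_iff]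
      linear_combination ψ (r 1) * v₁ + ψ (r 2) * zw₂ + ψ (r 3) * ww₁ + ψ (r 4) * ww₂ +
        ψ (r 5) * (z₁ * ww₂ - z₂ * ww₁ + ψ (c 3) * zz₀ + 2 * ψ (c 2) * zz₁ + ψ (c 1) * zz₂)

variable {k : Type u} [Field k] (κ : k →+* A)

theorem isUnit_two_of_charZero {k : Type u} [Field k] (κ : k →+* A) [CharZero k] : IsUnit (2 : A) := by
  simpa [map_ofNat κ 2] using (IsUnit.mk0 (2 : k) two_ne_zero).map κ

/-- The normal equations hold at a point if and only if the normal relations do. -/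
theorem normalRelations_iff [CharZero k] {c : Fin 4 → A} {x : Fin 2 × Fin 2 → B} :
    NormalRelations ψ c (x (0, 0)) (x (0, 1)) (x (1, 0)) (x (1, 1)) ↔
      ∀ i, MvPolynomial.eval₂Hom ψ x (normalEquations κ c i) = 0 := by
  have h2ψ : ψ 2 = 2 := map_ofNat ψ 2
  have h2 : IsUnit (2 : B) := by simpa [h2ψ] using (isUnit_two_of_charZero κ).map ψ
  have hκ : ψ (κ 2⁻¹) * 2 = 1 := by
    have : κ 2⁻¹ * κ 2 = 1 := by rw [← map_mul, inv_mul_cancel₀ two_ne_zero, map_one]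
    simpa [map_ofNat κ 2, h2ψ] using congrArg ψ this
  constructor
  · rintro ⟨zz₀, zz₁, zz₂, zw₀, zw₁, zw₂, ww₀, ww₁, ww₂⟩ ⟨i, j⟩
    simp only [map_add, map_sub, map_mul, map_neg, map_pow] at zw₀ zw₁ zw₂
    fin_cases i <;> fin_cases j <;>
      simp [h2ψ, normalEquations, quadrics, symSq, coordVector, blockMul, tripleBlock, constantVector,
        Matrix.mulVec, dotProduct, Fin.sum_univ_two]
    · linear_combination zz₀
    · linear_combination zz₁ + (x (0, 0) * x (0, 1)) * hκ
    · linear_combination zz₂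
    · linear_combination 2 * zw₀
    · linear_combination zw₁ + (x (0, 0) * x (1, 1) + x (0, 1) * x (1, 0)) * hκ
    · linear_combination 2 * zw₂
    · linear_combination ww₀
    · linear_combination ww₁ + (x (1, 0) * x (1, 1)) * hκ
    · linear_combination ww₂
  · intro h
    have h' := fun i j => h (i, j)
    simp only [Fin.forall_fin_succ] at h'
    simp [h2ψ, normalEquations, quadrics, symSq, coordVector, blockMul, tripleBlock, constantVector,
        Matrix.mulVec, dotProduct, Fin.sum_univ_two] at h'
    obtain ⟨⟨zz₀, zz₁, zz₂⟩, ⟨zw₀, zw₁, zw₂⟩, ww₀, ww₁, ww₂⟩ := h'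
    constructor
    · linear_combination zz₀
    · linear_combination zz₁ - (x (0, 0) * x (0, 1)) * hκ
    · linear_combination zz₂
    · simp only [map_add, map_sub, map_mul, map_neg, map_pow]
      exact h2.mul_left_cancel (by linear_combination zw₀)
    · simp only [map_add, map_sub, map_mul, map_neg, map_pow]
      linear_combination zw₁ - (x (0, 0) * x (1, 1) + x (0, 1) * x (1, 0)) * hκ
    · simp only [map_add, map_sub, map_mul, map_neg, map_pow]
      exact h2.mul_left_cancel (by linear_combination zw₂)
    · linear_combination ww₀
    · linear_combination ww₁ - (x (1, 0) * x (1, 1)) * hκ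
    · linear_combination ww₂

theorem IsPresentedBy.normalRelations [CharZero k] {c : Fin 4 → A} {x : Fin 2 × Fin 2 → B}
    (h : IsPresentedBy ψ x (normalEquations κ c)) :
    NormalRelations ψ c (x (0, 0)) (x (0, 1)) (x (1, 0)) (x (1, 1)) :=
  (normalRelations_iff κ).mpr fun i => by
    rw [← RingHom.mem_ker, h.2]
    exact Ideal.subset_span ⟨i, rfl⟩

/-- A ring presented by the normal equations maps to any solution of the normal relations. -/
theorem IsPresentedBy.exists_ringHom [CharZero k] {c : Fin 4 → A} {x : Fin 2 × Fin 2 → B}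
    (h : IsPresentedBy ψ x (normalEquations κ c)) {y : Fin 2 × Fin 2 → B}
    (hy : NormalRelations ψ c (y (0, 0)) (y (0, 1)) (y (1, 0)) (y (1, 1))) :
    ∃ f : B →+* B, (∀ a, f (ψ a) = ψ a) ∧ ∀ p, f (x p) = y p := by
  have hker : RingHom.ker (MvPolynomial.eval₂Hom ψ x) ≤
      RingHom.ker (MvPolynomial.eval₂Hom ψ y) := by
    rw [h.2, Ideal.span_le]
    rintro _ ⟨i, rfl⟩
    exact (normalRelations_iff κ).mp hy i
  let f := RingHom.liftOfSurjective (MvPolynomial.eval₂Hom ψ x) h.1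
    ⟨MvPolynomial.eval₂Hom ψ y, hker⟩
  have hf : ∀ q, f (MvPolynomial.eval₂Hom ψ x q) = MvPolynomial.eval₂Hom ψ y q :=
    RingHom.liftOfRightInverse_comp_apply _ _ _ ⟨MvPolynomial.eval₂Hom ψ y, hker⟩
  refine ⟨f, fun a => ?_, fun p => ?_⟩
  · simpa using hf (MvPolynomial.C a)
  · simpa using hf (MvPolynomial.X p)

end Presentation

/-! ### Linear equations become normal equations in new coordinates. -/

section ChangeOfCoordinates

variable {A B : Type u} [CommRing A] [CommRing B] {ψ : A →+* B} {k : Type u} [Field k]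
  (κ : k →+* A)

/-- The linear substitution of variables `(z_j, w_j)ᵗ ↦ g (z_j, w_j)ᵗ`. -/
def substitution (g : Matrix (Fin 2) (Fin 2) k) : CoordRing A →ₐ[A] CoordRing A :=
  MvPolynomial.aeval fun p => ∑ q, MvPolynomial.C (κ (g p.1 q)) * MvPolynomial.X (q, p.2)

theorem eval_substitution (g : Matrix (Fin 2) (Fin 2) k) (x : Fin 2 × Fin 2 → B)
    (f : CoordRing A) :
    MvPolynomial.eval₂Hom ψ x (substitution κ g f) =
      MvPolynomial.eval₂Hom ψ (fun p => ∑ q, ψ (κ (g p.1 q)) * x (q, p.2)) f := by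
  induction f using MvPolynomial.induction_on with
  | C a => simp [substitution]
  | add f f' hf hf' => rw [map_add, map_add, map_add, hf, hf']
  | mul_X f p hf =>
    rw [map_mul, map_mul, map_mul, hf]
    simp [substitution]

theorem substitution_X (g : Matrix (Fin 2) (Fin 2) k) (p : Fin 2 × Fin 2) :
    substitution κ g (MvPolynomial.X p : CoordRing A) =
      MvPolynomial.C (κ (g p.1 0)) * MvPolynomial.X (0, p.2) +
        MvPolynomial.C (κ (g p.1 1)) * MvPolynomial.X (1, p.2) := by
  simp [substitution, Fin.sum_univ_two]

theorem substitution_C (g : Matrix (Fin 2) (Fin 2) k) (a : A) :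
    substitution κ g (MvPolynomial.C a) = MvPolynomial.C a := by
  simp [substitution]

theorem substitution_comp (g h : Matrix (Fin 2) (Fin 2) k) :
    (substitution κ g).comp (substitution κ h) = (substitution κ (h * g) : _ →ₐ[A] _) := by
  refine MvPolynomial.algHom_ext fun p => ?_
  simp only [AlgHom.comp_apply, substitution_X, map_add, map_mul, substitution_C,
    Matrix.mul_apply, Fin.sum_univ_two]
  ring

theorem substitution_one :
    substitution κ (1 : Matrix (Fin 2) (Fin 2) k) = AlgHom.id A (CoordRing A) := by
  refine MvPolynomial.algHom_ext fun p => ?_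
  obtain ⟨i, j⟩ := p
  rw [substitution_X]
  revert i
  simp [Fin.forall_fin_two]

/-- Each entry of S² is a symmetric bilinear form in the two vectors, so pZ + qW and rZ + sW expand
as in the symmetric square of a binary form. -/
theorem substitution_quadrics (p q r s : k) (i : Fin 3) :
    substitution κ !![p, q; r, s] (quadrics κ 0 i) =
        MvPolynomial.C (κ (p ^ 2)) * quadrics κ 0 i +
          MvPolynomial.C (κ (2 * (p * q))) * quadrics κ 1 i +
          MvPolynomial.C (κ (q ^ 2)) * quadrics κ 2 i ∧
      substitution κ !![p, q; r, s] (quadrics κ 1 i) =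
        MvPolynomial.C (κ (p * r)) * quadrics κ 0 i +
          MvPolynomial.C (κ (p * s + q * r)) * quadrics κ 1 i +
          MvPolynomial.C (κ (q * s)) * quadrics κ 2 i ∧
      substitution κ !![p, q; r, s] (quadrics κ 2 i) =
        MvPolynomial.C (κ (r ^ 2)) * quadrics κ 0 i +
          MvPolynomial.C (κ (2 * (r * s))) * quadrics κ 1 i +
          MvPolynomial.C (κ (s ^ 2)) * quadrics κ 2 i := by
  have h2 : (MvPolynomial.C (κ 2) : CoordRing A) = 2 := by
    rw [map_ofNat κ 2, map_ofNat MvPolynomial.C 2]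
  refine ⟨?_, ?_, ?_⟩ <;> fin_cases i <;>
    simp [quadrics, symSq, coordVector, substitution, Fin.sum_univ_two, h2] <;> ring

theorem substitution_blockMul (g : Matrix (Fin 2) (Fin 2) k) (c : Fin 4 → A) (p : Fin 2)
    (i : Fin 3) : substitution κ g (blockMul c p i) =
      MvPolynomial.C (κ (g p 0)) * blockMul c 0 i +
        MvPolynomial.C (κ (g p 1)) * blockMul c 1 i := by
  fin_cases i <;>
    simp [blockMul, tripleBlock, coordVector, substitution, Fin.sum_univ_two, Matrix.mulVec,
      dotProduct] <;> ring

/-- The matrix by which `g = (p, q; r, s)` acts on `S²(Z), S²(Z, W), S²(W)`, the second row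
being doubled. -/
def symSquare (p q r s : k) : Matrix (Fin 3) (Fin 3) k :=
  !![p ^ 2, 2 * (p * q), q ^ 2; 2 * (p * r), 2 * (p * s + q * r), 2 * (q * s);
    r ^ 2, 2 * (r * s), s ^ 2]

/-- The symmetric square of a 2 × 2 matrix has the cube of its determinant as determinant; the
doubled middle row contributes the factor 2. -/
theorem isUnit_det_symSquare [CharZero k] {p q r s : k} (h : p * s - q * r ≠ 0) :
    IsUnit (symSquare p q r s).det := by
  have : (symSquare p q r s).det = 2 * (p * s - q * r) ^ 3 := by
    rw [symSquare, Matrix.det_fin_three]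
    simp
    ring
  rw [this]
  exact (mul_ne_zero two_ne_zero (pow_ne_zero 3 h)).isUnit

/-- The quadratic parts match by `substitution_quadrics`, and `h₁`, …, `h₆` say precisely that the
coefficients of C̃Z and C̃W match. Only a constant discrepancy remains. -/
theorem substitution_normalEquations {p q r s : k} {e : Fin 4 → k}
    (h₁ : p ^ 2 * e 1 - 2 * (p * q) * e 2 + q ^ 2 * e 3 = r)
    (h₂ : p ^ 2 * e 0 - 2 * (p * q) * e 1 + q ^ 2 * e 2 = s)
    (h₃ : p * r * e 1 - (p * s + q * r) * e 2 + q * s * e 3 = 0)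
    (h₄ : p * r * e 0 - (p * s + q * r) * e 1 + q * s * e 2 = 0)
    (h₅ : r ^ 2 * e 1 - 2 * (r * s) * e 2 + s ^ 2 * e 3 = p)
    (h₆ : r ^ 2 * e 0 - 2 * (r * s) * e 1 + s ^ 2 * e 2 = q)
    (c : Fin 4 → A) (d : Fin 3 → Fin 3 → A) (n i : Fin 3) :
    substitution κ !![p, q; r, s] (normalEquations κ c (n, i)) =
      ∑ m, MvPolynomial.C (κ (symSquare p q r s n m)) * linearEquations κ e c d (m, i) +
        MvPolynomial.C (∑ m, κ (symSquare p q r s n m) * d m i -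
          ![0, constantVector c i, 0] n) := by
  obtain ⟨q₀, q₁, q₂⟩ := substitution_quadrics (A := A) κ p q r s i
  have h2 : (MvPolynomial.C (κ 2) : CoordRing A) = 2 := by
    rw [map_ofNat κ 2, map_ofNat MvPolynomial.C 2]
  let κ' : k →+* CoordRing A := MvPolynomial.C.comp κ
  replace h₁ := congrArg κ' h₁
  replace h₂ := congrArg κ' h₂
  replace h₃ := congrArg κ' h₃
  replace h₄ := congrArg κ' h₄
  replace h₅ := congrArg κ' h₅
  replace h₆ := congrArg κ' h₆
  simp only [κ', map_add, map_sub, map_mul, map_pow, RingHom.comp_apply, h2, map_zero] at h₁ h₂ h₃ h₄ h₅ h₆ q₀ q₁ q₂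
  fin_cases n
  · simp [normalEquations, linearEquations, symSquare, Fin.sum_univ_three, q₀,
      substitution_blockMul, tripleBlock, h2]
    linear_combination blockMul c 0 i * h₁ + blockMul c 1 i * h₂
  · simp [normalEquations, linearEquations, symSquare, Fin.sum_univ_three, q₁,
      substitution_blockMul, tripleBlock, h2,
      map_ofNat (substitution κ !![p, q; r, s]) 2]
    linear_combination 2 * blockMul c 0 i * h₃ + 2 * blockMul c 1 i * h₄
  · simp [normalEquations, linearEquations, symSquare, Fin.sum_univ_three, q₂,
      substitution_blockMul, tripleBlock, h2]
    linear_combination blockMul c 0 i * h₅ + blockMul c 1 i * h₆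

/-- If the normal equations hold up to constants, then they hold. -/
theorem normalEquations_constants_eq_zero [CharZero k] {c : Fin 4 → A} {y : Fin 2 × Fin 2 → B}
    (hind : Independent ψ (y (0, 0)) (y (0, 1)) (y (1, 0)) (y (1, 1))) {δ : Fin 3 → Fin 3 → A}
    (hv : ∀ n i, MvPolynomial.eval₂Hom ψ y (normalEquations κ c (n, i)) = ψ (δ n i))
    (n i : Fin 3) : δ n i = 0 := by
  have h2ψ : ψ 2 = 2 := map_ofNat ψ 2
  have hκ : ψ (κ 2⁻¹) * 2 = 1 := by
    have : κ 2⁻¹ * κ 2 = 1 := by rw [← map_mul, inv_mul_cancel₀ two_ne_zero, map_one]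
    simpa [map_ofNat κ 2, h2ψ] using congrArg ψ this
  simp only [Fin.forall_fin_succ] at hv
  simp [h2ψ, normalEquations, quadrics, symSq, coordVector, blockMul, tripleBlock,
    constantVector, Matrix.mulVec, dotProduct, Fin.sum_univ_two] at hv
  obtain ⟨⟨zz₀, zz₁, zz₂⟩, ⟨zw₀, zw₁, zw₂⟩, ww₀, ww₁, ww₂⟩ := hv
  obtain ⟨k₀, k₁, k₂⟩ := constants_eq (isUnit_two_of_charZero κ) hind c (δ 0)
    (δ 1 + constantVector c) (δ 2) (by linear_combination zz₀)
    (by linear_combination zz₁ - y (0, 0) * y (0, 1) * hκ) (by linear_combination zz₂)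
    (by simp [constantVector, h2ψ]; linear_combination zw₀)
    (by
      simp [constantVector]
      linear_combination zw₁ - (y (0, 0) * y (1, 1) + y (0, 1) * y (1, 0)) * hκ)
    (by simp [constantVector, h2ψ]; linear_combination zw₂)
    (by linear_combination ww₀)
    (by linear_combination ww₁ - y (1, 0) * y (1, 1) * hκ) (by linear_combination ww₂)
  fin_cases n
  · exact congrFun k₀ i
  · exact congrFun (add_eq_right.mp k₁) i
  · exact congrFun k₂ i

theorem eq_substitution_of_mul_eq_one {g : Matrix (Fin 2) (Fin 2) k}
    {T' T : Matrix (Fin 3) (Fin 3) k} (hT : T' * T = 1) {f h : Fin 3 → CoordRing A}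
    (hf : ∀ n, substitution κ g (f n) = ∑ m, MvPolynomial.C (κ (T n m)) * h m) (n : Fin 3) :
    h n = substitution κ g (∑ m, MvPolynomial.C (κ (T' n m)) * f m) := by
  have hT' : ∀ l, ∑ m, T' n m * T m l = (1 : Matrix (Fin 3) (Fin 3) k) n l := fun l => by
    rw [← hT, Matrix.mul_apply]
  simp only [map_sum, map_mul, substitution_C, hf, Finset.mul_sum]
  rw [Finset.sum_comm]
  simp only [← mul_assoc, ← map_mul, ← Finset.sum_mul, ← map_sum, hT']
  simp [Matrix.one_apply, apply_ite]

theorem substitution_left_inv {g h : Matrix (Fin 2) (Fin 2) k} (hgh : h * g = 1)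
    (f : CoordRing A) : substitution κ g (substitution κ h f) = f := by
  rw [← AlgHom.comp_apply, substitution_comp, hgh, substitution_one, AlgHom.id_apply]

theorem map_mem_of_mem_span (σ : CoordRing A →ₐ[A] CoordRing A) {s : Set (CoordRing A)}
    {I : Ideal (CoordRing A)} (h : ∀ f ∈ s, σ f ∈ I) {f : CoordRing A} (hf : f ∈ Ideal.span s) :
    σ f ∈ I :=
  (Ideal.span_le.mpr h : Ideal.span s ≤ I.comap (σ : CoordRing A →+* CoordRing A)) hf

/-- A ring presented by linear equations is presented by the normal equations in new
coordinates. -/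
theorem IsPresentedBy.normalEquations [CharZero k] {p q r s : k} {e : Fin 4 → k}
    (hdet : p * s - q * r ≠ 0)
    (h₁ : p ^ 2 * e 1 - 2 * (p * q) * e 2 + q ^ 2 * e 3 = r)
    (h₂ : p ^ 2 * e 0 - 2 * (p * q) * e 1 + q ^ 2 * e 2 = s)
    (h₃ : p * r * e 1 - (p * s + q * r) * e 2 + q * s * e 3 = 0)
    (h₄ : p * r * e 0 - (p * s + q * r) * e 1 + q * s * e 2 = 0)
    (h₅ : r ^ 2 * e 1 - 2 * (r * s) * e 2 + s ^ 2 * e 3 = p)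
    (h₆ : r ^ 2 * e 0 - 2 * (r * s) * e 1 + s ^ 2 * e 2 = q)
    {c : Fin 4 → A} {d : Fin 3 → Fin 3 → A} {x y : Fin 2 × Fin 2 → B}
    (hx : IsPresentedBy ψ x (linearEquations κ e c d))
    (hy : ∀ n, y n = ∑ m, ψ (κ (!![p, q; r, s] n.1 m)) * x (m, n.2))
    (hind : Independent ψ (y (0, 0)) (y (0, 1)) (y (1, 0)) (y (1, 1))) :
    IsPresentedBy ψ y (normalEquations κ c) := by
  have h2ψ : ψ 2 = 2 := map_ofNat ψ 2
  set g : Matrix (Fin 2) (Fin 2) k := !![p, q; r, s] with hg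
  have hgdet : IsUnit g.det := by
    rw [hg, Matrix.det_fin_two_of]
    exact hdet.isUnit
  obtain rfl : y = fun n => ∑ m, ψ (κ (g n.1 m)) * x (m, n.2) := funext hy
  set y : Fin 2 × Fin 2 → B := fun n => ∑ m, ψ (κ (g n.1 m)) * x (m, n.2) with hydef
  have heval := eval_substitution (ψ := ψ) κ g x
  have hinv := substitution_left_inv (A := A) κ (Matrix.nonsing_inv_mul _ hgdet)
  have hinv' := substitution_left_inv (A := A) κ (Matrix.mul_nonsing_inv _ hgdet)
  set δ : Fin 3 → Fin 3 → A := fun n i =>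
    ∑ m, κ (symSquare p q r s n m) * d m i - ![0, constantVector c i, 0] n with hδ
  have hsub : ∀ n i, substitution κ g (AlgCover.normalEquations κ c (n, i)) =
      ∑ m, MvPolynomial.C (κ (symSquare p q r s n m)) * linearEquations κ e c d (m, i) +
        MvPolynomial.C (δ n i) := substitution_normalEquations κ h₁ h₂ h₃ h₄ h₅ h₆ c d
  have hlin : ∀ i, MvPolynomial.eval₂Hom ψ x (linearEquations κ e c d i) = 0 := fun i => by
    rw [← RingHom.mem_ker, hx.2]
    exact Ideal.subset_span ⟨i, rfl⟩
  have hval : ∀ n i, MvPolynomial.eval₂Hom ψ y (AlgCover.normalEquations κ c (n, i)) =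
      ψ (δ n i) := fun n i => by
    rw [← heval, hsub, map_add, map_sum]
    simp only [map_mul, hlin, mul_zero, Finset.sum_const_zero, zero_add]
    simp [hδ]
  -- The values of the normal equations at `y` are the constants `δ`, so associativity and
  -- independence force them to vanish.
  have hδ0 := normalEquations_constants_eq_zero κ hind hval
  have hsub' : ∀ n i, substitution κ g (AlgCover.normalEquations κ c (n, i)) =
      ∑ m, MvPolynomial.C (κ (symSquare p q r s n m)) * linearEquations κ e c d (m, i) :=
    fun n i => by rw [hsub, hδ0 n i, map_zero, add_zero]
  refine ⟨fun b => ?_, le_antisymm (fun f hf => ?_) ?_⟩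
  · obtain ⟨f, rfl⟩ := hx.1 b
    exact ⟨substitution κ g⁻¹ f, by rw [← heval, hinv]⟩
  -- A relation among the new coordinates is moved to the old ones by `g` and brought back by `g⁻¹`;
  -- inverting `symSquare` expresses the old generators through the new ones.
  · have hf' : substitution κ g f ∈ Ideal.span (Set.range (linearEquations κ e c d)) := by
      rw [← hx.2, RingHom.mem_ker, heval]
      exact hf
    rw [← hinv' f]
    refine map_mem_of_mem_span (substitution κ g⁻¹) (fun f h => ?_) hf'
    obtain ⟨⟨n, i⟩, rfl⟩ := h
    have hT := Matrix.nonsing_inv_mul _ (isUnit_det_symSquare hdet)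
    have key : linearEquations κ e c d (n, i) = substitution κ g
        (∑ m, MvPolynomial.C (κ ((symSquare p q r s)⁻¹ n m)) *
          AlgCover.normalEquations κ c (m, i)) :=
      eq_substitution_of_mul_eq_one κ hT (f := fun m => AlgCover.normalEquations κ c (m, i))
        (h := fun m => linearEquations κ e c d (m, i)) (fun m => hsub' m i) n
    rw [key, hinv']
    exact Ideal.sum_mem _ fun m _ => Ideal.mul_mem_left _ _ (Ideal.subset_span ⟨_, rfl⟩)
  · rw [Ideal.span_le]
    rintro _ ⟨⟨n, i⟩, rfl⟩
    rw [SetLike.mem_coe, RingHom.mem_ker, hval, hδ0, map_zero]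

end ChangeOfCoordinates

/-! ### Sheaves of modules and their sections. -/

section Sections

variable {Y : Scheme.{u}} {M N : Y.Modules}

theorem app_map (f : M ⟶ N) {U V : Y.Opens} (i : V ⟶ U) (x : Γ(M, U)) :
    f.app V (M.presheaf.map i.op x) = N.presheaf.map i.op (f.app U x) :=
  congr($(f.mapPresheaf.naturality i.op) x)

theorem map_map (M : Y.Modules) {U V W : Y.Opens} (i : V ⟶ U) (j : W ⟶ V) (x : Γ(M, U)) :
    M.presheaf.map j.op (M.presheaf.map i.op x) = M.presheaf.map (j ≫ i).op x :=
  congr($(M.presheaf.map_comp i.op j.op) x).symm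

theorem eq_of_forall_mem (M : Y.Modules) {U : Y.Opens} {x y : Γ(M, U)}
    (h : ∀ p ∈ U, ∃ (V : Y.Opens) (i : V ⟶ U), p ∈ V ∧
      M.presheaf.map i.op x = M.presheaf.map i.op y) : x = y := by
  choose V i hp hV using fun p : U => h p.1 p.2
  refine TopCat.Sheaf.eq_of_locally_eq' (⟨M.presheaf, M.isSheaf⟩ : TopCat.Sheaf Ab Y) V U i
    (fun p hp' => ?_) x y hV
  exact TopologicalSpace.Opens.mem_iSup.mpr ⟨⟨p, hp'⟩, hp _⟩

theorem ring_eq_of_forall_mem {U : Y.Opens} {x y : Γ(Y, U)}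
    (h : ∀ p ∈ U, ∃ (V : Y.Opens) (i : V ⟶ U), p ∈ V ∧
      Y.presheaf.map i.op x = Y.presheaf.map i.op y) : x = y :=
  eq_of_forall_mem (structureSheaf Y) h

/-- A morphism of sheaves of modules, from its linear maps on sections. -/
def homOfLinear (f : ∀ U : Y.Opens, Γ(M, U) →ₗ[Γ(Y, U)] Γ(N, U))
    (hf : ∀ {U V : Y.Opens} (i : V ⟶ U) (x : Γ(M, U)),
      f V (M.presheaf.map i.op x) = N.presheaf.map i.op (f U x)) : M ⟶ N :=
  SheafOfModules.Hom.mk (PresheafOfModules.homMk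
    { app := fun U => AddCommGrpCat.ofHom (f U.unop).toAddMonoidHom
      naturality := fun _ _ i => AddCommGrpCat.hom_ext (AddMonoidHom.ext fun x => hf i.unop x) }
    fun U r x => (f U.unop).map_smul r x)

theorem isIso_iff_bijective {f : M ⟶ N} :
    IsIso f ↔ ∀ U, Function.Bijective (f.app U) := by
  rw [Scheme.Modules.Hom.isIso_iff_isIso_app]
  exact forall_congr' fun U => ConcreteCategory.isIso_iff_bijective _

/-- A morphism of sheaves of modules is an isomorphism if it is so on a basis. -/
theorem isIso_of_basis {f : M ⟶ N} {ι : Type u} {B : ι → Y.Opens}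
    (hB : TopologicalSpace.Opens.IsBasis (Set.range B))
    (h : ∀ i, Function.Bijective (f.app (B i))) : IsIso f := by
  let F : TopCat.Sheaf Ab Y := ⟨M.presheaf, M.isSheaf⟩
  let G : TopCat.Sheaf Ab Y := ⟨N.presheaf, N.isSheaf⟩
  let φ : F ⟶ G := ⟨f.mapPresheaf⟩
  have : IsIso φ := TopCat.Sheaf.isIso_iff_isIso_basis hB fun i =>
    (ConcreteCategory.isIso_iff_bijective _).mpr (h i)
  have : IsIso ((TopCat.Sheaf.forget Ab Y).map φ) := inferInstance
  exact (isIso_iff_of_reflects_iso f (Scheme.Modules.toPresheaf Y)).mp this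

variable {K : Y.Modules}

theorem biprod_desc_app (f : M ⟶ K) (g : N ⟶ K) (U : Y.Opens) (x : Γ(M ⊞ N, U)) :
    (biprod.desc f g).app U x =
      f.app U ((biprod.fst : M ⊞ N ⟶ M).app U x) + g.app U ((biprod.snd : M ⊞ N ⟶ N).app U x) := by
  rw [biprod.desc_eq]
  rfl

theorem biprod_sections_bijective (M N : Y.Modules) (U : Y.Opens) :
    Function.Bijective (fun x : Γ(M ⊞ N, U) => ((biprod.fst : M ⊞ N ⟶ M).app U x,
      (biprod.snd : M ⊞ N ⟶ N).app U x)) := by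
  have e₁ : ∀ x : Γ(M, U), (biprod.fst : M ⊞ N ⟶ M).app U ((biprod.inl : M ⟶ M ⊞ N).app U x) = x :=
    fun x => congr(($(biprod.inl_fst (X := M) (Y := N))).app U x)
  have e₂ : ∀ x : Γ(M, U), (biprod.snd : M ⊞ N ⟶ N).app U ((biprod.inl : M ⟶ M ⊞ N).app U x) = 0 :=
    fun x => congr(($(biprod.inl_snd (X := M) (Y := N))).app U x)
  have e₃ : ∀ x : Γ(N, U), (biprod.fst : M ⊞ N ⟶ M).app U ((biprod.inr : N ⟶ M ⊞ N).app U x) = 0 :=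
    fun x => congr(($(biprod.inr_fst (X := M) (Y := N))).app U x)
  have e₄ : ∀ x : Γ(N, U), (biprod.snd : M ⊞ N ⟶ N).app U ((biprod.inr : N ⟶ M ⊞ N).app U x) = x :=
    fun x => congr(($(biprod.inr_snd (X := M) (Y := N))).app U x)
  have e₅ : ∀ x : Γ(M ⊞ N, U),
      (biprod.inl : M ⟶ M ⊞ N).app U ((biprod.fst : M ⊞ N ⟶ M).app U x) +
        (biprod.inr : N ⟶ M ⊞ N).app U ((biprod.snd : M ⊞ N ⟶ N).app U x) = x :=
    fun x => congr(($(biprod.total (X := M) (Y := N))).app U x)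
  constructor
  · intro x y h
    rw [← e₅ x, ← e₅ y, (Prod.mk.inj h).1, (Prod.mk.inj h).2]
  · rintro ⟨x, y⟩
    refine ⟨(biprod.inl : M ⟶ M ⊞ N).app U x + (biprod.inr : N ⟶ M ⊞ N).app U y, ?_⟩
    simp only [map_add, e₁, e₂, e₃, e₄, add_zero, zero_add]

/-- `M ⊕ N ⟶ K` is an isomorphism if and only if `M(U) × N(U) → K(U)` is bijective for all `U`. -/
theorem isIso_biprod_desc_iff {f : M ⟶ K} {g : N ⟶ K} :
    IsIso (biprod.desc f g) ↔ ∀ U : Y.Opens,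
      Function.Bijective fun x : Γ(M, U) × Γ(N, U) => f.app U x.1 + g.app U x.2 := by
  rw [isIso_iff_bijective]
  refine forall_congr' fun U => ?_
  rw [← Function.Bijective.of_comp_iff _ (biprod_sections_bijective M N U)]
  exact Iff.of_eq (congrArg _ (funext fun x => biprod_desc_app f g U x))

end Sections

/-! ### Frames and direct sum decompositions. -/

section Frames

variable {Y : Scheme.{u}} {M N P D : Y.Modules}

/-- The section `r` of the structure sheaf, as a section of a sheaf of modules. -/
def unitSection {U : Y.Opens} (r : Γ(Y, U)) : Γ(structureSheaf Y, U) := r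

theorem app_unitSection (f : structureSheaf Y ⟶ D) {U : Y.Opens} (r : Γ(Y, U)) :
    f.app U (unitSection r) = r • f.app U (unitSection 1) := by
  rw [← Scheme.Modules.Hom.app_smul]
  exact congrArg _ (mul_one r).symm

theorem map_unitSection {U V : Y.Opens} (i : V ⟶ U) (r : Γ(Y, U)) :
    (structureSheaf Y).presheaf.map i.op (unitSection r) = unitSection (Y.presheaf.map i.op r) :=
  rfl

/-- A finite sum of multiples of sections restricts termwise. -/
theorem map_sum_smul (M : Y.Modules) {n : ℕ} {U V : Y.Opens} (i : V ⟶ U) (r : Fin n → Γ(Y, U))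
    (b : Fin n → Γ(M, U)) :
    M.presheaf.map i.op (∑ j, r j • b j) =
      ∑ j, Y.presheaf.map i.op (r j) • M.presheaf.map i.op (b j) := by
  rw [map_sum]
  exact Finset.sum_congr rfl fun j _ => Scheme.Modules.map_smul M i _ _

/-- Being a frame can be checked locally. -/
theorem isFrame_of_locally {n : ℕ} {U : Y.Opens} {b : Fin n → Γ(M, U)}
    (h : ∀ (V : Y.Opens) (_ : V ⟶ U), ∀ p ∈ V, ∃ (W : Y.Opens) (_ : W ⟶ V) (j : W ⟶ U), p ∈ W ∧
      LinearIndependent Γ(Y, W) (fun l => M.presheaf.map j.op (b l)) ∧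
      Submodule.span Γ(Y, W) (Set.range fun l => M.presheaf.map j.op (b l)) = ⊤) :
    IsFrame M U b := by
  have hLI : ∀ (V : Y.Opens) (i : V ⟶ U),
      LinearIndependent Γ(Y, V) (fun l => M.presheaf.map i.op (b l)) := by
    intro V i
    rw [Fintype.linearIndependent_iff]
    intro g hg l
    refine ring_eq_of_forall_mem fun p hp => ?_
    obtain ⟨W, k, j, hpW, hW, -⟩ := h V i p hp
    refine ⟨W, k, hpW, ?_⟩
    rw [map_zero]
    rw [Fintype.linearIndependent_iff] at hW
    refine hW (fun l => Y.presheaf.map k.op (g l)) ?_ l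
    have := congrArg (M.presheaf.map k.op) hg
    rw [map_sum_smul, map_zero] at this
    simp only [map_map] at this
    exact this
  refine fun V i => ⟨hLI V i, ?_⟩
  rw [eq_top_iff]
  rintro x -
  choose W k j hpW _ hW using fun p : V => h V i p.1 p.2
  have hx : ∀ p, ∃ c : Fin n → Γ(Y, W p), ∑ l, c l • M.presheaf.map (j p).op (b l) =
      M.presheaf.map (k p).op x := fun p =>
    (Submodule.mem_span_range_iff_exists_fun _).mp (hW p ▸ Submodule.mem_top)
  choose c hc using hx
  have hcov : V ≤ iSup W := fun p hp =>
    TopologicalSpace.Opens.mem_iSup.mpr ⟨⟨p, hp⟩, hpW _⟩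
  -- Linear independence makes the local coefficients unique, so they agree on overlaps and glue.
  have hcompat : ∀ p q, ∀ (T : Y.Opens) (t : T ⟶ W p) (t' : T ⟶ W q) l,
      Y.presheaf.map t.op (c p l) = Y.presheaf.map t'.op (c q l) := by
    intro p q T t t' l
    have h₁ := congrArg (M.presheaf.map t.op) (hc p)
    have h₂ := congrArg (M.presheaf.map t'.op) (hc q)
    rw [map_sum_smul] at h₁ h₂
    simp only [map_map] at h₁ h₂
    have hT := Fintype.linearIndependent_iff.mp (hLI T (t ≫ j p))
      (fun l => Y.presheaf.map t.op (c p l) - Y.presheaf.map t'.op (c q l)) (by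
        simp only [sub_smul, Finset.sum_sub_distrib]
        exact sub_eq_zero.mpr (h₁.trans h₂.symm)) l
    exact sub_eq_zero.mp hT
  have hglue : ∀ l, ∃ g : Γ(Y, V), ∀ p, Y.presheaf.map (k p).op g = c p l := fun l =>
    (TopCat.Sheaf.existsUnique_gluing' Y.sheaf W V k hcov (fun p => c p l)
      fun p q => hcompat p q _ _ _ l).exists
  choose g hg using hglue
  refine (Submodule.mem_span_range_iff_exists_fun _).mpr ⟨g, eq_of_forall_mem M fun p hp => ?_⟩
  refine ⟨W ⟨p, hp⟩, k ⟨p, hp⟩, hpW _, ?_⟩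
  rw [map_sum_smul, ← hc]
  simp only [hg, map_map]
  rfl

/-- If `D = 𝒪 ⊕ M` with `M` locally free of rank `n`, then `D` is locally free of rank `n + 1`. -/
theorem IsLocallyFreeOfRank.of_bijective {n : ℕ} (hM : IsLocallyFreeOfRank M n)
    (f : structureSheaf Y ⟶ D) (g : M ⟶ D)
    (h : ∀ U : Y.Opens, Function.Bijective fun x : Γ(structureSheaf Y, U) × Γ(M, U) =>
      f.app U x.1 + g.app U x.2) : IsLocallyFreeOfRank D (n + 1) := by
  intro y
  obtain ⟨U, hy, b, hb⟩ := hM y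
  refine ⟨U, hy, Fin.cons (f.app U (unitSection 1)) fun l => g.app U (b l), fun V i => ?_⟩
  have hcons : ∀ l : Fin (n + 1), D.presheaf.map i.op
      ((Fin.cons (f.app U (unitSection 1)) fun l => g.app U (b l) : Fin (n + 1) → Γ(D, U)) l) =
      (Fin.cons (f.app V (unitSection 1)) fun l => g.app V (M.presheaf.map i.op (b l)) :
        Fin (n + 1) → Γ(D, V)) l := by
    intro l
    refine Fin.cases ?_ (fun l => ?_) l
    · simp only [Fin.cons_zero]
      rw [← app_map, map_unitSection, map_one]
    · simp only [Fin.cons_succ]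
      rw [app_map]
  simp only [hcons]
  obtain ⟨hLI, hspan⟩ := hb V i
  have hsum : ∀ c : Fin (n + 1) → Γ(Y, V), ∑ l, c l •
      (Fin.cons (f.app V (unitSection 1)) fun l => g.app V (M.presheaf.map i.op (b l)) :
        Fin (n + 1) → Γ(D, V)) l =
      f.app V (unitSection (c 0)) + g.app V (∑ l : Fin n, c l.succ • M.presheaf.map i.op (b l)) := by
    intro c
    rw [Fin.sum_univ_succ, map_sum, app_unitSection f (c 0)]
    simp only [Fin.cons_zero, Fin.cons_succ, Scheme.Modules.Hom.app_smul]
  constructor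
  · rw [Fintype.linearIndependent_iff] at hLI ⊢
    intro c hc
    rw [hsum] at hc
    have := (h V).1 (a₁ := (unitSection (c 0), ∑ l : Fin n, c l.succ • M.presheaf.map i.op (b l)))
      (a₂ := 0) (by simpa using hc)
    obtain ⟨h₀, h₁⟩ := Prod.mk.inj this
    exact Fin.cases h₀ (hLI _ h₁)
  · rw [eq_top_iff]
    rintro x -
    obtain ⟨⟨r, m⟩, rfl⟩ := (h V).2 x
    obtain ⟨c, rfl⟩ := (Submodule.mem_span_range_iff_exists_fun _).mp
      (hspan ▸ Submodule.mem_top : m ∈ Submodule.span Γ(Y, V) (Set.range _))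
    exact (Submodule.mem_span_range_iff_exists_fun _).mpr
      ⟨Fin.cons r c, by rw [hsum]; simp only [Fin.cons_zero, Fin.cons_succ]; rfl⟩

/-- A fourfold direct sum decomposition, on sections. -/
theorem bijective_biprod_desc_iff (f : N ⟶ D) (a b : M ⟶ D) (t : P ⟶ D) (U : Y.Opens) :
    Function.Bijective ((biprod.desc f (biprod.desc a (biprod.desc b t))).app U) ↔
      Function.Bijective fun x : Γ(N, U) × Γ(M, U) × Γ(M, U) × Γ(P, U) =>
        f.app U x.1 + (a.app U x.2.1 + (b.app U x.2.2.1 + t.app U x.2.2.2)) := by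
  have h₁ := biprod_sections_bijective N (M ⊞ (M ⊞ P)) U
  have h₂ := biprod_sections_bijective M (M ⊞ P) U
  have h₃ := biprod_sections_bijective M P U
  have h := (Function.bijective_id.prodMap (Function.bijective_id.prodMap h₃)).comp
    ((Function.bijective_id.prodMap h₂).comp h₁)
  rw [← Function.Bijective.of_comp_iff _ h]
  refine Iff.of_eq (congrArg _ (funext fun x => ?_))
  simp only [biprod_desc_app]
  rfl

end Frames

/-! ### Constants of k acting on sheaves of modules. -/

section Constants

variable {k : Type u} [Field k] {Y : Scheme.{u}} (s : Y ⟶ Spec (.of k)) {M N : Y.Modules}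

theorem map_constants {U V : Y.Opens} (i : V ⟶ U) (c : k) :
    Y.presheaf.map i.op (constants s U c) = constants s V c := by
  have := congr($(Y.presheaf.map_comp (homOfLE (le_top : U ≤ ⊤)).op i.op)
    ((s.appTop.hom.comp (Scheme.ΓSpecIso (.of k)).inv.hom) c))
  exact this.symm

/-- Multiplication by a constant. -/
def constMul (M : Y.Modules) (c : k) : M ⟶ M :=
  homOfLinear (fun U => constants s U c • LinearMap.id) fun i x => by
    rw [LinearMap.smul_apply, LinearMap.smul_apply, LinearMap.id_apply, LinearMap.id_apply,
      Scheme.Modules.map_smul, map_constants]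

end Constants

open Scheme.AffineZariskiSite

/-! ### Gluing morphisms over the affine open sets of the base. -/

section Gluing

variable {X Y : Scheme.{u}} (f : X ⟶ Y) {Z : Scheme.{u}}

theorem hom_ext_of_affineOpens {α β : X ⟶ Z}
    (h : ∀ U : Y.affineOpens, (f ⁻¹ᵁ U.1).ι ≫ α = (f ⁻¹ᵁ U.1).ι ≫ β) : α = β :=
  Scheme.Cover.hom_ext (X.openCoverOfIsOpenCover _
    (.comap (iSup_affineOpens_eq_top Y) f.base.1)) _ _ h

/-- A family of morphisms on the preimages of the affine open sets that is compatible with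
restriction to basic open sets agrees on overlaps. -/
theorem comp_eq_comp_of_basicOpen (g : ∀ U : Y.affineOpens, (f ⁻¹ᵁ U.1).toScheme ⟶ Z)
    (hg : ∀ (U W : Y.affineOpens) (_ : ∃ r : Γ(Y, U.1), Y.basicOpen r = W.1) (hle : W.1 ≤ U.1),
      X.homOfLE (f.preimage_mono hle) ≫ g U = g W)
    {P : Scheme.{u}} {U V : Y.affineOpens}
    (a : P ⟶ (f ⁻¹ᵁ U.1).toScheme) (b : P ⟶ (f ⁻¹ᵁ V.1).toScheme)
    (hab : a ≫ (f ⁻¹ᵁ U.1).ι = b ≫ (f ⁻¹ᵁ V.1).ι) : a ≫ g U = b ≫ g V := by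
  refine Scheme.hom_ext_of_forall _ _ fun p => ?_
  have hb : (a p).1 = (b p).1 := congr($hab p)
  have hpV : f (a p).1 ∈ V.1 := by
    rw [hb]
    exact (b p).2
  -- The overlap of two affine open sets need not be affine, but each of its points has a
  -- neighbourhood that is basic in both, where the hypothesis applies twice.
  obtain ⟨r, s, hrs, hr⟩ := exists_basicOpen_le_affine_inter U.2 V.2 (f (a p).1)
    ⟨(a p).2, hpV⟩
  let W : Y.affineOpens := ⟨Y.basicOpen r, U.2.basicOpen r⟩
  have hWU : W.1 ≤ U.1 := Y.basicOpen_le r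
  have hWV : W.1 ≤ V.1 := hrs.le.trans (Y.basicOpen_le s)
  let O : P.Opens := (a ≫ (f ⁻¹ᵁ U.1).ι) ⁻¹ᵁ f ⁻¹ᵁ W.1
  have hO : Set.range (O.ι ≫ a ≫ (f ⁻¹ᵁ U.1).ι) ⊆ Set.range (f ⁻¹ᵁ W.1).ι := by
    rintro _ ⟨q, rfl⟩
    rw [Scheme.Opens.range_ι]
    exact q.2
  let c : O.toScheme ⟶ (f ⁻¹ᵁ W.1).toScheme := IsOpenImmersion.lift (f ⁻¹ᵁ W.1).ι _ hO
  have hc : c ≫ (f ⁻¹ᵁ W.1).ι = O.ι ≫ a ≫ (f ⁻¹ᵁ U.1).ι := IsOpenImmersion.lift_fac _ _ hO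
  have ha : c ≫ X.homOfLE (f.preimage_mono hWU) = O.ι ≫ a := by
    rw [← cancel_mono (f ⁻¹ᵁ U.1).ι, Category.assoc, Scheme.homOfLE_ι, hc, Category.assoc]
  have hb : c ≫ X.homOfLE (f.preimage_mono hWV) = O.ι ≫ b := by
    rw [← cancel_mono (f ⁻¹ᵁ V.1).ι, Category.assoc, Scheme.homOfLE_ι, hc, Category.assoc, hab]
  refine ⟨O, hr, ?_⟩
  rw [← Category.assoc, ← Category.assoc, ← ha, ← hb, Category.assoc, Category.assoc,
    hg U W ⟨r, rfl⟩ hWU, hg V W ⟨s, hrs.symm⟩ hWV]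

theorem exists_glue_of_affineOpens (g : ∀ U : Y.affineOpens, (f ⁻¹ᵁ U.1).toScheme ⟶ Z)
    (hg : ∀ (U W : Y.affineOpens) (_ : ∃ r : Γ(Y, U.1), Y.basicOpen r = W.1) (hle : W.1 ≤ U.1),
      X.homOfLE (f.preimage_mono hle) ≫ g U = g W) :
    ∃ α : X ⟶ Z, ∀ U : Y.affineOpens, (f ⁻¹ᵁ U.1).ι ≫ α = g U :=
  let 𝒰 := X.openCoverOfIsOpenCover _ (.comap (iSup_affineOpens_eq_top Y) f.base.1)
  have h : ∀ U V : 𝒰.I₀, pullback.fst (𝒰.f U) (𝒰.f V) ≫ g U = pullback.snd _ _ ≫ g V :=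
    fun _ _ => comp_eq_comp_of_basicOpen f g hg _ _ pullback.condition
  ⟨𝒰.glueMorphisms g h, 𝒰.ι_glueMorphisms g h⟩

end Gluing

/-- A subring of a localization is a localization, if all its elements have denominators. -/
theorem isLocalization_away_restrict {B B' : Type u} [CommRing B] [CommRing B'] (g : B →+* B')
    (b : B) (hloc : letI := g.toAlgebra; IsLocalization.Away b B') (S : Subring B) (S' : Subring B')
    (h : ∀ x ∈ S, g x ∈ S') (hb : b ∈ S) (hu : ∃ c ∈ S', g b * c = 1)
    (hsurj : ∀ x ∈ S', ∃ n : ℕ, ∃ y ∈ S, g b ^ n * x = g y) :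
    letI := (g.restrict S S' h).toAlgebra
    IsLocalization.Away (⟨b, hb⟩ : S) S' := by
  let := g.toAlgebra
  let := (g.restrict S S' h).toAlgebra
  refine IsLocalization.Away.mk _ ?_ ?_ ?_
  · obtain ⟨c, hc, hbc⟩ := hu
    exact IsUnit.of_mul_eq_one ⟨c, hc⟩ (Subtype.ext hbc)
  · rintro ⟨x, hx⟩
    obtain ⟨n, y, hy, hxy⟩ := hsurj x hx
    exact ⟨n, ⟨y, hy⟩, Subtype.ext ((mul_comm _ _).trans hxy)⟩
  · rintro ⟨x, hx⟩ ⟨y, hy⟩ hxy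
    obtain ⟨n, hn⟩ := IsLocalization.Away.exists_of_eq (S := B') b (a := x) (b := y)
      (congrArg Subtype.val hxy)
    exact ⟨n, Subtype.ext hn⟩

/-- A quasi-coherent subalgebra of `f_* 𝒪_X`. -/
structure QCSubalgebra {X Y : Scheme.{u}} (f : X ⟶ Y) where
  /-- The sections of the subalgebra. -/
  sections (U : Y.Opens) : Subring Γ(X, f ⁻¹ᵁ U)
  map_mem {U V : Y.Opens} (i : V ⟶ U) {x : Γ(X, f ⁻¹ᵁ U)} (hx : x ∈ sections U) :
    X.presheaf.map (homOfLE (f.preimage_mono i.le)).op x ∈ sections V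
  app_mem (U : Y.Opens) (r : Γ(Y, U)) : f.app U r ∈ sections U
  exists_pow_mul {U : Y.Opens} (hU : IsAffineOpen U) (r : Γ(Y, U))
    {x : Γ(X, f ⁻¹ᵁ Y.basicOpen r)} (hx : x ∈ sections (Y.basicOpen r)) :
    ∃ n : ℕ, ∃ y ∈ sections U,
      X.presheaf.map (homOfLE (f.preimage_mono (Y.basicOpen_le r))).op (f.app U r) ^ n * x =
        X.presheaf.map (homOfLE (f.preimage_mono (Y.basicOpen_le r))).op y

/-! ### The relative spectrum of a subalgebra of the direct image. -/

namespace QCSubalgebra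

variable {X Y : Scheme.{u}} {f : X ⟶ Y} (S : QCSubalgebra f)

/-- The presheaf of rings underlying a subalgebra of `f_* 𝒪_X`. -/
def diagram : Y.Opensᵒᵖ ⥤ CommRingCat where
  obj U := .of (S.sections U.unop)
  map {V U} i := CommRingCat.ofHom
    ((X.presheaf.map (homOfLE (f.preimage_mono i.unop.le)).op).hom.restrict _ _
      fun _ hx => S.map_mem i.unop hx)
  map_id U := by
    refine CommRingCat.hom_ext (RingHom.ext fun x => Subtype.ext ?_)
    exact congr($(X.presheaf.map_id (.op (f ⁻¹ᵁ U.unop))) x.1)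
  map_comp i j := by
    refine CommRingCat.hom_ext (RingHom.ext fun x => Subtype.ext ?_)
    exact congr($(X.presheaf.map_comp
      (homOfLE (f.preimage_mono i.unop.le)).op (homOfLE (f.preimage_mono j.unop.le)).op) x.1)

/-- The structure map of a subalgebra of `f_* 𝒪_X`. -/
def diagramMap : Y.presheaf ⟶ S.diagram where
  app U := CommRingCat.ofHom ((f.app U.unop).hom.codRestrict _ (S.app_mem U.unop))
  naturality {U V} i := by
    refine CommRingCat.hom_ext (RingHom.ext fun x => Subtype.ext ?_)
    exact congr($(f.naturality i) x)

/-- The inclusion of a subalgebra in the ring of functions over an open set. -/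
def val (U : Y.Opens) : S.diagram.obj (.op U) ⟶ Γ(X, f ⁻¹ᵁ U) :=
  CommRingCat.ofHom (S.sections U).subtype

theorem diagramMap_val (U : Y.Opens) : S.diagramMap.app (.op U) ≫ S.val U = f.app U := rfl

variable [IsAffineHom f]

theorem isLocalization_app {U : Y.Opens} (hU : IsAffineOpen U) (r : Γ(Y, U)) :
    letI := (X.presheaf.map (homOfLE (f.preimage_mono (Y.basicOpen_le r))).op).hom.toAlgebra
    IsLocalization.Away (f.app U r) Γ(X, f ⁻¹ᵁ Y.basicOpen r) := by
  have h := (hU.preimage f).isLocalization_basicOpen (f.app U r)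
  have e := f.preimage_basicOpen r
  let A : ∀ (V : X.Opens) (_ : V ≤ f ⁻¹ᵁ U), Algebra Γ(X, f ⁻¹ᵁ U) Γ(X, V) :=
    fun V hV => (X.presheaf.map (homOfLE hV).op).hom.toAlgebra
  have key : ∀ (V : X.Opens) (hV : V ≤ f ⁻¹ᵁ U), X.basicOpen (f.app U r) = V →
      @IsLocalization.Away _ _ (f.app U r) Γ(X, V) _ (A V hV) := by
    rintro V hV rfl
    exact h
  exact key _ _ e.symm

/-- This is the quasi-coherence needed for gluing: passing to a basic open set localizes the
subalgebra. Every section there has a power of the function as denominator by `exists_pow_mul`, so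
the localization property is inherited from that of the ambient algebra. -/
theorem coequifibered_diagramMap :
    ((toOpensFunctor Y).op.whiskerLeft S.diagramMap).Coequifibered := by
  refine coequifibered_iff_forall_isLocalizationAway.mpr fun U r => ?_
  refine isLocalization_away_restrict _ (f.app U.1 r) (isLocalization_app U.2 r) _ _
    (fun _ hx => S.map_mem (homOfLE (Y.basicOpen_le r)) hx) (S.app_mem _ _) ?_ (fun x hx => S.exists_pow_mul U.2 r hx)
  obtain ⟨c, hc⟩ : ∃ c : Γ(Y, Y.basicOpen r),
      Y.presheaf.map (homOfLE (Y.basicOpen_le r)).op r * c = 1 :=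
    (RingedSpace.isUnit_res_basicOpen Y.toRingedSpace r).exists_right_inv
  refine ⟨f.app _ c, S.app_mem _ _, ?_⟩
  have h₁ : f.app _ (Y.presheaf.map (homOfLE (Y.basicOpen_le r)).op r) =
      X.presheaf.map (homOfLE (f.preimage_mono (Y.basicOpen_le r))).op (f.app U.1 r) :=
    congr($(f.naturality (homOfLE (Y.basicOpen_le r)).op) r)
  have h₂ := congrArg (f.app (Y.basicOpen r)) hc
  rw [map_mul, map_one, h₁] at h₂
  exact h₂

/-- The gluing data of the relative spectrum of a subalgebra. -/
def glueData := relativeGluingData S.coequifibered_diagramMap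

instance : (S.glueData.functor ⋙ Scheme.forget).IsLocallyDirected :=
  Scheme.Cover.RelativeGluingData.instIsLocallyDirectedI₀CompFunctorForgetOfIsThin ..

/-- The relative spectrum of a subalgebra of `f_* 𝒪_X`. -/
def spec : Scheme.{u} := S.glueData.glued

/-- The affine cover of the relative spectrum. -/
def specCover : S.spec.OpenCover := S.glueData.cover

/-- The structure morphism of the relative spectrum. -/
def fromSpec : S.spec ⟶ Y := S.glueData.toBase

/-- The chart of the relative spectrum over an affine open set. -/
def chart (U : Y.affineOpens) : Spec (S.diagram.obj (.op U.1)) ⟶ S.spec := S.specCover.f U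

instance (U : Y.affineOpens) : IsOpenImmersion (S.chart U) := S.specCover.map_prop U

theorem SpecMap_chart {U W : Y.affineOpens} (h : ∃ r : Γ(Y, U.1), Y.basicOpen r = W.1)
    (hle : W.1 ≤ U.1) :
    Spec.map (S.diagram.map (homOfLE hle).op) ≫ S.chart U = S.chart W :=
  colimit.w S.glueData.functor
    (homOfLE h : (show Y.AffineZariskiSite from W) ⟶ (show Y.AffineZariskiSite from U))

theorem chart_fromSpec (U : Y.affineOpens) :
    S.chart U ≫ S.fromSpec = Spec.map (S.diagramMap.app (.op U.1)) ≫ U.2.fromSpec :=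
  colimit.ι_desc _ _

theorem fromSpec_preimage (U : Y.affineOpens) :
    S.fromSpec ⁻¹ᵁ U.1 = (S.chart U).opensRange := by
  have h := S.glueData.toBase_preimage_eq_opensRange_ι U
  have e : ((directedCover Y).f U).opensRange = U.1 := Scheme.Opens.opensRange_ι _
  rw [e] at h
  exact h

theorem exists_toSpec : ∃ α : X ⟶ S.spec, ∀ U : Y.affineOpens,
    (f ⁻¹ᵁ U.1).ι ≫ α = (f ⁻¹ᵁ U.1).toSpecΓ ≫ Spec.map (S.val U.1) ≫ S.chart U := by
  refine exists_glue_of_affineOpens f _ fun U W h hle => ?_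
  rw [← S.SpecMap_chart h hle, ← Scheme.Opens.toSpecΓ_SpecMap_presheaf_map_assoc,
    ← Spec.map_comp_assoc, ← Spec.map_comp_assoc]
  rfl

/-- The morphism from `X` to the relative spectrum. -/
def toSpec : X ⟶ S.spec := S.exists_toSpec.choose

theorem ι_toSpec (U : Y.affineOpens) :
    (f ⁻¹ᵁ U.1).ι ≫ S.toSpec =
      (f ⁻¹ᵁ U.1).toSpecΓ ≫ Spec.map (S.val U.1) ≫ S.chart U :=
  S.exists_toSpec.choose_spec U

theorem toSpec_fromSpec : S.toSpec ≫ S.fromSpec = f := by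
  refine hom_ext_of_affineOpens f fun U => ?_
  rw [← Category.assoc, S.ι_toSpec, Category.assoc, Category.assoc, S.chart_fromSpec,
    ← Spec.map_comp_assoc, diagramMap_val, Scheme.Hom.app_eq_appLE,
    IsAffineOpen.SpecMap_appLE_fromSpec _ U.2 (U.2.preimage f), ← Category.assoc,
    IsAffineOpen.toSpecΓ_fromSpec]

instance : IsAffineHom S.fromSpec where
  isAffine_preimage U hU := by
    rw [S.fromSpec_preimage ⟨U, hU⟩]
    exact isAffineOpen_opensRange _

/-- The sections of the structure sheaf of the relative spectrum. -/
def objIso {U : Y.Opens} (hU : IsAffineOpen U) :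
    Γ(S.spec, S.fromSpec ⁻¹ᵁ U) ≅ S.diagram.obj (.op U) :=
  S.spec.presheaf.mapIso (eqToIso ((S.chart ⟨U, hU⟩).image_top_eq_opensRange.trans
      (S.fromSpec_preimage ⟨U, hU⟩).symm)).op ≪≫
  (S.chart ⟨U, hU⟩).appIso ⊤ ≪≫ Scheme.ΓSpecIso _

theorem preimage_le_preimage (U : Y.Opens) : f ⁻¹ᵁ U ≤ S.toSpec ⁻¹ᵁ S.fromSpec ⁻¹ᵁ U := by
  rw [← Scheme.Hom.comp_preimage, S.toSpec_fromSpec]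

/-- Both sides induce the same morphism into the affine open subset of the relative spectrum, by the
chart description of `toSpec`. Functions on the relative spectrum thereby become elements of the
subalgebra. -/
theorem toSpec_appLE {U : Y.Opens} (hU : IsAffineOpen U) :
    S.toSpec.appLE (S.fromSpec ⁻¹ᵁ U) (f ⁻¹ᵁ U) (S.preimage_le_preimage U) =
      (S.objIso hU).hom ≫ S.val U := by
  have hV : IsAffineOpen (S.fromSpec ⁻¹ᵁ U) := hU.preimage S.fromSpec
  have hc : Spec.map (S.objIso hU).hom ≫ hV.fromSpec = S.chart ⟨U, hU⟩ := by
    have hT : IsAffineOpen (S.chart ⟨U, hU⟩ ''ᵁ ⊤) := (isAffineOpen_top _).image_of_isOpenImmersion _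
    rw [objIso, Iso.trans_hom, Iso.trans_hom, Spec.map_comp, Spec.map_comp, Category.assoc,
      Category.assoc]
    have h₁ : Spec.map (S.spec.presheaf.mapIso (eqToIso
        ((S.chart ⟨U, hU⟩).image_top_eq_opensRange.trans
          (S.fromSpec_preimage ⟨U, hU⟩).symm)).op).hom ≫ hV.fromSpec = hT.fromSpec :=
      hV.map_fromSpec hT _
    rw [h₁, Scheme.Hom.appIso_hom', hT.SpecMap_appLE_fromSpec _ (isAffineOpen_top _),
      IsAffineOpen.fromSpec_top]
    simp [Scheme.isoSpec_Spec]
  apply Spec.map_injective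
  rw [← cancel_mono hV.fromSpec, IsAffineOpen.SpecMap_appLE_fromSpec _ hV (hU.preimage f),
    Spec.map_comp, Category.assoc, hc, ← cancel_epi (hU.preimage f).isoSpec.hom,
    IsAffineOpen.isoSpec_hom, IsAffineOpen.toSpecΓ_fromSpec_assoc]
  exact S.ι_toSpec ⟨U, hU⟩

end QCSubalgebra

/-! ### From actions on the direct image to actions on the scheme. -/

section Endomorphisms

variable {X Y : Scheme.{u}} {f : X ⟶ Y}

theorem appLE_comp_of_invariant {α β : X ⟶ X} (hα : α ≫ f = f) (hβ : β ≫ f = f)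
    (hαβ : (α ≫ β) ≫ f = f) (U : Y.Opens) :
    (α ≫ β).appLE (f ⁻¹ᵁ U) (f ⁻¹ᵁ U) (preimage_le_of_invariant hαβ U) =
      β.appLE (f ⁻¹ᵁ U) (f ⁻¹ᵁ U) (preimage_le_of_invariant hβ U) ≫
        α.appLE (f ⁻¹ᵁ U) (f ⁻¹ᵁ U) (preimage_le_of_invariant hα U) := by
  rw [Scheme.Hom.appLE_comp_appLE]

theorem appLE_naturality {α : X ⟶ X} (hα : α ≫ f = f) {U V : Y.Opens} (i : V ⟶ U) :
    X.presheaf.map (homOfLE (f.preimage_mono i.le)).op ≫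
      α.appLE (f ⁻¹ᵁ V) (f ⁻¹ᵁ V) (preimage_le_of_invariant hα V) =
    α.appLE (f ⁻¹ᵁ U) (f ⁻¹ᵁ U) (preimage_le_of_invariant hα U) ≫
      X.presheaf.map (homOfLE (f.preimage_mono i.le)).op := by
  rw [Scheme.Hom.map_appLE, Scheme.Hom.appLE_map]

variable [IsAffineHom f]

theorem ι_comp_eq {α : X ⟶ X} (h : α ≫ f = f) (U : Y.affineOpens) :
    (f ⁻¹ᵁ U.1).ι ≫ α = (f ⁻¹ᵁ U.1).toSpecΓ ≫
      Spec.map (α.appLE (f ⁻¹ᵁ U.1) (f ⁻¹ᵁ U.1) (preimage_le_of_invariant h U.1)) ≫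
        (U.2.preimage f).fromSpec := by
  rw [IsAffineOpen.SpecMap_appLE_fromSpec _ (U.2.preimage f) (U.2.preimage f),
    ← Category.assoc, IsAffineOpen.toSpecΓ_fromSpec]

theorem endomorphism_ext {α β : X ⟶ X} (hα : α ≫ f = f) (hβ : β ≫ f = f)
    (h : ∀ U : Y.affineOpens,
      α.appLE (f ⁻¹ᵁ U.1) (f ⁻¹ᵁ U.1) (preimage_le_of_invariant hα U.1) =
        β.appLE (f ⁻¹ᵁ U.1) (f ⁻¹ᵁ U.1) (preimage_le_of_invariant hβ U.1)) : α = β := by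
  refine hom_ext_of_affineOpens f fun U => ?_
  rw [ι_comp_eq hα, ι_comp_eq hβ, h]

theorem exists_glueEndomorphism (θ : ∀ U : Y.Opens, Γ(X, f ⁻¹ᵁ U) ⟶ Γ(X, f ⁻¹ᵁ U))
    (hθ : ∀ (U V : Y.Opens) (i : V ⟶ U),
      X.presheaf.map (homOfLE (f.preimage_mono i.le)).op ≫ θ V =
        θ U ≫ X.presheaf.map (homOfLE (f.preimage_mono i.le)).op) :
    ∃ α : X ⟶ X, ∀ U : Y.affineOpens, (f ⁻¹ᵁ U.1).ι ≫ α =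
      (f ⁻¹ᵁ U.1).toSpecΓ ≫ Spec.map (θ U.1) ≫ (U.2.preimage f).fromSpec := by
  refine exists_glue_of_affineOpens f _ fun U W _ hle => ?_
  rw [← Scheme.Opens.toSpecΓ_SpecMap_presheaf_map_assoc, ← Spec.map_comp_assoc,
    ← hθ U.1 W.1 (homOfLE hle), Spec.map_comp_assoc,
    IsAffineOpen.map_fromSpec _ (W.2.preimage f)]

variable (θ : ∀ U : Y.Opens, Γ(X, f ⁻¹ᵁ U) ⟶ Γ(X, f ⁻¹ᵁ U))
  (hθ : ∀ (U V : Y.Opens) (i : V ⟶ U),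
    X.presheaf.map (homOfLE (f.preimage_mono i.le)).op ≫ θ V =
      θ U ≫ X.presheaf.map (homOfLE (f.preimage_mono i.le)).op)

/-- The endomorphism of `X` glued from endomorphisms of the rings `Γ(X, f ⁻¹ U)`. -/
def glueEndomorphism : X ⟶ X := (exists_glueEndomorphism θ hθ).choose

theorem ι_glueEndomorphism (U : Y.affineOpens) :
    (f ⁻¹ᵁ U.1).ι ≫ glueEndomorphism θ hθ = (f ⁻¹ᵁ U.1).toSpecΓ ≫ Spec.map (θ U.1) ≫
      (U.2.preimage f).fromSpec :=
  (exists_glueEndomorphism θ hθ).choose_spec U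

theorem glueEndomorphism_comp (h : ∀ U, f.app U ≫ θ U = f.app U) :
    glueEndomorphism θ hθ ≫ f = f := by
  refine hom_ext_of_affineOpens f fun U => ?_
  have h₁ : Spec.map (f.app U.1) ≫ U.2.fromSpec = (U.2.preimage f).fromSpec ≫ f := by
    rw [Scheme.Hom.app_eq_appLE, IsAffineOpen.SpecMap_appLE_fromSpec _ U.2 (U.2.preimage f)]
  rw [← Category.assoc, ι_glueEndomorphism, Category.assoc, Category.assoc, ← h₁,
    ← Spec.map_comp_assoc, h, h₁, ← Category.assoc, IsAffineOpen.toSpecΓ_fromSpec]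

theorem glueEndomorphism_appLE (h : ∀ U, f.app U ≫ θ U = f.app U) (U : Y.affineOpens) :
    (glueEndomorphism θ hθ).appLE (f ⁻¹ᵁ U.1) (f ⁻¹ᵁ U.1)
      (preimage_le_of_invariant (glueEndomorphism_comp θ hθ h) U.1) = θ U.1 := by
  have h₁ := ι_comp_eq (glueEndomorphism_comp θ hθ h) U
  rw [ι_glueEndomorphism, ← (U.2.preimage f).isoSpec_hom, cancel_epi, cancel_mono] at h₁
  exact (Spec.map_injective h₁).symm

/-- A group acting on the sheaf of algebras `f_* 𝒪_X` acts on `X` over `Y`. -/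
theorem exists_action {G : Type w} [Group G]
    (Θ : G → ∀ U : Y.Opens, Γ(X, f ⁻¹ᵁ U) ⟶ Γ(X, f ⁻¹ᵁ U))
    (hΘ : ∀ (g : G) (U V : Y.Opens) (i : V ⟶ U),
      X.presheaf.map (homOfLE (f.preimage_mono i.le)).op ≫ Θ g V =
        Θ g U ≫ X.presheaf.map (homOfLE (f.preimage_mono i.le)).op)
    (happ : ∀ g U, f.app U ≫ Θ g U = f.app U)
    (hone : ∀ U, Θ 1 U = 𝟙 _) (hmul : ∀ g h U, Θ (g * h) U = Θ g U ≫ Θ h U) :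
    ∃ (ρ : G →* Aut X) (hρ : ∀ g, (ρ g).hom ≫ f = f), ∀ (g : G) (U : Y.Opens),
      (ρ g).hom.appLE (f ⁻¹ᵁ U) (f ⁻¹ᵁ U) (preimage_le_of_invariant (hρ g) U) = Θ g U := by
  let γ (g : G) : X ⟶ X := glueEndomorphism (Θ g) (hΘ g)
  have hγ (g : G) : γ g ≫ f = f := glueEndomorphism_comp (Θ g) (hΘ g) (happ g)
  have hγ' (g : G) (U : Y.affineOpens) := glueEndomorphism_appLE (Θ g) (hΘ g) (happ g) U
  have h_one : γ 1 = 𝟙 X := by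
    refine endomorphism_ext (hγ 1) (Category.id_comp f) fun U => ?_
    rw [hγ', hone, Scheme.Hom.appLE, Scheme.Hom.id_app]
    exact ((Category.id_comp _).trans (X.presheaf.map_id _)).symm
  -- Passing from functions to spaces reverses the order of composition, and multiplication in `Aut
  -- X` is also reversed composition, so a homomorphism results.
  have h_mul (g h : G) : γ (g * h) = γ h ≫ γ g := by
    have h₁ : (γ h ≫ γ g) ≫ f = f := by rw [Category.assoc, hγ, hγ]
    refine endomorphism_ext (hγ (g * h)) h₁ fun U => ?_
    rw [appLE_comp_of_invariant (hγ h) (hγ g) h₁, hγ', hγ', hγ', hmul]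
  let ρ : G →* Aut X :=
    { toFun := fun g => ⟨γ g, γ g⁻¹, by rw [← h_mul, inv_mul_cancel, h_one],
        by rw [← h_mul, mul_inv_cancel, h_one]⟩
      map_one' := Iso.ext h_one
      map_mul' := fun g h => Iso.ext (h_mul g h) }
  refine ⟨ρ, hγ, fun g U => ?_⟩
  refine CommRingCat.hom_ext (RingHom.ext fun x => ?_)
  -- The gluing controls the action only over affine open sets; restriction to these determines it
  -- over an arbitrary `U`.
  refine eq_of_forall_mem (directImage f) (U := U) fun y hy => ?_
  obtain ⟨V, hV, hyV, hVU⟩ := exists_isAffineOpen_mem_and_subset hy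
  refine ⟨V, homOfLE hVU, hyV, ?_⟩
  have h₁ := congr($(appLE_naturality (hγ g) (homOfLE hVU)) x)
  have h₂ := congr($(hΘ g _ _ (homOfLE hVU)) x)
  rw [hγ' g ⟨V, hV⟩] at h₁
  exact h₁.symm.trans h₂

end Endomorphisms

/-! ### Recognizing quotients by finite groups. -/

section Quotients

variable {X Q : Scheme.{u}} {π : X ⟶ Q} {G : Type w} [Group G] {ρ : G →* Aut X}

/-- The action of `g` on the functions on `π ⁻¹ W`. -/
abbrev actFunction (hρ : ∀ g, (ρ g).hom ≫ π = π) (W : Q.Opens) (g : G) :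
    Γ(X, π ⁻¹ᵁ W) ⟶ Γ(X, π ⁻¹ᵁ W) :=
  (ρ g).hom.appLE (π ⁻¹ᵁ W) (π ⁻¹ᵁ W) (preimage_le_of_invariant (hρ g) W)

/-- Over `W`, the functions on `Q` are the invariant functions on `X`. -/
def IsInvariantOver (hρ : ∀ g, (ρ g).hom ≫ π = π) (W : Q.Opens) : Prop :=
  Function.Injective (π.app W) ∧ ∀ f : Γ(X, π ⁻¹ᵁ W), (∀ g, actFunction hρ W g f = f) →
    f ∈ Set.range (π.app W)

variable (hρ : ∀ g, (ρ g).hom ≫ π = π)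

theorem appLE_eq_id {α : X ⟶ X} (h : α = 𝟙 X) {V : X.Opens} (hV : V ≤ α ⁻¹ᵁ V) :
    α.appLE V V hV = 𝟙 _ := by
  subst h
  rw [Scheme.Hom.appLE, Scheme.Hom.id_app]
  exact (Category.id_comp _).trans (X.presheaf.map_id _)

theorem actFunction_app (W : Q.Opens) (g : G) (r : Γ(Q, W)) :
    actFunction hρ W g (π.app W r) = π.app W r := by
  have h : π.app W ≫ actFunction hρ W g = π.app W := by
    rw [actFunction, Scheme.Hom.app_eq_appLE, Scheme.Hom.appLE_comp_appLE]
    congr 1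
    exact hρ g
  exact congr($h r)

theorem actFunction_map {U V : Q.Opens} (i : V ⟶ U) (g : G) (x : Γ(X, π ⁻¹ᵁ U)) :
    actFunction hρ V g (X.presheaf.map (homOfLE (π.preimage_mono i.le)).op x) =
      X.presheaf.map (homOfLE (π.preimage_mono i.le)).op (actFunction hρ U g x) :=
  congr($(appLE_naturality (hρ g) i) x)

theorem app_map_preimage (π : X ⟶ Q) {U V : Q.Opens} (i : V ⟶ U) (r : Γ(Q, U)) :
    π.app V (Q.presheaf.map i.op r) =
      X.presheaf.map (homOfLE (π.preimage_mono i.le)).op (π.app U r) :=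
  congr($(π.naturality i.op) r)

/-- After clearing denominators, x becomes the restriction of some y, and gy and y agree after
multiplication by a power of r depending on g. Finiteness of the group gives a common exponent, the
sum of these. -/
theorem exists_pow_mul_eq_of_invariant [Finite G] [IsAffineHom π] {W : Q.Opens}
    (hW : IsAffineOpen W) (r : Γ(Q, W)) {x : Γ(X, π ⁻¹ᵁ Q.basicOpen r)}
    (hx : ∀ g, actFunction hρ _ g x = x) :
    ∃ (n : ℕ) (y : Γ(X, π ⁻¹ᵁ W)), (∀ g, actFunction hρ W g y = y) ∧
      X.presheaf.map (homOfLE (π.preimage_mono (Q.basicOpen_le r))).op (π.app W r) ^ n * x =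
        X.presheaf.map (homOfLE (π.preimage_mono (Q.basicOpen_le r))).op y := by
  have hlocX := QCSubalgebra.isLocalization_app (f := π) hW r
  let i := homOfLE (Q.basicOpen_le r)
  let res := X.presheaf.map (homOfLE (π.preimage_mono (Q.basicOpen_le r))).op
  let := res.hom.toAlgebra
  obtain ⟨n, y, hy⟩ := IsLocalization.Away.surj (S := Γ(X, π ⁻¹ᵁ Q.basicOpen r)) (π.app W r) x
  have hr : res (π.app W r) = π.app _ (Q.presheaf.map i.op r) := (app_map_preimage π i r).symm
  have hy' : x * res (π.app W r) ^ n = res y := hy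
  have h₁ (g : G) : res (actFunction hρ W g y) = res y := by
    have : res (actFunction hρ W g y) = actFunction hρ _ g (res y) :=
      (actFunction_map hρ i g y).symm
    rw [this, ← hy', map_mul, map_pow, hx, hr, actFunction_app]
  choose m hm using fun g => IsLocalization.Away.exists_of_eq
    (S := Γ(X, π ⁻¹ᵁ Q.basicOpen r)) (π.app W r) (h₁ g)
  cases nonempty_fintype G
  let N := ∑ g, m g
  have hN (g : G) : π.app W r ^ N * actFunction hρ W g y = π.app W r ^ N * y := by
    obtain ⟨l, hl⟩ := Nat.exists_eq_add_of_le
      (Finset.single_le_sum (f := m) (fun _ _ => Nat.zero_le _) (Finset.mem_univ g))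
    rw [show N = m g + l from hl, add_comm, pow_add, mul_assoc, hm, mul_assoc]
  refine ⟨N + n, π.app W r ^ N * y, fun g => by rw [map_mul, map_pow, actFunction_app, hN], ?_⟩
  change res (π.app W r) ^ (N + n) * x = res (π.app W r ^ N * y)
  rw [map_mul, map_pow, ← hy']
  ring

/-- Taking invariants of a finite group commutes with localization at an invariant function. -/
theorem IsInvariantOver.basicOpen [Finite G] [IsAffineHom π] {W : Q.Opens} (hW : IsAffineOpen W)
    (h : IsInvariantOver hρ W) (r : Γ(Q, W)) : IsInvariantOver hρ (Q.basicOpen r) := by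
  have hloc := hW.isLocalization_basicOpen r
  have hlocX := QCSubalgebra.isLocalization_app (f := π) hW r
  let i := homOfLE (Q.basicOpen_le r)
  let := (Q.presheaf.map i.op).hom.toAlgebra
  let := (X.presheaf.map (homOfLE (π.preimage_mono (Q.basicOpen_le r))).op).hom.toAlgebra
  have hu : IsUnit (Q.presheaf.map i.op r) :=
    IsLocalization.Away.algebraMap_isUnit (S := Γ(Q, Q.basicOpen r)) r
  constructor
  · rw [injective_iff_map_eq_zero]
    intro x hx
    obtain ⟨n, y, hy⟩ := IsLocalization.Away.surj (S := Γ(Q, Q.basicOpen r)) r x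
    have hy' : x * Q.presheaf.map i.op r ^ n = Q.presheaf.map i.op y := hy
    have h₁ : X.presheaf.map (homOfLE (π.preimage_mono (Q.basicOpen_le r))).op (π.app W y) = 0 := by
      rw [← app_map_preimage π i, ← hy', map_mul, hx, zero_mul]
    obtain ⟨m, hm⟩ := IsLocalization.Away.exists_of_eq (S := Γ(X, π ⁻¹ᵁ Q.basicOpen r))
      (π.app W r) (a := π.app W y) (b := 0) (h₁.trans (map_zero _).symm)
    rw [mul_zero, ← map_pow, ← map_mul] at hm
    have h₂ := h.1 (hm.trans (map_zero _).symm)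
    have h₃ := congrArg (Q.presheaf.map i.op) h₂
    rw [map_mul, map_pow, map_zero, ← hy', (hu.pow m).mul_right_eq_zero,
      (hu.pow n).mul_left_eq_zero] at h₃
    exact h₃
  · intro x hx
    obtain ⟨n, y, hy, hxy⟩ := exists_pow_mul_eq_of_invariant hρ hW r hx
    obtain ⟨t, ht⟩ := h.2 y hy
    obtain ⟨c, hc⟩ := (hu.pow n).exists_right_inv
    have hc' : π.app _ (Q.presheaf.map i.op r) ^ n * π.app _ c = 1 := by
      rw [← map_pow, ← map_mul, hc, map_one]
    rw [← ht, ← app_map_preimage π i, ← app_map_preimage π i] at hxy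
    refine ⟨Q.presheaf.map i.op t * c, ?_⟩
    rw [map_mul, ← hxy]
    linear_combination x * hc'

theorem isInvariantOver_of_cover [Finite G] [IsAffineHom π]
    (hQ : ∀ q : Q, ∃ W : Q.Opens, q ∈ W ∧ IsAffineOpen W ∧ IsInvariantOver hρ W) (V : Q.Opens) :
    IsInvariantOver hρ V := by
  have hcov (V : Q.Opens) (q : Q) (hq : q ∈ V) :
      ∃ D : Q.Opens, q ∈ D ∧ D ≤ V ∧ IsInvariantOver hρ D := by
    obtain ⟨W, hqW, hW, h⟩ := hQ q
    obtain ⟨r, hr, hqr⟩ := hW.exists_basicOpen_le ⟨q, hq⟩ hqW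
    exact ⟨_, hqr, hr, h.basicOpen hρ hW r⟩
  have hinj (V : Q.Opens) : Function.Injective (π.app V) := by
    intro x y hxy
    refine ring_eq_of_forall_mem fun q hq => ?_
    obtain ⟨D, hqD, hDV, hD⟩ := hcov V q hq
    refine ⟨D, homOfLE hDV, hqD, hD.1 ?_⟩
    rw [app_map_preimage, app_map_preimage, hxy]
  refine ⟨hinj V, fun f hf => ?_⟩
  choose D hqD hDV hD using fun q : V => hcov V q.1 q.2
  have hs (q : V) : ∃ t : Γ(Q, D q), π.app _ t =
      X.presheaf.map (homOfLE (π.preimage_mono (hDV q))).op f :=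
    (hD q).2 _ fun g => by rw [actFunction_map hρ (homOfLE (hDV q)), hf]
  choose t ht using hs
  obtain ⟨s, hs, -⟩ := TopCat.Sheaf.existsUnique_gluing' Q.sheaf D V (fun q => homOfLE (hDV q))
    (fun q hq => TopologicalSpace.Opens.mem_iSup.mpr ⟨⟨q, hq⟩, hqD _⟩) t fun p q => by
      refine hinj _ ?_
      refine (app_map_preimage π _ _).trans (Eq.trans ?_ (app_map_preimage π _ _).symm)
      rw [ht, ht, ← ConcreteCategory.comp_apply, ← ConcreteCategory.comp_apply,
        ← Functor.map_comp, ← Functor.map_comp]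
      rfl
  refine ⟨s, eq_of_forall_mem (directImage π) (U := V) fun q hq =>
    ⟨D ⟨q, hq⟩, homOfLE (hDV _), hqD _, ?_⟩⟩
  refine (app_map_preimage π (homOfLE (hDV ⟨q, hq⟩)) s).symm.trans ?_
  exact (congrArg _ (hs ⟨q, hq⟩)).trans (ht ⟨q, hq⟩)

/-- The complement of the closed image has empty preimage, so its ring of functions embeds in the
zero ring; hence 1 = 0 on it and it is empty. -/
theorem surjective_of_injective_app [UniversallyClosed π]
    (h : ∀ V : Q.Opens, Function.Injective (π.app V)) : Function.Surjective π := by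
  intro q
  by_contra hq
  let V : Q.Opens := ⟨(Set.range π)ᶜ, π.isClosedMap.isClosed_range.isOpen_compl⟩
  have hV : π ⁻¹ᵁ V = ⊥ := by
    ext x
    exact iff_of_false (fun hx => hx ⟨x, rfl⟩) id
  have h₁ : (1 : Γ(Q, V)) = 0 := by
    have : Subsingleton Γ(X, π ⁻¹ᵁ V) := by
      rw [hV]
      infer_instance
    exact h V (Subsingleton.elim _ _)
  have h₂ : Q.basicOpen (1 : Γ(Q, V)) = V := Q.basicOpen_of_isUnit isUnit_one
  have h₃ : q ∈ V := hq
  rw [← h₂, h₁, Scheme.basicOpen_zero] at h₃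
  exact h₃

/-- Over an affine open set this is the transitivity of a finite group on the primes lying over a
given prime of the ring of invariants. -/
theorem exists_apply_eq_of_isInvariantOver [Finite G] [IsAffineHom π] {W : Q.Opens}
    (hW : IsAffineOpen W) (h : IsInvariantOver hρ W) {x x' : X} (hx : π x ∈ W)
    (hxx' : π x = π x') : ∃ g : G, (ρ g).hom x = x' := by
  let B := Γ(X, π ⁻¹ᵁ W)
  let A := Γ(Q, W)
  -- Pullback of functions is a right action; the inverse makes it a left action.
  let Φ : G →* (B →+* B) :=
    { toFun := fun g => (actFunction hρ W g⁻¹).hom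
      map_one' := by
        refine RingHom.ext fun y => ?_
        have : actFunction hρ W (1 : G)⁻¹ = 𝟙 _ :=
          appLE_eq_id (by rw [inv_one, map_one]; rfl) _
        exact congr($this y)
      map_mul' := fun g k => by
        refine RingHom.ext fun y => ?_
        have : actFunction hρ W (g * k)⁻¹ = actFunction hρ W k⁻¹ ≫ actFunction hρ W g⁻¹ := by
          have h₁ : (ρ (g * k)⁻¹).hom = (ρ g⁻¹).hom ≫ (ρ k⁻¹).hom := by
            rw [mul_inv_rev, map_mul]; rfl
          simp only [actFunction, Scheme.Hom.appLE_comp_appLE, h₁]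
        exact congr($this y) }
  let : MulSemiringAction G B := MulSemiringAction.compHom B Φ
  let : Algebra A B := (π.app W).hom.toAlgebra
  have hsmul (g : G) (y : B) : g • y = actFunction hρ W g⁻¹ y := rfl
  have : SMulCommClass G A B := ⟨fun g r y => by
    rw [Algebra.smul_def, Algebra.smul_def, smul_mul']
    congr 1
    exact actFunction_app hρ W g⁻¹ r⟩
  have : Algebra.IsInvariant A B G := ⟨fun y hy => h.2 y fun g => by
    simpa [hsmul] using hy g⁻¹⟩
  have hB : IsAffineOpen (π ⁻¹ᵁ W) := hW.preimage π
  have hx' : π x' ∈ W := hxx' ▸ hx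
  let P := hB.primeIdealOf ⟨x, hx⟩
  let P' := hB.primeIdealOf ⟨x', hx'⟩
  have hPP' : P.asIdeal.under A = P'.asIdeal.under A := by
    have h₁ := hW.comap_primeIdealOf_appLE (f := π) (x := x) W (π ⁻¹ᵁ W) hB le_rfl hx
    have h₂ := hW.comap_primeIdealOf_appLE (f := π) (x := x') W (π ⁻¹ᵁ W) hB le_rfl hx'
    rw [← Scheme.Hom.app_eq_appLE] at h₁ h₂
    have h₃ : hW.primeIdealOf ⟨π x, hx⟩ = hW.primeIdealOf ⟨π x', hx'⟩ := by
      congr 1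
      exact Subtype.ext hxx'
    exact congrArg PrimeSpectrum.asIdeal (h₁.trans (h₃.trans h₂.symm))
  obtain ⟨g, hg⟩ := Algebra.IsInvariant.exists_smul_of_under_eq A B G P.asIdeal P'.asIdeal hPP'
  refine ⟨g, ?_⟩
  have hgx : (ρ g).hom x ∈ π ⁻¹ᵁ W := preimage_le_of_invariant (hρ g) W hx
  have h₁ : hB.primeIdealOf ⟨(ρ g).hom x, hgx⟩ = P' := by
    rw [← IsAffineOpen.comap_primeIdealOf_appLE (f := (ρ g).hom) (π ⁻¹ᵁ W) hB (π ⁻¹ᵁ W) hB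
      (preimage_le_of_invariant (hρ g) W) hx]
    refine PrimeSpectrum.ext (Ideal.ext fun y => ?_)
    rw [hg, Ideal.mem_pointwise_smul_iff_inv_smul_mem, hsmul, inv_inv]
    rfl
  have h₂ := congrArg hB.fromSpec h₁
  rwa [hB.fromSpec_primeIdealOf, hB.fromSpec_primeIdealOf] at h₂

/-- The quotient by a finite group can be recognized on an affine cover. -/
theorem isQuotientBy_of_cover [Finite G] [IsIntegralHom π]
    (hQ : ∀ q : Q, ∃ W : Q.Opens, q ∈ W ∧ IsAffineOpen W ∧ IsInvariantOver hρ W) :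
    IsQuotientBy ρ π where
  invariant := hρ
  isQuotientMap := π.isClosedMap.isQuotientMap π.continuous
    (surjective_of_injective_app fun V => (isInvariantOver_of_cover hρ hQ V).1)
  orbit x x' hxx' := by
    obtain ⟨W, hqW, hW, h⟩ := hQ (π x)
    exact exists_apply_eq_of_isInvariantOver hρ hW h hqW hxx'
  injective V := (isInvariantOver_of_cover hρ hQ V).1
  mem_range V := (isInvariantOver_of_cover hρ hQ V).2

end Quotients

/-! ### Construction of the quotient over the base. -/

section QuotientOverBase

variable {X Y : Scheme.{u}} {f : X ⟶ Y} [IsIntegralHom f] {G : Type w} [Group G] [Finite G]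
  {ρ : G →* Aut X} (hρ : ∀ g, (ρ g).hom ≫ f = f)

/-- The subalgebra of invariants of `f_* 𝒪_X`. -/
def invariants : QCSubalgebra f where
  sections U :=
    { carrier := {x | ∀ g, actFunction hρ U g x = x}
      mul_mem' := fun hx hy g => by rw [map_mul, hx, hy]
      one_mem' := fun g => map_one _
      add_mem' := fun hx hy g => by rw [map_add, hx, hy]
      zero_mem' := fun g => map_zero _
      neg_mem' := fun hx g => by rw [map_neg, hx] }
  map_mem i x hx g := by rw [actFunction_map hρ i, hx]
  app_mem U r g := actFunction_app hρ U g r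
  exists_pow_mul hU r x hx := by
    obtain ⟨n, y, hy, h⟩ := exists_pow_mul_eq_of_invariant hρ hU r hx
    exact ⟨n, y, hy, h⟩

/-- The quotient `X / G` over `Y`. -/
abbrev quotient : Scheme.{u} := (invariants hρ).spec

/-- The quotient map `X ⟶ X / G`. -/
abbrev toQuotient : X ⟶ quotient hρ := (invariants hρ).toSpec

/-- The structure map `X / G ⟶ Y`. -/
abbrev fromQuotient : quotient hρ ⟶ Y := (invariants hρ).fromSpec

theorem comp_toQuotient (g : G) : (ρ g).hom ≫ toQuotient hρ = toQuotient hρ := by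
  refine hom_ext_of_affineOpens f fun U => ?_
  have h₁ : (U.2.preimage f).fromSpec ≫ toQuotient hρ =
      Spec.map ((invariants hρ).val U.1) ≫ (invariants hρ).chart U := by
    rw [← cancel_epi (U.2.preimage f).isoSpec.hom, IsAffineOpen.isoSpec_hom_fromSpec_assoc,
      QCSubalgebra.ι_toSpec, IsAffineOpen.isoSpec_hom]
  have h₂ : (invariants hρ).val U.1 ≫ actFunction hρ U.1 g = (invariants hρ).val U.1 :=
    CommRingCat.hom_ext (RingHom.ext fun x => x.2 g)
  have h₃ : Spec.map (actFunction hρ U.1 g) ≫ Spec.map ((invariants hρ).val U.1) =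
      Spec.map ((invariants hρ).val U.1) := by
    rw [← Spec.map_comp, h₂]
  rw [← Category.assoc, ι_comp_eq (hρ g), Category.assoc, Category.assoc, h₁,
    QCSubalgebra.ι_toSpec]
  exact congrArg ((f ⁻¹ᵁ U.1).toSpecΓ ≫ ·) (congr($h₃ ≫ (invariants hρ).chart U))

/-- Holds by construction, through `toSpec_appLE`. The two descriptions of the preimage of `U` in
`X` are equal but not definitionally so, whence the transport along the restriction isomorphism
`res`. -/
theorem isInvariantOver_quotient {U : Y.Opens} (hU : IsAffineOpen U) :
    IsInvariantOver (comp_toQuotient hρ) (fromQuotient hρ ⁻¹ᵁ U) := by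
  let π := toQuotient hρ
  let W := fromQuotient hρ ⁻¹ᵁ U
  have hW : f ⁻¹ᵁ U = π ⁻¹ᵁ W := by
    rw [← Scheme.Hom.comp_preimage, QCSubalgebra.toSpec_fromSpec]
  let res : Γ(X, π ⁻¹ᵁ W) ⟶ Γ(X, f ⁻¹ᵁ U) := X.presheaf.map (homOfLE hW.le).op
  have hres : IsIso res := by
    have : IsIso (homOfLE hW.le) := ⟨homOfLE hW.ge, rfl, rfl⟩
    infer_instance
  have hres' : Function.Injective res :=
    ((ConcreteCategory.isIso_iff_bijective res).mp hres).1
  have h₁ (x) : res (π.app W x) = (((invariants hρ).objIso hU).hom x : (invariants hρ).sections U).1 :=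
    congr($((invariants hρ).toSpec_appLE hU) x)
  have hiso := (ConcreteCategory.isIso_iff_bijective ((invariants hρ).objIso hU).hom).mp
    inferInstance
  constructor
  · intro x y hxy
    refine hiso.1 (Subtype.ext ?_)
    exact (h₁ x).symm.trans ((congrArg res hxy).trans (h₁ y))
  · intro x hx
    have h₂ (g : G) : actFunction hρ U g (res x) = res x := by
      have : res ≫ actFunction hρ U g = actFunction (comp_toQuotient hρ) W g ≫ res := by
        rw [Scheme.Hom.map_appLE, Scheme.Hom.appLE_map]
      exact congr($this x).trans (congrArg res (hx g))
    obtain ⟨y, hy⟩ := hiso.2 ⟨res x, h₂⟩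
    exact ⟨y, hres' ((h₁ y).trans (congrArg Subtype.val hy))⟩

theorem isQuotientBy_toQuotient : IsQuotientBy ρ (toQuotient hρ) := by
  have : IsIntegralHom (toQuotient hρ ≫ fromQuotient hρ) := by
    rw [QCSubalgebra.toSpec_fromSpec]
    infer_instance
  have : IsIntegralHom (toQuotient hρ) := .of_comp _ (fromQuotient hρ)
  refine isQuotientBy_of_cover (comp_toQuotient hρ) fun q => ?_
  obtain ⟨U, hU, hqU, -⟩ := exists_isAffineOpen_mem_and_subset
    (x := fromQuotient hρ q) (U := ⊤) trivial
  exact ⟨_, hqU, hU.preimage _, isInvariantOver_quotient hρ hU⟩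

theorem app_appLE_toQuotient (U : Y.Opens) :
    (fromQuotient hρ).app U ≫ (toQuotient hρ).appLE (fromQuotient hρ ⁻¹ᵁ U) (f ⁻¹ᵁ U)
      ((invariants hρ).preimage_le_preimage U) = f.app U := by
  rw [Scheme.Hom.app_eq_appLE, Scheme.Hom.appLE_comp_appLE, Scheme.Hom.app_eq_appLE]
  congr 1
  exact QCSubalgebra.toSpec_fromSpec _

/-- The inclusion of the functions on `X / G` in those on `X`. -/
def quotientInclusion : directImage (fromQuotient hρ) ⟶ directImage f :=
  homOfLinear (fun U =>
    { toFun := (toQuotient hρ).appLE (fromQuotient hρ ⁻¹ᵁ U) (f ⁻¹ᵁ U)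
        ((invariants hρ).preimage_le_preimage U)
      map_add' := fun x y => map_add ((toQuotient hρ).appLE (fromQuotient hρ ⁻¹ᵁ U) (f ⁻¹ᵁ U)
        ((invariants hρ).preimage_le_preimage U)).hom x y
      map_smul' := fun r x => by
        refine (map_mul ((toQuotient hρ).appLE (fromQuotient hρ ⁻¹ᵁ U) (f ⁻¹ᵁ U)
          ((invariants hρ).preimage_le_preimage U)).hom ((fromQuotient hρ).app U r) x).trans ?_
        exact congrArg (· * _) congr($(app_appLE_toQuotient hρ U) r) })
    fun {U V} i x => by
      have : (quotient hρ).presheaf.map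
          (homOfLE ((fromQuotient hρ).preimage_mono i.le)).op ≫
            (toQuotient hρ).appLE (fromQuotient hρ ⁻¹ᵁ V) (f ⁻¹ᵁ V)
              ((invariants hρ).preimage_le_preimage V) =
          (toQuotient hρ).appLE (fromQuotient hρ ⁻¹ᵁ U) (f ⁻¹ᵁ U)
              ((invariants hρ).preimage_le_preimage U) ≫
            X.presheaf.map (homOfLE (f.preimage_mono i.le)).op := by
        rw [Scheme.Hom.map_appLE, Scheme.Hom.appLE_map]
      exact congr($this x)

theorem sharp_quotientInclusion (U : Y.Opens) (r : Γ(structureSheaf Y, U)) :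
    (quotientInclusion hρ).app U ((sharp (fromQuotient hρ)).app U r) = (sharp f).app U r :=
  congr($(app_appLE_toQuotient hρ U) r)

theorem quotientInclusion_app_eq (U : Y.Opens) : ∃ e : Γ(X, toQuotient hρ ⁻¹ᵁ fromQuotient hρ ⁻¹ᵁ U) ≅ Γ(X, f ⁻¹ᵁ U),
    (∀ g, e.hom ≫ actFunction hρ U g = actFunction (comp_toQuotient hρ) (fromQuotient hρ ⁻¹ᵁ U) g ≫ e.hom) ∧
    ∀ x, (quotientInclusion hρ).app U x = e.hom ((toQuotient hρ).app _ x) := by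
  have hW : f ⁻¹ᵁ U = toQuotient hρ ⁻¹ᵁ fromQuotient hρ ⁻¹ᵁ U := by
    rw [← Scheme.Hom.comp_preimage, QCSubalgebra.toSpec_fromSpec]
  have : IsIso (homOfLE hW.le) := ⟨homOfLE hW.ge, rfl, rfl⟩
  refine ⟨asIso (X.presheaf.map (homOfLE hW.le).op), fun g => ?_, fun x => rfl⟩
  rw [asIso_hom, Scheme.Hom.map_appLE, Scheme.Hom.appLE_map]

theorem quotientInclusion_app_injective (U : Y.Opens) :
    Function.Injective ((quotientInclusion hρ).app U) := by
  obtain ⟨e, -, he⟩ := quotientInclusion_app_eq hρ U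
  have hinj := ((ConcreteCategory.isIso_iff_bijective e.hom).mp inferInstance).1.comp
    ((isQuotientBy_toQuotient hρ).injective _)
  exact fun x y hxy => hinj ((he x).symm.trans (hxy.trans (he y)))

/-- The open set is arbitrary here, not only affine, which allows the direct image of the quotient
to be compared with summands as a sheaf. -/
theorem mem_range_quotientInclusion_app (U : Y.Opens) (x : Γ(X, f ⁻¹ᵁ U)) :
    x ∈ Set.range ((quotientInclusion hρ).app U) ↔ ∀ g, actFunction hρ U g x = x := by
  obtain ⟨e, heq, he⟩ := quotientInclusion_app_eq hρ U
  constructor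
  · rintro ⟨y, rfl⟩ g
    rw [he]
    refine congr($(heq g) _).trans (congrArg e.hom ?_)
    exact actFunction_app (comp_toQuotient hρ) _ g y
  · intro hx
    have hinj := ((ConcreteCategory.isIso_iff_bijective e.hom).mp inferInstance)
    obtain ⟨y, rfl⟩ := hinj.2 x
    obtain ⟨z, rfl⟩ := (isQuotientBy_toQuotient hρ).mem_range _ y fun g =>
      hinj.1 (congr($(heq g) y).symm.trans (hx g))
    exact ⟨z, he z⟩

end QuotientOverBase

open ExteriorSheaf

/-! ### Embedding the exterior square by 2 × 2 minors. -/

section Wedge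

/-- The alternating map `(m, n) ↦ f m * g n - f n * g m`. -/
def wedgeAlternating {R M B : Type*} [CommRing R] [AddCommGroup M] [Module R M] [CommRing B]
    [Algebra R B] (f g : M →ₗ[R] B) : M [⋀^Fin 2]→ₗ[R] B where
  toFun m := f (m 0) * g (m 1) - f (m 1) * g (m 0)
  map_update_add' m i x y := by
    fin_cases i <;> simp [Function.update_self, Function.update_of_ne] <;> ring
  map_update_smul' m i c x := by
    fin_cases i <;> simp [Function.update_self, Function.update_of_ne, smul_sub]
  map_eq_zero_of_eq' m i j h hij := by
    have : m 0 = m 1 := by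
      fin_cases i <;> fin_cases j <;> simp_all
    simp [this]

variable {X Y : Scheme.{u}} {φ : X ⟶ Y} {M : Y.Modules} (a b : M ⟶ directImage φ)

/-- The linear map on sections underlying a map to `φ_* 𝒪_X`. -/
def sectionsLinear (U : Y.Opens) :
    letI := (φ.app U).hom.toAlgebra
    Γ(M, U) →ₗ[Γ(Y, U)] Γ(X, φ ⁻¹ᵁ U) :=
  letI := (φ.app U).hom.toAlgebra
  { toFun := fun x => a.app U x
    map_add' := fun x y => map_add (a.app U).hom x y
    map_smul' := fun r x => Scheme.Modules.Hom.app_smul a r x }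

/-- The linear map `⋀² M(U) → Γ(X, φ ⁻¹ U)`, `m ∧ n ↦ a m * b n - a n * b m`. -/
def wedgeLinear (U : Y.Opens) :
    letI := (φ.app U).hom.toAlgebra
    ⋀[Γ(Y, U)]^2 Γ(M, U) →ₗ[Γ(Y, U)] Γ(X, φ ⁻¹ᵁ U) :=
  letI := (φ.app U).hom.toAlgebra
  exteriorPower.alternatingMapLinearEquiv
    (wedgeAlternating (sectionsLinear a U) (sectionsLinear b U))

theorem wedgeLinear_ιMulti (U : Y.Opens) (m : Fin 2 → Γ(M, U)) :
    wedgeLinear a b U (exteriorPower.ιMulti Γ(Y, U) 2 m) =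
      toFunction φ (a.app U (m 0)) * toFunction φ (b.app U (m 1)) -
        toFunction φ (a.app U (m 1)) * toFunction φ (b.app U (m 0)) := by
  let := (φ.app U).hom.toAlgebra
  exact exteriorPower.alternatingMapLinearEquiv_apply_ιMulti _ _

theorem wedgeLinear_semiMap {U V : Y.Opens} (i : V ⟶ U) (x : ⋀[Γ(Y, U)]^2 Γ(M, U)) :
    wedgeLinear a b V (semiMap _ 2 (restr M i) x) =
      X.presheaf.map (homOfLE (φ.preimage_mono i.le)).op (wedgeLinear a b U x) := by
  induction (exteriorPower.ιMulti_span Γ(Y, U) 2 Γ(M, U) ▸ Submodule.mem_top :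
      x ∈ Submodule.span Γ(Y, U) (Set.range (exteriorPower.ιMulti Γ(Y, U) 2)))
    using Submodule.span_induction with
  | mem x hx =>
    obtain ⟨m, rfl⟩ := hx
    have h (c : M ⟶ directImage φ) (l : Fin 2) : toFunction φ (c.app V (restr M i (m l))) =
        X.presheaf.map (homOfLE (φ.preimage_mono i.le)).op (toFunction φ (c.app U (m l))) :=
      app_map c i (m l)
    rw [semiMap_ιMulti, wedgeLinear_ιMulti, wedgeLinear_ιMulti, map_sub, map_mul, map_mul, h, h,
      h, h]
  | zero => simp only [map_zero]
  | add x y _ _ hx hy => simp only [map_add, hx, hy]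
  | smul r x _ hx =>
    let := (φ.app U).hom.toAlgebra
    let := (φ.app V).hom.toAlgebra
    rw [map_smulₛₗ, map_smul, map_smul, hx]
    refine (Algebra.smul_def _ _).trans (Eq.trans ?_ (congrArg _ (Algebra.smul_def _ _)).symm)
    refine Eq.trans ?_ (map_mul _ _ _).symm
    exact congrArg (· * _) (app_map_preimage φ i r)

/-- The map of presheaves of modules underlying `wedge`. -/
def wedgePresheaf : powerPresheaf 2 M ⟶ (SheafOfModules.forget _ ⋙
    PresheafOfModules.restrictScalars (𝟙 Y.ringCatSheaf.obj)).obj (directImage φ) :=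
  PresheafOfModules.homMk
    { app := fun U => AddCommGrpCat.ofHom (wedgeLinear a b U.unop).toAddMonoidHom
      naturality := fun U V i => AddCommGrpCat.hom_ext (AddMonoidHom.ext fun x =>
        wedgeLinear_semiMap a b i.unop x) }
    fun U r x => by
      let := (φ.app U.unop).hom.toAlgebra
      refine ((wedgeLinear a b U.unop).map_smul r x).trans ?_
      exact Algebra.smul_def _ _

/-- The map `⋀² M ⟶ φ_* 𝒪_X`, `m ∧ n ↦ a m * b n - a n * b m`. -/
def wedge : power 2 M ⟶ directImage φ :=
  ((PresheafOfModules.sheafificationAdjunction (𝟙 Y.ringCatSheaf.obj)).homEquiv _ _).symm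
    (wedgePresheaf a b)

/-- The section `m₀ ∧ m₁` of `⋀² M`. -/
def wedgeSection {U : Y.Opens} (m : Fin 2 → Γ(M, U)) : Γ(power 2 M, U) :=
  ((PresheafOfModules.sheafificationAdjunction (𝟙 Y.ringCatSheaf.obj)).unit.app
    (powerPresheaf 2 M)).app (.op U) (exteriorPower.ιMulti Γ(Y, U) 2 m)

theorem wedge_app_wedgeSection {U : Y.Opens} (m : Fin 2 → Γ(M, U)) :
    toFunction φ ((wedge a b).app U (wedgeSection m)) =
      toFunction φ (a.app U (m 0)) * toFunction φ (b.app U (m 1)) -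
        toFunction φ (a.app U (m 1)) * toFunction φ (b.app U (m 0)) := by
  rw [← wedgeLinear_ιMulti]
  have h := (PresheafOfModules.sheafificationAdjunction
    (𝟙 Y.ringCatSheaf.obj)).homEquiv_unit (f := wedge a b)
  rw [wedge, Equiv.apply_symm_apply] at h
  have h' := congr(($h).app (.op U))
  exact congr($h' (exteriorPower.ιMulti Γ(Y, U) 2 m)).symm

theorem map_wedgeSection {U V : Y.Opens} (i : V ⟶ U) (m : Fin 2 → Γ(M, U)) :
    (power 2 M).presheaf.map i.op (wedgeSection m) =
      wedgeSection fun l => M.presheaf.map i.op (m l) := by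
  have h := ((PresheafOfModules.sheafificationAdjunction (𝟙 Y.ringCatSheaf.obj)).unit.app
    (powerPresheaf 2 M)).naturality i.op
  refine congr($h (exteriorPower.ιMulti Γ(Y, U) 2 m)).symm.trans ?_
  exact congrArg _ (semiMap_ιMulti _ 2 (restr M i) m)

end Wedge

/-- The inverse is the adjugate matrix divided by the determinant. -/
theorem bijective_two_by_two {R M : Type*} [CommRing R] [AddCommGroup M] [Module R M]
    {p q r s : R} (h : IsUnit (p * s - q * r)) :
    Function.Bijective fun x : M × M => (p • x.1 + r • x.2, q • x.1 + s • x.2) := by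
  obtain ⟨d, hd⟩ := h.exists_right_inv
  refine Function.bijective_iff_has_inverse.mpr ⟨fun x =>
    (d • (s • x.1 - r • x.2), d • (p • x.2 - q • x.1)), fun x => Prod.ext ?_ ?_,
    fun x => Prod.ext ?_ ?_⟩ <;> dsimp only
  · exact Eq.trans (b := ((p * s - q * r) * d) • x.1) (by module) (by rw [hd, one_smul])
  · exact Eq.trans (b := ((p * s - q * r) * d) • x.2) (by module) (by rw [hd, one_smul])
  · exact Eq.trans (b := ((p * s - q * r) * d) • x.1) (by module) (by rw [hd, one_smul])
  · exact Eq.trans (b := ((p * s - q * r) * d) • x.2) (by module) (by rw [hd, one_smul])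

/-! ### Linear combinations of the two inclusions. -/

section Combination

variable {k : Type u} [Field k] {Y : Scheme.{u}} (s : Y ⟶ Spec (.of k)) {M D N P : Y.Modules}

/-- The linear combination `p a + q b`. -/
def combination (a b : M ⟶ D) (p q : k) : M ⟶ D := constMul s M p ≫ a + constMul s M q ≫ b

theorem combination_app (a b : M ⟶ D) (p q : k) (U : Y.Opens) (x : Γ(M, U)) :
    (combination s a b p q).app U x =
      constants s U p • a.app U x + constants s U q • b.app U x := by
  refine Eq.trans (b := a.app U (constants s U p • x) + b.app U (constants s U q • x)) rfl ?_
  rw [Scheme.Modules.Hom.app_smul, Scheme.Modules.Hom.app_smul]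

theorem bijective_combination {f : N ⟶ D} {a b : M ⟶ D} {t : P ⟶ D} {U : Y.Opens}
    (h : Function.Bijective fun x : Γ(N, U) × Γ(M, U) × Γ(M, U) × Γ(P, U) =>
      f.app U x.1 + (a.app U x.2.1 + (b.app U x.2.2.1 + t.app U x.2.2.2)))
    {p q p' q' : k} (hdet : p * q' - q * p' ≠ 0) :
    Function.Bijective fun x : Γ(N, U) × Γ(M, U) × Γ(M, U) × Γ(P, U) =>
      f.app U x.1 + ((combination s a b p q).app U x.2.1 +
        ((combination s a b p' q').app U x.2.2.1 + t.app U x.2.2.2)) := by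
  have hu : IsUnit (constants s U p * constants s U q' - constants s U q * constants s U p') := by
    rw [← map_mul, ← map_mul, ← map_sub]
    exact hdet.isUnit.map _
  have h₁ : Function.Bijective fun x : Γ(M, U) × Γ(M, U) × Γ(P, U) =>
      (constants s U p • x.1 + constants s U p' • x.2.1,
        constants s U q • x.1 + constants s U q' • x.2.1, x.2.2) := by
    have := (Equiv.prodAssoc Γ(M, U) Γ(M, U) Γ(P, U)).bijective.comp
      (((bijective_two_by_two (M := Γ(M, U)) hu).prodMap
        (Function.bijective_id (α := Γ(P, U)))).comp
          (Equiv.prodAssoc Γ(M, U) Γ(M, U) Γ(P, U)).symm.bijective)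
    exact this
  have h₂ := h.comp ((Function.bijective_id (α := Γ(N, U))).prodMap h₁)
  refine (congrArg _ (funext fun x => ?_)).mp h₂
  simp only [Function.comp_apply, Prod.map_fst, Prod.map_snd, id]
  rw [combination_app, combination_app, map_add, map_add, Scheme.Modules.Hom.app_smul,
    Scheme.Modules.Hom.app_smul, Scheme.Modules.Hom.app_smul, Scheme.Modules.Hom.app_smul]
  abel

end Combination

/-! ### Charts in normal form. -/

section Charts

variable {k : Type u} [Field k] {X Y : Scheme.{u}} (s : Y ⟶ Spec (.of k)) {φ : X ⟶ Y}
  {M P : Y.Modules} (a b : M ⟶ directImage φ)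

theorem IsFrame.eq_zero {U : Y.Opens} {m : Fin 2 → Γ(M, U)} (hm : IsFrame M U m) {x y : Γ(Y, U)}
    (h : x • m 0 + y • m 1 = 0) : x = 0 ∧ y = 0 := by
  have h₁ := Fintype.linearIndependent_iff.mp (hm U (𝟙 U)).1 ![x, y] (by
    have e (l : Fin 2) : M.presheaf.map (𝟙 U : U ⟶ U).op (m l) = m l :=
      congr($(M.presheaf.map_id (.op U)) (m l))
    rw [Fin.sum_univ_two, e, e]
    exact h)
  exact ⟨h₁ 0, h₁ 1⟩

/-- The sum is direct and the frame is independent; the fourth summand plays no role, so any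
complement `t` will do. -/
theorem independent_coordinates {t : P ⟶ directImage φ} {U : Y.Opens}
    (h : Function.Bijective fun x : Γ(structureSheaf Y, U) × Γ(M, U) × Γ(M, U) × Γ(P, U) =>
      (sharp φ).app U x.1 + (a.app U x.2.1 + (b.app U x.2.2.1 + t.app U x.2.2.2)))
    {m : Fin 2 → Γ(M, U)} (hm : IsFrame M U m) :
    Independent (φ.app U).hom (coordinates φ a b U m (0, 0)) (coordinates φ a b U m (0, 1))
      (coordinates φ a b U m (1, 0)) (coordinates φ a b U m (1, 1)) := by
  intro r₀ r₁ r₂ r₃ r₄ hr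
  have h₀ := h.1 (a₁ := (unitSection r₀, r₁ • m 0 + r₂ • m 1, r₃ • m 0 + r₄ • m 1, 0))
    (a₂ := 0) (by
      simp only [map_add, Scheme.Modules.Hom.app_smul, Prod.fst_zero, Prod.snd_zero, map_zero,
        add_zero]
      refine Eq.trans ?_ hr
      change φ.app U r₀ + ((φ.app U r₁ * coordinates φ a b U m (0, 0) +
        φ.app U r₂ * coordinates φ a b U m (0, 1)) + (φ.app U r₃ * coordinates φ a b U m (1, 0) +
        φ.app U r₄ * coordinates φ a b U m (1, 1))) = _
      ring)
  simp only [Prod.mk.injEq, Prod.zero_eq_mk] at h₀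
  obtain ⟨e₀, e₁, e₂, -⟩ := h₀
  exact ⟨e₀, (hm.eq_zero e₁).1, (hm.eq_zero e₁).2, (hm.eq_zero e₂).1, (hm.eq_zero e₂).2⟩

/-- A chart over which the cover is given by the normal equations. -/
structure IsNormalChart (U : Y.Opens) (m : Fin 2 → Γ(M, U)) (c : Fin 4 → Γ(Y, U)) : Prop where
  isAffineOpen : IsAffineOpen U
  isFrame : IsFrame M U m
  isPresentedBy : IsPresentedBy (φ.app U).hom (coordinates φ a b U m)
    (normalEquations (constants s U) c)

variable {a b}

/-- The change of coordinates is the same as a change of the two inclusions of `M`, made once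
globally and independent of the chart. -/
theorem changeCoordinates_eq (g : GL (Fin 2) k) (U : Y.Opens) (m : Fin 2 → Γ(M, U)) :
    changeCoordinates s φ g U (coordinates φ a b U m) =
      coordinates φ (combination s a b (g.val 0 0) (g.val 0 1))
        (combination s a b (g.val 1 0) (g.val 1 1)) U m := by
  funext ⟨i, j⟩
  fin_cases i
  · refine (Fin.sum_univ_two _).trans ?_
    exact (combination_app s a b (g.val 0 0) (g.val 0 1) U (m j)).symm
  · refine (Fin.sum_univ_two _).trans ?_
    exact (combination_app s a b (g.val 1 0) (g.val 1 1) U (m j)).symm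

/-- The functions over `V` are generated by `1`, `a m_j`, `b m_j` and `a m₁ b m₂ - a m₂ b m₁`. -/
def IsSpanned (a b : M ⟶ directImage φ) (V : Y.Opens) (m : Fin 2 → Γ(M, V)) : Prop :=
  ∀ x : Γ(directImage φ, V), ∃ r : Fin 6 → Γ(Y, V), x =
    (sharp φ).app V (unitSection (r 0)) + (a.app V (r 1 • m 0 + r 2 • m 1) +
      (b.app V (r 3 • m 0 + r 4 • m 1) + (wedge a b).app V (r 5 • wedgeSection m)))

theorem IsNormalChart.isSpanned [CharZero k] {U : Y.Opens} {m : Fin 2 → Γ(M, U)}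
    {c : Fin 4 → Γ(Y, U)} (h : IsNormalChart s a b U m c) : IsSpanned a b U m := by
  intro x
  obtain ⟨f, rfl⟩ := h.isPresentedBy.1 x
  obtain ⟨r, hr⟩ := (h.isPresentedBy.normalRelations (constants s U)).exists_coeffs
    (isUnit_two_of_charZero (constants s U)) f
  refine ⟨r, hr.trans ?_⟩
  simp only [map_add, Scheme.Modules.Hom.app_smul]
  have hw : (wedge a b).app U (wedgeSection m) = coordinates φ a b U m (0, 0) *
      coordinates φ a b U m (1, 1) - coordinates φ a b U m (0, 1) *
      coordinates φ a b U m (1, 0) := wedge_app_wedgeSection a b m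
  rw [hw]
  change _ = φ.app U (r 0) + ((φ.app U (r 1) * coordinates φ a b U m (0, 0) +
        φ.app U (r 2) * coordinates φ a b U m (0, 1)) +
        ((φ.app U (r 3) * coordinates φ a b U m (1, 0) +
        φ.app U (r 4) * coordinates φ a b U m (1, 1)) + φ.app U (r 5) * (_)))
  simp only [← add_assoc]

theorem exists_smul_eq_map [IsAffineHom φ] {U : Y.Opens} (hU : IsAffineOpen U) (r : Γ(Y, U))
    (x : Γ(directImage φ, Y.basicOpen r)) : ∃ (v : Γ(Y, Y.basicOpen r)) (y : Γ(directImage φ, U)),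
      IsUnit v ∧ v • x = (directImage φ).presheaf.map (homOfLE (Y.basicOpen_le r)).op y := by
  have hloc := hU.isLocalization_basicOpen r
  have hlocX := QCSubalgebra.isLocalization_app (f := φ) hU r
  let i := homOfLE (Y.basicOpen_le r)
  let := (Y.presheaf.map i.op).hom.toAlgebra
  let := (X.presheaf.map (homOfLE (φ.preimage_mono (Y.basicOpen_le r))).op).hom.toAlgebra
  have hu : IsUnit (Y.presheaf.map i.op r) :=
    IsLocalization.Away.algebraMap_isUnit (S := Γ(Y, Y.basicOpen r)) r
  obtain ⟨n, y, hy⟩ := IsLocalization.Away.surj (S := Γ(X, φ ⁻¹ᵁ Y.basicOpen r)) (φ.app U r) x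
  have hr : X.presheaf.map (homOfLE (φ.preimage_mono (Y.basicOpen_le r))).op (φ.app U r) =
    φ.app _ (Y.presheaf.map i.op r) := (app_map_preimage φ i r).symm
  have hy' : toFunction φ x *
      X.presheaf.map (homOfLE (φ.preimage_mono (Y.basicOpen_le r))).op (φ.app U r) ^ n =
      X.presheaf.map (homOfLE (φ.preimage_mono (Y.basicOpen_le r))).op y := hy
  refine ⟨Y.presheaf.map i.op r ^ n, y, hu.pow n, ?_⟩
  refine Eq.trans ?_ hy'
  rw [hr, mul_comm, ← map_pow (φ.app (Y.basicOpen r)).hom]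
  rfl

/-- Charts need not form a basis of the topology, but their basic open subsets do; spanning is the
property that is passed on to these, by clearing denominators. -/
theorem IsSpanned.basicOpen [IsAffineHom φ] {U : Y.Opens} (hU : IsAffineOpen U)
    {m : Fin 2 → Γ(M, U)} (h : IsSpanned a b U m) (r : Γ(Y, U)) :
    IsSpanned a b (Y.basicOpen r)
      fun l => M.presheaf.map (homOfLE (Y.basicOpen_le r)).op (m l) := by
  intro x
  obtain ⟨v, y, hv, hxy⟩ := exists_smul_eq_map hU r x
  obtain ⟨v', hv'⟩ := hv.exists_right_inv
  obtain ⟨l, hl⟩ := h y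
  let i := homOfLE (Y.basicOpen_le r)
  refine ⟨fun j => v' * Y.presheaf.map i.op (l j), ?_⟩
  have hx : x = v' • (directImage φ).presheaf.map i.op y := by
    rw [← hxy, smul_smul, mul_comm, hv', one_smul]
  rw [hx, hl]
  simp only [map_add, ← app_map, Scheme.Modules.map_smul, map_wedgeSection, smul_add,
    Scheme.Modules.Hom.app_smul, mul_smul, map_unitSection]
  rw [app_unitSection, app_unitSection _ (v' * _), mul_smul]

end Charts

/-! ### The decomposition with the minors as last summand, and matrices acting on it. -/

section Decomposition

variable {k : Type u} [Field k] {X Y : Scheme.{u}} (s : Y ⟶ Spec (.of k)) {φ : X ⟶ Y}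
  {M P : Y.Modules} (a b : M ⟶ directImage φ)

/-- Principal open subsets of normal charts. -/
def IsChartOpen (V : Y.Opens) : Prop :=
  ∃ (U : Y.Opens) (m : Fin 2 → Γ(M, U)) (c : Fin 4 → Γ(Y, U)) (r : Γ(Y, U)),
    IsNormalChart s a b U m c ∧ V = Y.basicOpen r

theorem isFrame_map {n : ℕ} {U V : Y.Opens} (i : V ⟶ U) {m : Fin n → Γ(M, U)}
    (hm : IsFrame M U m) : IsFrame M V fun l => M.presheaf.map i.op (m l) := by
  intro W j
  simp only [map_map]
  exact hm W (j ≫ i)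

variable {s a b}

theorem IsChartOpen.exists_frame [CharZero k] [IsAffineHom φ] {V : Y.Opens}
    (h : IsChartOpen s a b V) : IsAffineOpen V ∧ ∃ m : Fin 2 → Γ(M, V),
      IsFrame M V m ∧ IsSpanned a b V m := by
  obtain ⟨U, m, c, r, hU, rfl⟩ := h
  exact ⟨hU.isAffineOpen.basicOpen r, _, isFrame_map _ hU.isFrame,
    hU.isSpanned.basicOpen hU.isAffineOpen r⟩

theorem exists_isChartOpen_le (hcov : ∀ y : Y, ∃ (U : Y.Opens) (m : Fin 2 → Γ(M, U))
    (c : Fin 4 → Γ(Y, U)), y ∈ U ∧ IsNormalChart s a b U m c) {V : Y.Opens} {y : Y} (hy : y ∈ V) :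
    ∃ W : Y.Opens, y ∈ W ∧ W ≤ V ∧ IsChartOpen s a b W := by
  obtain ⟨U, m, c, hyU, hU⟩ := hcov y
  obtain ⟨r, hr, hyr⟩ := hU.isAffineOpen.exists_basicOpen_le ⟨y, hy⟩ hyU
  exact ⟨_, hyr, hr, U, m, c, r, hU, rfl⟩

variable (a b) in
/-- The map `𝒪 ⊕ M ⊕ M ⊕ ⋀² M ⟶ φ_* 𝒪_X` defined by `a`, `b` and `wedge a b`. -/
def decomposition : structureSheaf Y ⊞ (M ⊞ (M ⊞ power 2 M)) ⟶ directImage φ :=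
  biprod.desc (sharp φ) (biprod.desc a (biprod.desc b (wedge a b)))

/-- On a basis of affine open sets the map is surjective by `IsSpanned`. Composed with the inverse
of the isomorphism `E`, it is a surjective endomorphism of a finite module, and such an endomorphism
is injective. -/
theorem isIso_decomposition [CharZero k] [IsFinite φ]
    (hcov : ∀ y : Y, ∃ (U : Y.Opens) (m : Fin 2 → Γ(M, U))
      (c : Fin 4 → Γ(Y, U)), y ∈ U ∧ IsNormalChart s a b U m c)
    (E : structureSheaf Y ⊞ (M ⊞ (M ⊞ power 2 M)) ⟶ directImage φ) [IsIso E] :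
    IsIso (decomposition a b) := by
  have hsurj (V : Y.Opens) (hV : IsChartOpen s a b V) :
      Function.Surjective ((decomposition a b).app V) := by
    obtain ⟨-, m, -, hspan⟩ := hV.exists_frame
    have h₁ := biprod_sections_bijective (structureSheaf Y) (M ⊞ (M ⊞ power 2 M)) V
    have h₂ := biprod_sections_bijective M (M ⊞ power 2 M) V
    have h₃ := biprod_sections_bijective M (power 2 M) V
    have h := (Function.bijective_id.prodMap (Function.bijective_id.prodMap h₃)).comp
      ((Function.bijective_id.prodMap h₂).comp h₁)
    intro x
    obtain ⟨r, hr⟩ := hspan x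
    obtain ⟨y, hy⟩ := h.2 (unitSection (r 0), r 1 • m 0 + r 2 • m 1, r 3 • m 0 + r 4 • m 1,
      r 5 • wedgeSection m)
    refine ⟨y, ?_⟩
    simp only [Function.comp_apply, Prod.map_apply, id, Prod.mk.injEq] at hy
    rw [decomposition, biprod_desc_app, biprod_desc_app, biprod_desc_app, hy.1, hy.2.1, hy.2.2.1,
      hy.2.2.2]
    exact hr.symm
  have hiso : IsIso (inv E ≫ decomposition a b) := by
    refine isIso_of_basis (ι := {V : Y.Opens // IsChartOpen s a b V}) (B := Subtype.val) ?_ ?_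
    · rw [TopologicalSpace.Opens.isBasis_iff_nbhd]
      intro V y hy
      obtain ⟨W, hyW, hWV, hW⟩ := exists_isChartOpen_le hcov hy
      exact ⟨W, ⟨⟨W, hW⟩, rfl⟩, hyW, hWV⟩
    · rintro ⟨V, hV⟩
      have hVa := hV.exists_frame.1
      let g : Γ(directImage φ, V) →ₗ[Γ(Y, V)] Γ(directImage φ, V) :=
        { toFun := fun x => (inv E ≫ decomposition a b).app V x
          map_add' := fun x y => map_add ((inv E ≫ decomposition a b).app V).hom x y
          map_smul' := fun r x => Scheme.Modules.Hom.app_smul _ r x }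
      have : Module.Finite Γ(Y, V) Γ(directImage φ, V) := IsFinite.finite_app φ V hVa
      have hg : Function.Surjective g := by
        have h₁ := ((isIso_iff_bijective (f := inv E)).mp inferInstance V).2
        exact (hsurj V hV).comp h₁
      exact ⟨OrzechProperty.injective_of_surjective_endomorphism g hg, hg⟩
  have : decomposition a b = E ≫ inv E ≫ decomposition a b := by simp
  rw [this]
  infer_instance

variable (s) [hD : IsIso (decomposition a b)]

variable (a b) in
theorem decomposition_bijective (U : Y.Opens) : Function.Bijective
    fun x : Γ(structureSheaf Y, U) × Γ(M, U) × Γ(M, U) × Γ(power 2 M, U) =>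
      (sharp φ).app U x.1 + (a.app U x.2.1 + (b.app U x.2.2.1 + (wedge a b).app U x.2.2.2)) :=
  (bijective_biprod_desc_iff _ _ _ _ U).mp (isIso_iff_bijective.mp hD U)

variable (a b) in
theorem decomposition_induction {U : Y.Opens} {p : Γ(directImage φ, U) → Prop}
    (hs : ∀ r, p ((sharp φ).app U r)) (ha : ∀ m, p (a.app U m)) (hb : ∀ m, p (b.app U m))
    (hw : ∀ n, p ((wedge a b).app U n)) (hadd : ∀ x y, p x → p y → p (x + y)) (x) : p x := by
  obtain ⟨⟨r, m, n, o⟩, rfl⟩ := (decomposition_bijective a b U).2 x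
  exact hadd _ _ (hs r) (hadd _ _ (ha m) (hadd _ _ (hb n) (hw o)))

variable (a b) in
/-- The endomorphism of `φ_* 𝒪_X` defined by a matrix acting on the two copies of `M`. -/
def matrixEnd (g : Matrix (Fin 2) (Fin 2) k) : directImage φ ⟶ directImage φ :=
  inv (decomposition a b) ≫ biprod.desc (sharp φ) (biprod.desc (combination s a b (g 0 0) (g 1 0))
    (biprod.desc (combination s a b (g 0 1) (g 1 1)) (constMul s _ g.det ≫ wedge a b)))

variable (g h : Matrix (Fin 2) (Fin 2) k) {U : Y.Opens}

theorem matrixEnd_sharp (r) :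
    (matrixEnd s a b g).app U ((sharp φ).app U r) = (sharp φ).app U r := by
  have : sharp φ ≫ matrixEnd s a b g = sharp φ := by
    have : sharp φ = biprod.inl ≫ decomposition a b := by simp [decomposition]
    conv_lhs => rw [this, matrixEnd]
    simp
  exact congr(($this).app U r)

theorem matrixEnd_left (m) : (matrixEnd s a b g).app U (a.app U m) =
    constants s U (g 0 0) • a.app U m + constants s U (g 1 0) • b.app U m := by
  have : a ≫ matrixEnd s a b g = combination s a b (g 0 0) (g 1 0) := by
    have : a = biprod.inl ≫ biprod.inr ≫ decomposition a b := by simp [decomposition]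
    conv_lhs => lhs; rw [this]
    rw [matrixEnd]
    simp
  exact congr(($this).app U m).trans (combination_app ..)

theorem matrixEnd_right (m) : (matrixEnd s a b g).app U (b.app U m) =
    constants s U (g 0 1) • a.app U m + constants s U (g 1 1) • b.app U m := by
  have : b ≫ matrixEnd s a b g = combination s a b (g 0 1) (g 1 1) := by
    have : b = biprod.inl ≫ biprod.inr ≫ biprod.inr ≫ decomposition a b := by
      simp [decomposition]
    conv_lhs => lhs; rw [this]
    rw [matrixEnd]
    simp
  exact congr(($this).app U m).trans (combination_app ..)

theorem matrixEnd_wedge (m) : (matrixEnd s a b g).app U ((wedge a b).app U m) =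
    constants s U g.det • (wedge a b).app U m := by
  have : wedge a b ≫ matrixEnd s a b g = constMul s _ g.det ≫ wedge a b := by
    have : wedge a b = biprod.inr ≫ biprod.inr ≫ biprod.inr ≫ decomposition a b := by
      simp [decomposition]
    conv_lhs => lhs; rw [this]
    rw [matrixEnd]
    simp
  refine congr(($this).app U m).trans ?_
  exact Scheme.Modules.Hom.app_smul (wedge a b) (constants s U g.det) m

theorem matrixEnd_one (x) : (matrixEnd s a b 1).app U x = x := by
  induction x using decomposition_induction a b with
  | hs r => rw [matrixEnd_sharp]
  | ha m =>
    rw [matrixEnd_left, Matrix.one_apply_eq, Matrix.one_apply_ne one_ne_zero, map_one, map_zero,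
      one_smul, zero_smul, add_zero]
  | hb m =>
    rw [matrixEnd_right, Matrix.one_apply_eq, Matrix.one_apply_ne zero_ne_one, map_one, map_zero,
      one_smul, zero_smul, zero_add]
  | hw m => rw [matrixEnd_wedge, Matrix.det_one, map_one, one_smul]
  | hadd x y hx hy => rw [map_add, hx, hy]

/-- The columns of the matrix are the images of the two copies of `M`, so products correspond to
compositions; on the last summand this is multiplicativity of the determinant. -/
theorem matrixEnd_mul (x) : (matrixEnd s a b (g * h)).app U x =
    (matrixEnd s a b g).app U ((matrixEnd s a b h).app U x) := by
  induction x using decomposition_induction a b with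
  | hs r => rw [matrixEnd_sharp, matrixEnd_sharp, matrixEnd_sharp]
  | ha m =>
    rw [matrixEnd_left, matrixEnd_left, map_add, Scheme.Modules.Hom.app_smul,
      Scheme.Modules.Hom.app_smul, matrixEnd_left, matrixEnd_right]
    simp only [Matrix.mul_apply, Fin.sum_univ_two, map_add, map_mul]
    module
  | hb m =>
    rw [matrixEnd_right, matrixEnd_right, map_add, Scheme.Modules.Hom.app_smul,
      Scheme.Modules.Hom.app_smul, matrixEnd_left, matrixEnd_right]
    simp only [Matrix.mul_apply, Fin.sum_univ_two, map_add, map_mul]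
    module
  | hw m =>
    rw [matrixEnd_wedge, matrixEnd_wedge, Scheme.Modules.Hom.app_smul, matrixEnd_wedge,
      Matrix.det_mul, map_mul, smul_smul, mul_comm]
  | hadd x y hx hy => rw [map_add, hx, hy, map_add, map_add]

end Decomposition

/-! ### Symmetries of the normal relations. -/

section Relations

variable {A B : Type u} [CommRing A] [CommRing B] {ψ : A →+* B} {c : Fin 4 → A} {z₁ z₂ w₁ w₂ : B}

/-- The relations are homogeneous when z and w have weights 1 and 2 modulo 3: zz is linear in w, ww
is linear in z, and zw is constant. -/
theorem NormalRelations.smul (h : NormalRelations ψ c z₁ z₂ w₁ w₂) {α β : B} (hα : α ^ 2 = β)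
    (hβ : β ^ 2 = α) (hαβ : α * β = 1) :
    NormalRelations ψ c (α * z₁) (α * z₂) (β * w₁) (β * w₂) where
  zz₀ := by linear_combination α ^ 2 * h.zz₀ + (ψ (c 1) * w₁ + ψ (c 0) * w₂) * hα
  zz₁ := by linear_combination α ^ 2 * h.zz₁ + (-ψ (c 2) * w₁ - ψ (c 1) * w₂) * hα
  zz₂ := by linear_combination α ^ 2 * h.zz₂ + (ψ (c 3) * w₁ + ψ (c 2) * w₂) * hα
  zw₀ := by linear_combination h.zw₀ + z₁ * w₁ * hαβ
  zw₁ := by linear_combination h.zw₁ + (z₁ * w₂ + z₂ * w₁) * hαβ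
  zw₂ := by linear_combination h.zw₂ + z₂ * w₂ * hαβ
  ww₀ := by linear_combination β ^ 2 * h.ww₀ + (ψ (c 1) * z₁ + ψ (c 0) * z₂) * hβ
  ww₁ := by linear_combination β ^ 2 * h.ww₁ + (-ψ (c 2) * z₁ - ψ (c 1) * z₂) * hβ
  ww₂ := by linear_combination β ^ 2 * h.ww₂ + (ψ (c 3) * z₁ + ψ (c 2) * z₂) * hβ

theorem NormalRelations.swap (h : NormalRelations ψ c z₁ z₂ w₁ w₂) :
    NormalRelations ψ c w₁ w₂ z₁ z₂ where
  zz₀ := h.ww₀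
  zz₁ := h.ww₁
  zz₂ := h.ww₂
  zw₀ := by linear_combination h.zw₀
  zw₁ := by linear_combination h.zw₁
  zw₂ := by linear_combination h.zw₂
  ww₀ := h.zz₀
  ww₁ := h.zz₁
  ww₂ := h.zz₂

/-- The matrices which preserve the normal relations. -/
def IsSymmetry {k : Type*} [Field k] (g : Matrix (Fin 2) (Fin 2) k) : Prop :=
  ∃ α β : k, α ^ 2 = β ∧ β ^ 2 = α ∧ α * β = 1 ∧ (g = !![α, 0; 0, β] ∨ g = !![0, α; β, 0])

theorem IsSymmetry.normalRelations {k : Type*} [Field k] {g : Matrix (Fin 2) (Fin 2) k}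
    (hg : IsSymmetry g) (κ : k →+* B) (h : NormalRelations ψ c z₁ z₂ w₁ w₂) :
    NormalRelations ψ c (κ (g 0 0) * z₁ + κ (g 1 0) * w₁) (κ (g 0 0) * z₂ + κ (g 1 0) * w₂)
      (κ (g 0 1) * z₁ + κ (g 1 1) * w₁) (κ (g 0 1) * z₂ + κ (g 1 1) * w₂) := by
  obtain ⟨α, β, hα, hβ, hαβ, rfl | rfl⟩ := hg
  · have := h.smul (α := κ α) (β := κ β) (by rw [← map_pow, hα]) (by rw [← map_pow, hβ])
      (by rw [← map_mul, hαβ, map_one])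
    simpa using this
  · have := h.swap.smul (α := κ β) (β := κ α) (by rw [← map_pow, hβ]) (by rw [← map_pow, hα])
      (by rw [← map_mul, mul_comm, hαβ, map_one])
    simpa using this

end Relations

/-! ### Symmetries act by ring homomorphisms. -/

section Multiplicativity

variable {k : Type u} [Field k] [CharZero k] {X Y : Scheme.{u}} {s : Y ⟶ Spec (.of k)}
  {φ : X ⟶ Y} {M : Y.Modules} {a b : M ⟶ directImage φ} [IsIso (decomposition a b)]
  {g : Matrix (Fin 2) (Fin 2) k}

/-- The transformed coordinates satisfy the normal relations again, so the presentation yields a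
ring endomorphism. It agrees with `matrixEnd` on the spanning elements, the minor z₁w₂ - z₂w₁ being
multiplied by the determinant. -/
theorem matrixEnd_chart_mul (hg : IsSymmetry g) {U : Y.Opens} {m : Fin 2 → Γ(M, U)}
    {c : Fin 4 → Γ(Y, U)} (hU : IsNormalChart s a b U m c) (x y : Γ(X, φ ⁻¹ᵁ U)) :
    toFunction φ ((matrixEnd s a b g).app U (x * y)) =
      toFunction φ ((matrixEnd s a b g).app U x) * toFunction φ ((matrixEnd s a b g).app U y) := by
  let κ := (φ.app U).hom.comp (constants s U)
  let x₀ := coordinates φ a b U m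
  let y₀ : Fin 2 × Fin 2 → Γ(X, φ ⁻¹ᵁ U) := fun p =>
    κ (g 0 p.1) * x₀ (0, p.2) + κ (g 1 p.1) * x₀ (1, p.2)
  obtain ⟨F, hF, hF'⟩ := hU.isPresentedBy.exists_ringHom (constants s U) (y := y₀)
    (hg.normalRelations κ (hU.isPresentedBy.normalRelations (constants s U)))
  let F₀ : Γ(directImage φ, U) →+ Γ(directImage φ, U) := F.toAddMonoidHom
  have hFa (j : Fin 2) : F₀ (a.app U (m j)) = (matrixEnd s a b g).app U (a.app U (m j)) :=
    (hF' (0, j)).trans (matrixEnd_left s g (m j)).symm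
  have hFb (j : Fin 2) : F₀ (b.app U (m j)) = (matrixEnd s a b g).app U (b.app U (m j)) :=
    (hF' (1, j)).trans (matrixEnd_right s g (m j)).symm
  have hsmul (r : Γ(Y, U)) (x : Γ(directImage φ, U)) : F₀ (r • x) = r • F₀ x :=
    (map_mul F (φ.app U r) x).trans (congrArg (· * _) (hF r))
  have hFw : F₀ ((wedge a b).app U (wedgeSection m)) =
      (matrixEnd s a b g).app U ((wedge a b).app U (wedgeSection m)) := by
    rw [matrixEnd_wedge]
    have hw : (wedge a b).app U (wedgeSection m) = x₀ (0, 0) * x₀ (1, 1) - x₀ (0, 1) * x₀ (1, 0) :=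
      wedge_app_wedgeSection a b m
    rw [hw]
    change F (x₀ (0, 0) * x₀ (1, 1) - x₀ (0, 1) * x₀ (1, 0)) =
      κ g.det * (x₀ (0, 0) * x₀ (1, 1) - x₀ (0, 1) * x₀ (1, 0))
    rw [map_sub, map_mul, map_mul, hF', hF', hF', hF', Matrix.det_fin_two, map_sub, map_mul,
      map_mul]
    ring
  have key (x : Γ(X, φ ⁻¹ᵁ U)) : F x = toFunction φ ((matrixEnd s a b g).app U x) := by
    change F₀ x = (matrixEnd s a b g).app U x
    obtain ⟨r, rfl⟩ := IsNormalChart.isSpanned s hU x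
    simp only [map_add, Scheme.Modules.Hom.app_smul, hsmul, hFa, hFb, hFw, matrixEnd_sharp]
    exact congrArg (· + _) (hF (r 0))
  rw [← key, ← key, ← key, map_mul]

/-- From charts the identity passes to their basic open subsets by clearing denominators, which is
possible because `matrixEnd` is linear, and from these to all open sets by the sheaf property. -/
theorem matrixEnd_mul_mul [IsAffineHom φ] (hg : IsSymmetry g)
    (hcov : ∀ y : Y, ∃ (U : Y.Opens) (m : Fin 2 → Γ(M, U))
      (c : Fin 4 → Γ(Y, U)), y ∈ U ∧ IsNormalChart s a b U m c) {U : Y.Opens}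
    (x y : Γ(X, φ ⁻¹ᵁ U)) :
    toFunction φ ((matrixEnd s a b g).app U (x * y)) =
      toFunction φ ((matrixEnd s a b g).app U x) * toFunction φ ((matrixEnd s a b g).app U y) := by
  have hmap {V W : Y.Opens} (i : W ⟶ V) (x : Γ(directImage φ, V)) :=
    app_map (matrixEnd s a b g) i x
  have hchart (V : Y.Opens) (hV : IsChartOpen s a b V) (x y : Γ(X, φ ⁻¹ᵁ V)) :
      toFunction φ ((matrixEnd s a b g).app V (x * y)) =
        toFunction φ ((matrixEnd s a b g).app V x) *
          toFunction φ ((matrixEnd s a b g).app V y) := by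
    obtain ⟨U, m, c, r, hU, rfl⟩ := hV
    obtain ⟨v, (x' : Γ(X, φ ⁻¹ᵁ U)), hv, hx⟩ := exists_smul_eq_map (φ := φ) hU.isAffineOpen r x
    obtain ⟨v', (y' : Γ(X, φ ⁻¹ᵁ U)), hv', hy⟩ := exists_smul_eq_map (φ := φ) hU.isAffineOpen r y
    let i := homOfLE (Y.basicOpen_le r)
    let θ := fun z : Γ(X, φ ⁻¹ᵁ Y.basicOpen r) =>
      toFunction φ ((matrixEnd s a b g).app (Y.basicOpen r) z)
    let f := φ.app (Y.basicOpen r)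
    have hlin (w : Γ(Y, Y.basicOpen r)) (z : Γ(X, φ ⁻¹ᵁ Y.basicOpen r)) : θ (f w * z) = f w * θ z :=
      Scheme.Modules.Hom.app_smul (matrixEnd s a b g) w (x := z)
    let res := X.presheaf.map (homOfLE (φ.preimage_mono i.le)).op
    have hx' : f v * x = res x' := hx
    have hy' : f v' * y = res y' := hy
    have hres (z : Γ(X, φ ⁻¹ᵁ U)) :
        θ (res z) = res (toFunction φ ((matrixEnd s a b g).app U z)) := hmap i z
    have h₁ : θ (res (x' * y')) = θ (res x') * θ (res y') := by
      rw [hres, hres, hres, matrixEnd_chart_mul hg hU, map_mul]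
    have hunit : IsUnit (f (v * v')) := (hv.mul hv').map f.hom
    change θ (x * y) = θ x * θ y
    refine hunit.mul_left_cancel ?_
    rw [← hlin, map_mul]
    rw [map_mul, ← hx', ← hy', hlin, hlin, show f v * x * (f v' * y) = f v * f v' * (x * y) by
      ring] at h₁
    rw [h₁]
    ring
  refine eq_of_forall_mem (directImage φ) (U := U) fun p hp => ?_
  obtain ⟨V, hpV, hVU, hV⟩ := exists_isChartOpen_le hcov hp
  refine ⟨V, homOfLE hVU, hpV, ?_⟩
  let res := X.presheaf.map (homOfLE (φ.preimage_mono hVU)).op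
  have hres (z : Γ(X, φ ⁻¹ᵁ U)) : toFunction φ ((matrixEnd s a b g).app V (res z)) =
    res (toFunction φ ((matrixEnd s a b g).app U z)) := hmap (homOfLE hVU) z
  have h₁ := hchart V hV (res x) (res y)
  rw [← map_mul, hres, hres, hres, ← map_mul] at h₁
  exact h₁

/-- The action of a symmetry on functions, as a ring homomorphism. -/
theorem exists_matrixEnd_ringHom [IsAffineHom φ] (hg : IsSymmetry g)
    (hcov : ∀ y : Y, ∃ (U : Y.Opens) (m : Fin 2 → Γ(M, U))
      (c : Fin 4 → Γ(Y, U)), y ∈ U ∧ IsNormalChart s a b U m c) (U : Y.Opens) :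
    ∃ F : Γ(X, φ ⁻¹ᵁ U) ⟶ Γ(X, φ ⁻¹ᵁ U), ∀ x, F x = (matrixEnd s a b g).app U x :=
  ⟨CommRingCat.ofHom
    { toFun := fun x => (matrixEnd s a b g).app U x
      map_one' := by
        have h₁ : (1 : Γ(X, φ ⁻¹ᵁ U)) = (sharp φ).app U (unitSection 1) :=
          (map_one (φ.app U).hom).symm
        exact (congrArg _ h₁).trans ((matrixEnd_sharp s g _).trans h₁.symm)
      map_zero' := map_zero ((matrixEnd s a b g).app U).hom
      map_add' := map_add ((matrixEnd s a b g).app U).hom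
      map_mul' := matrixEnd_mul_mul hg hcov }, fun _ => rfl⟩

end Multiplicativity

/-! ### The two-dimensional representation of S₃. -/

section Representation

variable {k : Type u} [Field k]

/-- The two-dimensional representation of `S₃`, for a primitive third root of unity `ω`. -/
def permMatrix (ω : k) (σ : Equiv.Perm (Fin 3)) : Matrix (Fin 2) (Fin 2) k :=
  if Equiv.Perm.sign σ = 1 then !![ω ^ (σ 0).val, 0; 0, ω ^ (2 * (σ 0).val)]
  else !![0, ω ^ (σ 0).val; ω ^ (2 * (σ 0).val), 0]

variable {ω : k}

theorem pow_mod_three (hω : ω ^ 3 = 1) (n : ℕ) : ω ^ n = ω ^ (n % 3) := by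
  conv_lhs => rw [← Nat.div_add_mod n 3, pow_add, pow_mul, hω, one_pow, one_mul]

theorem isSymmetry_permMatrix (hω : ω ^ 3 = 1) (σ : Equiv.Perm (Fin 3)) :
    IsSymmetry (permMatrix ω σ) := by
  refine ⟨ω ^ (σ 0).val, ω ^ (2 * (σ 0).val), by ring, ?_, ?_, ?_⟩
  · rw [← pow_mul, pow_mod_three hω, pow_mod_three hω (σ 0).val]
    congr 1
    omega
  · rw [← pow_add, pow_mod_three hω]
    have : ((σ 0).val + 2 * (σ 0).val) % 3 = 0 := by omega
    rw [this, pow_zero]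
  · rw [permMatrix]
    split_ifs
    · exact Or.inl rfl
    · exact Or.inr rfl

theorem permMatrix_one : permMatrix ω 1 = 1 := by
  rw [permMatrix, if_pos (map_one _)]
  simp [Matrix.one_fin_two]

/-- Modulo 3 an even permutation is x ↦ x + σ(0) and an odd one is x ↦ σ(0) - x; the coefficient 2
stands for -1. -/
theorem perm_mul_apply_zero : ∀ σ τ : Equiv.Perm (Fin 3), ((σ * τ) 0).val =
    if Equiv.Perm.sign σ = 1 then ((σ 0).val + (τ 0).val) % 3
    else ((σ 0).val + 2 * (τ 0).val) % 3 := by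
  decide

theorem permMatrix_mul (hω : ω ^ 3 = 1) (σ τ : Equiv.Perm (Fin 3)) :
    permMatrix ω (σ * τ) = permMatrix ω σ * permMatrix ω τ := by
  have hmod (m n : ℕ) (h : m % 3 = n % 3) : ω ^ m = ω ^ n := by
    rw [pow_mod_three hω m, h, ← pow_mod_three hω n]
  have h₀ := perm_mul_apply_zero σ τ
  rw [permMatrix, permMatrix, permMatrix, map_mul]
  have hne : (-1 : ℤˣ) ≠ 1 := by decide
  generalize ((σ * τ) 0).val = l, (σ 0).val = m, (τ 0).val = n at h₀ ⊢
  rcases Int.units_eq_one_or (Equiv.Perm.sign σ) with hσ | hσ <;>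
    rcases Int.units_eq_one_or (Equiv.Perm.sign τ) with hτ | hτ <;>
    simp only [hσ, hτ, mul_one, one_mul, neg_mul_neg, if_true, if_neg hne] at h₀ ⊢ <;>
    simp only [Matrix.mul_fin_two, mul_zero, zero_mul, add_zero, zero_add, ← pow_add]
  · rw [hmod l (m + n) (by omega), hmod (2 * l) (2 * m + 2 * n) (by omega)]
  · rw [hmod l (m + n) (by omega), hmod (2 * l) (2 * m + 2 * n) (by omega)]
  · rw [hmod l (m + 2 * n) (by omega), hmod (2 * l) (2 * m + n) (by omega)]
  · rw [hmod l (m + 2 * n) (by omega), hmod (2 * l) (2 * m + n) (by omega)]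

theorem perm_ext_of_sign : ∀ σ τ : Equiv.Perm (Fin 3),
    Equiv.Perm.sign σ = Equiv.Perm.sign τ → σ 0 = τ 0 → σ = τ := by
  decide

theorem injective_permMatrix (hω : IsPrimitiveRoot ω 3) :
    Function.Injective (permMatrix ω) := by
  intro σ τ h
  have hne : (-1 : ℤˣ) ≠ 1 := by decide
  have h0 (n : ℕ) : ω ^ n ≠ 0 := pow_ne_zero n (hω.ne_zero three_ne_zero)
  have hpow (h : ω ^ (σ 0).val = ω ^ (τ 0).val) : σ 0 = τ 0 :=
    Fin.ext (hω.pow_inj (σ 0).isLt (τ 0).isLt h)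
  rw [permMatrix, permMatrix] at h
  rcases Int.units_eq_one_or (Equiv.Perm.sign σ) with hσ | hσ <;>
    rcases Int.units_eq_one_or (Equiv.Perm.sign τ) with hτ | hτ <;>
    simp only [hσ, hτ, if_true, if_neg hne] at h
  · exact perm_ext_of_sign σ τ (hσ.trans hτ.symm) (hpow congr($h 0 0))
  · exact absurd congr($h 0 0) (h0 _)
  · exact absurd congr($h 0 0).symm (h0 _)
  · exact perm_ext_of_sign σ τ (hσ.trans hτ.symm) (hpow congr($h 0 1))

end Representation

/-! ### Direct summands of covering maps. -/

section Retracts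

variable {X Z Y : Scheme.{u}}

theorem flat_of_isAffineHom (f : X ⟶ Y) [IsAffineHom f]
    (h : ∀ U : Y.Opens, IsAffineOpen U → (f.app U).hom.Flat) : Flat f where
  flat_appLE := by
    intro U hU V hV e
    have h₁ : (X.presheaf.map (homOfLE e).op).hom.Flat := by
      -- Restriction between affine open sets is flat, as an instance of flatness of the identity
      -- morphism.
      have := Scheme.Hom.flat_appLE (𝟙 X) (hU.preimage f) hV e
      have h₂ : (𝟙 X : X ⟶ X).appLE (f ⁻¹ᵁ U) V e = X.presheaf.map (homOfLE e).op := by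
        have h₃ (α : X ⟶ X) (hα : α = 𝟙 X) (e' : V ≤ α ⁻¹ᵁ (f ⁻¹ᵁ U)) :
            α.appLE (f ⁻¹ᵁ U) V e' = X.presheaf.map (homOfLE e).op := by
          subst hα
          rw [Scheme.Hom.appLE, Scheme.Hom.id_app]
          exact Category.id_comp _
        exact h₃ _ rfl _
      exact h₂ ▸ this
    exact (h U hU).comp h₁

/-- The linear map on sections underlying a morphism of sheaves of modules. -/
def sectionsLinearMap {M N : Y.Modules} (f : M ⟶ N) (U : Y.Opens) :
    Γ(M, U) →ₗ[Γ(Y, U)] Γ(N, U) where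
  toFun x := f.app U x
  map_add' x y := map_add (f.app U).hom x y
  map_smul' r x := Scheme.Modules.Hom.app_smul f r x

/-- A covering map whose direct image is a retract of that of a covering map. -/
theorem IsCoveringMap.of_retract {f : X ⟶ Y} {g : Z ⟶ Y} {n d : ℕ} (hf : IsCoveringMap f n)
    [IsAffineHom g] (ι : directImage g ⟶ directImage f) (p : directImage f ⟶ directImage g)
    (h : ι ≫ p = 𝟙 _) (hg : IsLocallyFreeOfRank (directImage g) d) : IsCoveringMap g d where
  finite := by
    refine ⟨fun U hU => ?_⟩
    have := hf.finite
    have h₁ : Module.Finite Γ(Y, U) Γ(directImage f, U) := IsFinite.finite_app f U hU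
    have h₂ : Module.Finite Γ(Y, U) Γ(directImage g, U) :=
      Module.Finite.of_surjective (sectionsLinearMap p U) fun x =>
        ⟨ι.app U x, congr(($h).app U x)⟩
    exact h₂
  flat := by
    refine flat_of_isAffineHom g fun U hU => ?_
    have := hf.finite
    have := hf.flat
    have h₁ : Module.Flat Γ(Y, U) Γ(directImage f, U) := by
      have := Scheme.Hom.flat_appLE f hU (hU.preimage f) le_rfl
      rw [← Scheme.Hom.app_eq_appLE] at this
      exact this
    have h₂ : Module.Flat Γ(Y, U) Γ(directImage g, U) :=
      Module.Flat.of_retract (sectionsLinearMap ι U) (sectionsLinearMap p U)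
        (LinearMap.ext fun x => congr(($h).app U x))
    exact h₂
  locallyFree := hg

/-- Lifting a morphism through a morphism which is injective on sections. -/
theorem exists_lift {M N D : Y.Modules} (ι : N ⟶ D) (hι : ∀ U, Function.Injective (ι.app U))
    (j : M ⟶ D) (hj : ∀ U x, j.app U x ∈ Set.range (ι.app U)) : ∃ i : M ⟶ N, i ≫ ι = j := by
  choose l hl using hj
  refine ⟨homOfLinear (fun U =>
    { toFun := l U
      map_add' := fun x y => hι U (by rw [hl, map_add, map_add, hl, hl])
      map_smul' := fun r x => hι U (by
        rw [hl, Scheme.Modules.Hom.app_smul, RingHom.id_apply, Scheme.Modules.Hom.app_smul, hl]) })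
    fun {U V} i x => hι V ?_, Scheme.Modules.hom_ext _ _ fun U => ?_⟩
  · change ι.app V (l V _) = ι.app V (N.presheaf.map i.op (l U x))
    rw [hl, app_map, app_map, hl]
  · exact AddCommGrpCat.hom_ext (AddMonoidHom.ext fun x => hl U x)

end Retracts

/-! ### Quotients whose invariants are a direct summand. -/

section Quotients

variable {X Y : Scheme.{u}} {φ : X ⟶ Y} {G : Type w} [Group G] [Finite G] {ρ : G →* Aut X}
  {N : Y.Modules}

/-- By `hinv` the invariants are the image of 𝒪 ⊕ N, and `l` splits that map. So the direct image of
the quotient is 𝒪 ⊕ N, and it is a retract of the direct image of `X`, from which it inherits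
finiteness and flatness. -/
theorem exists_quotient_of_retraction {n d : ℕ} (hφ : IsCoveringMap φ n)
    (hρ : ∀ g, (ρ g).hom ≫ φ = φ) (j : N ⟶ directImage φ) (l : directImage φ ⟶ structureSheaf Y ⊞ N)
    (hl : biprod.desc (sharp φ) j ≫ l = 𝟙 _) (hN : IsLocallyFreeOfRank N d)
    (hinv : ∀ (U : Y.Opens) (x : Γ(X, φ ⁻¹ᵁ U)), (∀ g, actFunction hρ U g x = x) ↔
      ∃ r m, x = (sharp φ).app U r + j.app U m) :
    ∃ (Q : Scheme.{u}) (π : X ⟶ Q) (f : Q ⟶ Y), IsQuotientBy ρ π ∧ π ≫ f = φ ∧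
      IsCoveringMap f (d + 1) ∧ ∃ i : N ⟶ directImage f, IsIso (biprod.desc (sharp f) i) := by
  have := hφ.finite
  let ι := quotientInclusion hρ
  obtain ⟨i, hi⟩ := exists_lift ι (quotientInclusion_app_injective hρ) j fun U x =>
    (mem_range_quotientInclusion_app hρ U _).mpr
      ((hinv U _).mpr ⟨0, x, by rw [map_zero, zero_add]⟩)
  let e := biprod.desc (sharp (fromQuotient hρ)) i
  have he : e ≫ ι = biprod.desc (sharp φ) j := by
    refine biprod.hom_ext' _ _ ?_ ?_
    · rw [biprod.inl_desc_assoc, biprod.inl_desc]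
      exact Scheme.Modules.hom_ext _ _ fun U => AddCommGrpCat.hom_ext (AddMonoidHom.ext fun x =>
        sharp_quotientInclusion hρ U x)
    · rw [biprod.inr_desc_assoc, biprod.inr_desc, hi]
  have hei (U : Y.Opens) (x : Γ(N, U)) : ι.app U (i.app U x) = j.app U x :=
    congr(($hi).app U x)
  have hbij (U : Y.Opens) : Function.Bijective fun x : Γ(structureSheaf Y, U) × Γ(N, U) =>
      (sharp (fromQuotient hρ)).app U x.1 + i.app U x.2 := by
    constructor
    · have hmono : Function.Injective (e.app U) := by
        have h₁ : e ≫ ι ≫ l = 𝟙 _ := by rw [← Category.assoc, he, hl]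
        exact Function.LeftInverse.injective (g := (ι ≫ l).app U) fun x => congr(($h₁).app U x)
      have h₂ := (biprod_sections_bijective (structureSheaf Y) N U)
      intro x y hxy
      obtain ⟨x, rfl⟩ := h₂.2 x
      obtain ⟨y, rfl⟩ := h₂.2 y
      have hxy' : x = y := hmono (by
        rw [biprod_desc_app, biprod_desc_app]
        exact hxy)
      rw [hxy']
    · intro x
      obtain ⟨r, m, hx⟩ := (hinv U _).mp ((mem_range_quotientInclusion_app hρ U _).mp ⟨x, rfl⟩)
      refine ⟨(r, m), quotientInclusion_app_injective hρ U ?_⟩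
      refine Eq.trans ?_ hx.symm
      rw [map_add]
      exact congrArg₂ (· + ·) (sharp_quotientInclusion hρ U r) (hei U m)
  have hiso : IsIso e := isIso_biprod_desc_iff.mpr hbij
  refine ⟨quotient hρ, toQuotient hρ, fromQuotient hρ, isQuotientBy_toQuotient hρ,
    QCSubalgebra.toSpec_fromSpec _, ?_, i, hiso⟩
  refine hφ.of_retract ι (l ≫ e) ?_ (hN.of_bijective _ _ hbij)
  rw [← cancel_epi e, ← Category.assoc, ← Category.assoc, he, hl, Category.id_comp,
    Category.comp_id]

end Quotients

/-- A basis identifies the target with the source, and a surjective endomorphism of a finite module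
is injective. -/
theorem injective_of_surjective_of_basis {R D : Type*} [CommRing R] [AddCommGroup D]
    [Module R D] {n : ℕ} {d : Fin n → D} (hd : LinearIndependent R d)
    (hd' : Submodule.span R (Set.range d) = ⊤) {L : (Fin n → R) →ₗ[R] D}
    (hL : Function.Surjective L) : Function.Injective L := by
  let e := (Module.Basis.mk hd hd'.ge).equivFun
  have h := OrzechProperty.injective_of_surjective_endomorphism (e.toLinearMap ∘ₗ L)
    (e.surjective.comp hL)
  exact fun x y hxy => h (congrArg e hxy)

/-! ### The exterior square is locally free of rank one. -/

section

variable {k : Type u} [Field k] {X Y : Scheme.{u}} {s : Y ⟶ Spec (.of k)}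
  {φ : X ⟶ Y} {M : Y.Modules} {a b : M ⟶ directImage φ}

/-- A count of ranks: six sections span a free module of rank six, so they form a basis. The last of
them is thus independent, and by directness of the decomposition it spans its summand. -/
theorem isFrame_wedgeSection [IsAffineHom φ] [IsIso (decomposition a b)] {V W : Y.Opens}
    (hV : IsAffineOpen V) {m : Fin 2 → Γ(M, V)} (hm : IsSpanned a b V m) (hVW : V ≤ W)
    {d : Fin 6 → Γ(directImage φ, W)} (hd : IsFrame (directImage φ) W d) :
    IsFrame (power 2 M) V (fun _ : Fin 1 => wedgeSection m) := by
  refine isFrame_of_locally fun V' i p hp => ?_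
  obtain ⟨r, hr, hpr⟩ := hV.exists_basicOpen_le ⟨p, hp⟩ (i.le hp)
  let j := homOfLE (Y.basicOpen_le r)
  refine ⟨Y.basicOpen r, homOfLE hr, j, hpr, ?_⟩
  have hspan := hm.basicOpen hV r
  simp only [map_wedgeSection]
  set m' : Fin 2 → Γ(M, Y.basicOpen r) := fun l => M.presheaf.map j.op (m l) with hm'
  obtain ⟨hd₁, hd₂⟩ := hd (Y.basicOpen r) (homOfLE ((Y.basicOpen_le r).trans hVW))
  let L := Fintype.linearCombination Γ(Y, Y.basicOpen r)
    ![(sharp φ).app _ (unitSection 1), a.app _ (m' 0), a.app _ (m' 1), b.app _ (m' 0),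
      b.app _ (m' 1), (wedge a b).app _ (wedgeSection m')]
  have hL : Function.Surjective L := by
    intro x
    obtain ⟨l, rfl⟩ := hspan x
    refine ⟨l, ?_⟩
    rw [Fintype.linearCombination_apply, Fin.sum_univ_six, app_unitSection _ (l 0)]
    simp only [map_add, Scheme.Modules.Hom.app_smul]
    simp only [← add_assoc]
    rfl
  have hLinj := injective_of_surjective_of_basis hd₁ hd₂ hL
  constructor
  · rw [Fintype.linearIndependent_iff]
    intro g hg l
    rw [Fin.sum_univ_one] at hg
    have h₁ : L (Pi.single 5 (g 0)) = 0 := by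
      rw [Fintype.linearCombination_apply_single]
      refine (Scheme.Modules.Hom.app_smul (wedge a b) (g 0) (wedgeSection m')).symm.trans ?_
      exact (congrArg _ hg).trans (map_zero _)
    have h₂ := congrFun (hLinj (h₁.trans (map_zero L).symm)) 5
    rw [Pi.single_eq_same] at h₂
    rwa [Subsingleton.elim l 0]
  · rw [eq_top_iff]
    rintro x -
    obtain ⟨l, hl⟩ := hspan ((wedge a b).app _ x)
    have h₁ := (decomposition_bijective a b (Y.basicOpen r)).1
      (a₁ := (0, 0, 0, x)) (a₂ := (_, _, _, _)) (by
        simp only [map_zero, zero_add]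
        exact hl)
    simp only [Prod.mk.injEq] at h₁
    rw [h₁.2.2.2]
    exact Submodule.smul_mem _ _ (Submodule.subset_span ⟨0, rfl⟩)

theorem isLocallyFreeOfRank_power [CharZero k] [IsAffineHom φ] [IsIso (decomposition a b)]
    (hcov : ∀ y : Y, ∃ (U : Y.Opens) (m : Fin 2 → Γ(M, U))
      (c : Fin 4 → Γ(Y, U)), y ∈ U ∧ IsNormalChart s a b U m c)
    (hD : IsLocallyFreeOfRank (directImage φ) 6) : IsLocallyFreeOfRank (power 2 M) 1 := by
  intro y
  obtain ⟨W, hyW, d, hd⟩ := hD y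
  obtain ⟨V, hyV, hVW, hV⟩ := exists_isChartOpen_le hcov hyW
  obtain ⟨hVa, m, -, hm⟩ := hV.exists_frame
  exact ⟨V, hyV, _, isFrame_wedgeSection hVa hm hVW hd⟩

end

/-! ### Fixed sections of rotations and reflections. -/

section Fixed

variable {k : Type u} [Field k] {X Y : Scheme.{u}} (s : Y ⟶ Spec (.of k))
  {φ : X ⟶ Y} {M : Y.Modules} {a b : M ⟶ directImage φ} [IsIso (decomposition a b)]
  {U : Y.Opens}

theorem matrixEnd_eq_self_iff (g : Matrix (Fin 2) (Fin 2) k) (r : Γ(structureSheaf Y, U))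
    (m n : Γ(M, U)) (o : Γ(power 2 M, U)) :
    (matrixEnd s a b g).app U
        ((sharp φ).app U r + (a.app U m + (b.app U n + (wedge a b).app U o))) =
      (sharp φ).app U r + (a.app U m + (b.app U n + (wedge a b).app U o)) ↔
    constants s U (g 0 0) • m + constants s U (g 0 1) • n = m ∧
      constants s U (g 1 0) • m + constants s U (g 1 1) • n = n ∧
      constants s U g.det • o = o := by
  have h : (matrixEnd s a b g).app U
        ((sharp φ).app U r + (a.app U m + (b.app U n + (wedge a b).app U o))) =
      (sharp φ).app U r + (a.app U (constants s U (g 0 0) • m + constants s U (g 0 1) • n) +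
        (b.app U (constants s U (g 1 0) • m + constants s U (g 1 1) • n) +
          (wedge a b).app U (constants s U g.det • o))) := by
    simp only [map_add, matrixEnd_sharp, matrixEnd_left, matrixEnd_right, matrixEnd_wedge,
      Scheme.Modules.Hom.app_smul]
    abel
  rw [h]
  constructor
  · intro h'
    have h₁ := (decomposition_bijective a b U).1 (a₁ := (_, _, _, _)) (a₂ := (_, _, _, _)) h'
    simp only [Prod.mk.injEq] at h₁
    exact h₁.2
  · rintro ⟨h₁, h₂, h₃⟩
    rw [h₁, h₂, h₃]

theorem constants_smul_eq_self_iff {N : Y.Modules} {c : k} (hc : c ≠ 1) (x : Γ(N, U)) :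
    constants s U c • x = x ↔ x = 0 := by
  constructor
  · intro h
    have h₁ : constants s U (c - 1) • x = 0 := by
      rw [map_sub, map_one, sub_smul, h, one_smul, sub_self]
    have h₂ : constants s U (c - 1)⁻¹ * constants s U (c - 1) = 1 := by
      rw [← map_mul, inv_mul_cancel₀ (sub_ne_zero.mpr hc), map_one]
    rw [← one_smul Γ(Y, U) x, ← h₂, mul_smul, h₁, smul_zero]
  · rintro rfl
    exact smul_zero _

/-- The determinant is 1, so the exterior square is fixed, while both eigenvalues on the copies of
`M` differ from 1. -/
theorem rotation_eq_self_iff {α β : k} (hα : α ≠ 1) (hβ : β ≠ 1) (hαβ : α * β = 1)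
    (r : Γ(structureSheaf Y, U)) (m n : Γ(M, U)) (o : Γ(power 2 M, U)) :
    (matrixEnd s a b !![α, 0; 0, β]).app U
        ((sharp φ).app U r + (a.app U m + (b.app U n + (wedge a b).app U o))) =
      (sharp φ).app U r + (a.app U m + (b.app U n + (wedge a b).app U o)) ↔ m = 0 ∧ n = 0 := by
  rw [matrixEnd_eq_self_iff, Matrix.det_fin_two_of, mul_zero, sub_zero, hαβ, map_one, one_smul]
  change constants s U α • m + constants s U 0 • n = m ∧
    constants s U 0 • m + constants s U β • n = n ∧ o = o ↔ _
  rw [map_zero, zero_smul, zero_smul, add_zero, zero_add, constants_smul_eq_self_iff s hα,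
    constants_smul_eq_self_iff s hβ]
  simp

/-- The determinant is -1 ≠ 1, which kills the exterior square; on the two copies of `M` the
eigenvalue 1 leaves the graph of a scalar. -/
theorem reflection_eq_self_iff [CharZero k] {α β : k} (hαβ : α * β = 1)
    (r : Γ(structureSheaf Y, U)) (m n : Γ(M, U)) (o : Γ(power 2 M, U)) :
    (matrixEnd s a b !![0, α; β, 0]).app U
        ((sharp φ).app U r + (a.app U m + (b.app U n + (wedge a b).app U o))) =
      (sharp φ).app U r + (a.app U m + (b.app U n + (wedge a b).app U o)) ↔
    n = constants s U β • m ∧ o = 0 := by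
  rw [matrixEnd_eq_self_iff, Matrix.det_fin_two_of, mul_zero, zero_sub, hαβ,
    constants_smul_eq_self_iff s (by norm_num)]
  change constants s U 0 • m + constants s U α • n = m ∧
    constants s U β • m + constants s U 0 • n = n ∧ o = 0 ↔ _
  rw [map_zero, zero_smul, zero_smul, add_zero, zero_add]
  constructor
  · rintro ⟨-, h₂, h₃⟩
    exact ⟨h₂.symm, h₃⟩
  · rintro ⟨rfl, h₃⟩
    exact ⟨by rw [smul_smul, ← map_mul, hαβ, map_one, one_smul], rfl, h₃⟩

end Fixed

section Symmetric

theorem perm_of_sq_eq_one : ∀ σ : Equiv.Perm (Fin 3), σ * σ = 1 → σ ≠ 1 →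
    Equiv.Perm.sign σ⁻¹ = -1 := by
  decide

theorem perm_of_cube_eq_one : ∀ σ : Equiv.Perm (Fin 3), σ ^ 3 = 1 →
    Equiv.Perm.sign σ⁻¹ = 1 ∧ (σ ≠ 1 → σ⁻¹ 0 ≠ 0) := by
  decide

end Symmetric

/-! ### The action of S₃ and its quotients. -/

section Action

variable {k : Type u} [Field k] {X Y : Scheme.{u}} {s : Y ⟶ Spec (.of k)}
  {φ : X ⟶ Y} {M : Y.Modules} {a b : M ⟶ directImage φ} [IsIso (decomposition a b)] {ω : k}

theorem exists_symmetric_action [IsAffineHom φ] [CharZero k] (hω : ω ^ 3 = 1)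
    (hcov : ∀ y : Y, ∃ (U : Y.Opens) (m : Fin 2 → Γ(M, U))
      (c : Fin 4 → Γ(Y, U)), y ∈ U ∧ IsNormalChart s a b U m c) :
    ∃ (ρ : Equiv.Perm (Fin 3) →* Aut X) (hρ : ∀ σ, (ρ σ).hom ≫ φ = φ),
      ∀ (σ : Equiv.Perm (Fin 3)) (U : Y.Opens) (x : Γ(X, φ ⁻¹ᵁ U)),
        actFunction hρ U σ x = (matrixEnd s a b (permMatrix ω σ⁻¹)).app U x := by
  -- The inverse compensates for the contravariance of functions: `exists_action` asks for the rule
  -- that reverses composition.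
  choose Θ hΘ using fun (σ : Equiv.Perm (Fin 3)) (U : Y.Opens) =>
    exists_matrixEnd_ringHom (isSymmetry_permMatrix hω σ⁻¹) hcov U
  obtain ⟨ρ, hρ, h⟩ : ∃ (ρ : Equiv.Perm (Fin 3) →* Aut X) (hρ : ∀ σ, (ρ σ).hom ≫ φ = φ),
      ∀ (σ : Equiv.Perm (Fin 3)) (U : Y.Opens), actFunction hρ U σ = Θ σ U := by
    refine exists_action Θ (fun σ U V i => ?_) (fun σ U => ?_) (fun U => ?_) fun σ τ U => ?_
    · refine CommRingCat.hom_ext (RingHom.ext fun x => ?_)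
      refine (hΘ σ V _).trans ((app_map (matrixEnd s a b (permMatrix ω σ⁻¹)) i x).trans ?_)
      exact congrArg (X.presheaf.map (homOfLE (φ.preimage_mono i.le)).op) (hΘ σ U x).symm
    · refine CommRingCat.hom_ext (RingHom.ext fun r => ?_)
      exact (hΘ σ U _).trans (matrixEnd_sharp s _ _)
    · refine CommRingCat.hom_ext (RingHom.ext fun x => (hΘ 1 U x).trans ?_)
      rw [inv_one, permMatrix_one]
      exact matrixEnd_one s x
    · refine CommRingCat.hom_ext (RingHom.ext fun x => (hΘ (σ * τ) U x).trans ?_)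
      rw [mul_inv_rev, permMatrix_mul hω]
      refine (matrixEnd_mul s _ _ _).trans ?_
      exact ((hΘ τ U _).trans (congrArg _ (hΘ σ U x))).symm
  exact ⟨ρ, hρ, fun σ U x => congr($(h σ U) x).trans (hΘ σ U x)⟩

/-- Over a nonempty chart the constants embed in the functions and a frame element has no
annihilator, so its images in the two copies of `M` reveal the entries of the matrix. -/
theorem eq_one_of_matrixEnd_eq [Nonempty Y] {g : Matrix (Fin 2) (Fin 2) k}
    (hcov : ∀ y : Y, ∃ (U : Y.Opens) (m : Fin 2 → Γ(M, U))
      (c : Fin 4 → Γ(Y, U)), y ∈ U ∧ IsNormalChart s a b U m c)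
    (h : ∀ (U : Y.Opens) (x : Γ(directImage φ, U)), (matrixEnd s a b g).app U x = x) : g = 1 := by
  obtain ⟨U, m, c, hyU, hU⟩ := hcov (Classical.arbitrary Y)
  have : Nonempty U := ⟨⟨_, hyU⟩⟩
  have hinj : Function.Injective (constants s U) := (constants s U).injective
  have h₁ := (matrixEnd_eq_self_iff s g 0 (m 0) 0 0).mp (h U _)
  have h₂ := (matrixEnd_eq_self_iff s g 0 0 (m 0) 0).mp (h U _)
  simp only [smul_zero, add_zero, zero_add] at h₁ h₂
  have hz {x : Γ(Y, U)} (hx : x • m 0 = 0) : x = 0 :=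
    (hU.isFrame.eq_zero (x := x) (y := 0) (by rw [hx, zero_smul, add_zero])).1
  have hone {c : k} (hc : constants s U c • m 0 = m 0) : c = 1 := by
    refine hinj (sub_eq_zero.mp (hz ?_))
    rw [map_one, sub_smul, hc, one_smul, sub_self]
  have hzero {c : k} (hc : constants s U c • m 0 = 0) : c = 0 :=
    hinj ((hz hc).trans (map_zero _).symm)
  rw [Matrix.eta_fin_two g, hone h₁.1, hzero h₁.2.1, hzero h₂.1, hone h₂.2.1, Matrix.one_fin_two]

variable {ρ : Equiv.Perm (Fin 3) →* Aut X} {hρ : ∀ σ, (ρ σ).hom ≫ φ = φ}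

theorem injective_of_actFunction_eq [Nonempty Y] (hω : IsPrimitiveRoot ω 3)
    (hcov : ∀ y : Y, ∃ (U : Y.Opens) (m : Fin 2 → Γ(M, U))
      (c : Fin 4 → Γ(Y, U)), y ∈ U ∧ IsNormalChart s a b U m c)
    (hact : ∀ (σ : Equiv.Perm (Fin 3)) (U : Y.Opens) (x : Γ(X, φ ⁻¹ᵁ U)),
      actFunction hρ U σ x = (matrixEnd s a b (permMatrix ω σ⁻¹)).app U x) :
    Function.Injective ρ := by
  rw [injective_iff_map_eq_one]
  intro σ hσ
  have h₁ : permMatrix ω σ⁻¹ = 1 := eq_one_of_matrixEnd_eq (a := a) (b := b) hcov fun U x => by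
    have h₂ : (ρ σ).hom = 𝟙 X := by rw [hσ]; rfl
    refine (hact σ U x).symm.trans ?_
    exact congr($(appLE_eq_id h₂ (preimage_le_of_invariant (hρ σ) U)) x)
  exact inv_eq_one.mp (injective_permMatrix hω (h₁.trans permMatrix_one.symm))

theorem permMatrix_eq_self_iff_of_sign_one (hω : IsPrimitiveRoot ω 3) {σ : Equiv.Perm (Fin 3)}
    (hσ : Equiv.Perm.sign σ = 1) (hσ' : σ 0 ≠ 0) {U : Y.Opens} (r : Γ(structureSheaf Y, U))
    (m n : Γ(M, U)) (o : Γ(power 2 M, U)) :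
    (matrixEnd s a b (permMatrix ω σ)).app U
        ((sharp φ).app U r + (a.app U m + (b.app U n + (wedge a b).app U o))) =
      (sharp φ).app U r + (a.app U m + (b.app U n + (wedge a b).app U o)) ↔ m = 0 ∧ n = 0 := by
  have h₁ : (σ 0).val ≠ 0 := fun h => hσ' (Fin.ext h)
  have h₂ := (σ 0).isLt
  rw [permMatrix, if_pos hσ]
  refine rotation_eq_self_iff s ?_ ?_ ?_ r m n o
  · rw [Ne, hω.pow_eq_one_iff_dvd]
    omega
  · rw [Ne, hω.pow_eq_one_iff_dvd]
    omega
  · rw [← pow_add, hω.pow_eq_one_iff_dvd]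
    omega

theorem permMatrix_eq_self_iff_of_sign_neg_one [CharZero k] (hω : IsPrimitiveRoot ω 3)
    {σ : Equiv.Perm (Fin 3)} (hσ : Equiv.Perm.sign σ = -1) {U : Y.Opens}
    (r : Γ(structureSheaf Y, U)) (m n : Γ(M, U)) (o : Γ(power 2 M, U)) :
    (matrixEnd s a b (permMatrix ω σ)).app U
        ((sharp φ).app U r + (a.app U m + (b.app U n + (wedge a b).app U o))) =
      (sharp φ).app U r + (a.app U m + (b.app U n + (wedge a b).app U o)) ↔
    n = constants s U (ω ^ (2 * (σ 0).val)) • m ∧ o = 0 := by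
  rw [permMatrix, if_neg (by rw [hσ]; decide)]
  refine reflection_eq_self_iff s ?_ r m n o
  rw [← pow_add, hω.pow_eq_one_iff_dvd]
  omega

theorem isQuotientBy_of_actFunction_eq [IsFinite φ] [CharZero k] (hω : IsPrimitiveRoot ω 3)
    (hact : ∀ (σ : Equiv.Perm (Fin 3)) (U : Y.Opens) (x : Γ(X, φ ⁻¹ᵁ U)),
      actFunction hρ U σ x = (matrixEnd s a b (permMatrix ω σ⁻¹)).app U x) :
    IsQuotientBy ρ φ := by
  refine isQuotientBy_of_cover hρ fun q => ?_
  obtain ⟨U, hU, hqU, -⟩ := exists_isAffineOpen_mem_and_subset (x := q) (U := ⊤) trivial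
  refine ⟨U, hqU, hU, fun x y hxy => ?_, fun x hx => ?_⟩
  · have h₁ := (decomposition_bijective a b U).1 (a₁ := (x, 0, 0, 0)) (a₂ := (y, 0, 0, 0)) (by
      simp only [map_zero, add_zero]
      exact hxy)
    exact congrArg Prod.fst h₁
  · obtain ⟨⟨r, m, n, o⟩, rfl⟩ := (decomposition_bijective a b U).2 x
    -- One rotation eliminates both copies of `M` and one reflection eliminates the exterior square,
    -- leaving only functions from the base.
    obtain ⟨rfl, rfl⟩ := (permMatrix_eq_self_iff_of_sign_one hω (σ := finRotate 3)
      (by decide) (by decide) r m n o).mp (by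
        have := (hact (finRotate 3)⁻¹ U _).symm.trans (hx (finRotate 3)⁻¹)
        rwa [inv_inv] at this)
    obtain ⟨-, rfl⟩ := (permMatrix_eq_self_iff_of_sign_neg_one hω (σ := Equiv.swap 1 2)
      (by decide) r 0 0 o).mp (by
        have := (hact (Equiv.swap 1 2)⁻¹ U _).symm.trans (hx (Equiv.swap 1 2)⁻¹)
        rwa [inv_inv] at this)
    refine ⟨r, ?_⟩
    simp only [map_zero, add_zero]
    rfl

theorem constMul_one (s : Y ⟶ Spec (.of k)) (N : Y.Modules) : constMul s N 1 = 𝟙 N :=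
  Scheme.Modules.hom_ext _ _ fun U => AddCommGrpCat.hom_ext (AddMonoidHom.ext fun x => by
    change constants s U 1 • x = x
    rw [map_one, one_smul])

theorem exists_quotient_of_card_two [CharZero k] {d : ℕ} (hφ : IsCoveringMap φ d) (hω : IsPrimitiveRoot ω 3)
    (hact : ∀ (σ : Equiv.Perm (Fin 3)) (U : Y.Opens) (x : Γ(X, φ ⁻¹ᵁ U)),
      actFunction hρ U σ x = (matrixEnd s a b (permMatrix ω σ⁻¹)).app U x)
    (hM : IsLocallyFreeOfRank M 2) (H : Subgroup (Equiv.Perm (Fin 3))) (hH : Nat.card H = 2) :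
    ∃ (Q : Scheme.{u}) (π : X ⟶ Q) (f : Q ⟶ Y), IsQuotientBy (ρ.comp H.subtype) π ∧ π ≫ f = φ ∧
      IsCoveringMap f 3 ∧ ∃ i : M ⟶ directImage f, IsIso (biprod.desc (sharp f) i) := by
  obtain ⟨τ, hτ, hτ'⟩ := (Nat.card_eq_two_iff' (1 : H)).mp hH
  have hsq : τ * τ = 1 := by
    by_contra h
    exact hτ (mul_eq_left.mp (hτ' _ h))
  have hsign := perm_of_sq_eq_one τ.1 congr(($hsq).1) fun h => hτ (Subtype.ext h)
  let β : k := ω ^ (2 * (τ.1⁻¹ 0).val)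
  have hdesc : biprod.desc (sharp φ) (combination s a b 1 β) ≫ inv (decomposition a b) ≫
      biprod.desc biprod.inl (biprod.desc biprod.inr 0) = 𝟙 (structureSheaf Y ⊞ M) := by
    have h₁ : sharp φ = biprod.inl ≫ decomposition a b := by simp [decomposition]
    have h₂ : a = biprod.inl ≫ biprod.inr ≫ decomposition a b := by simp [decomposition]
    have h₃ : b = biprod.inl ≫ biprod.inr ≫ biprod.inr ≫ decomposition a b := by
      simp [decomposition]
    have e₁ : sharp φ ≫ inv (decomposition a b) = biprod.inl := by
      rw [IsIso.comp_inv_eq, ← h₁]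
    have e₂ : a ≫ inv (decomposition a b) = biprod.inl ≫ biprod.inr := by
      rw [IsIso.comp_inv_eq, Category.assoc, ← h₂]
    have e₃ : b ≫ inv (decomposition a b) = biprod.inl ≫ biprod.inr ≫ biprod.inr := by
      rw [IsIso.comp_inv_eq, Category.assoc, Category.assoc, ← h₃]
    refine biprod.hom_ext' _ _ ?_ ?_
    · rw [biprod.inl_desc_assoc, reassoc_of% e₁]
      simp
    · rw [biprod.inr_desc_assoc, combination, constMul_one, Preadditive.add_comp, Category.assoc,
        Category.assoc, reassoc_of% e₂, reassoc_of% e₃]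
      simp
  refine exists_quotient_of_retraction hφ (fun h : H => hρ h.1) _ _ hdesc hM fun U x => ?_
  constructor
  · intro hx
    obtain ⟨⟨r, m, n, o⟩, rfl⟩ := (decomposition_bijective a b U).2 x
    obtain ⟨rfl, rfl⟩ := (permMatrix_eq_self_iff_of_sign_neg_one hω hsign r m n o).mp
      ((hact τ.1 U _).symm.trans (hx τ))
    refine ⟨r, m, (?_ : @Eq Γ(directImage φ, U) _ _)⟩
    dsimp only
    rw [combination_app, map_one, one_smul, map_zero ((wedge a b).app U).hom, add_zero,
      Scheme.Modules.Hom.app_smul]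
  · rintro ⟨r, m, rfl⟩ h
    by_cases h1 : h = 1
    · subst h1
      refine (hact 1 U _).trans ?_
      rw [inv_one, permMatrix_one]
      exact matrixEnd_one s _
    · obtain rfl := hτ' h h1
      refine (hact h.1 U _).trans ?_
      have := (permMatrix_eq_self_iff_of_sign_neg_one (s := s) (a := a) (b := b) hω hsign r m _ 0).mpr
        ⟨rfl, rfl⟩
      rw [map_zero ((wedge a b).app U).hom, add_zero, Scheme.Modules.Hom.app_smul] at this
      rw [combination_app, map_one, one_smul]
      exact this

/-- All elements have order dividing 3, so they are even, and those other than 1 move 0. A single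
nontrivial rotation thus already cuts out the invariants 𝒪 ⊕ ⋀²M. -/
theorem exists_quotient_of_card_three {d : ℕ} (hφ : IsCoveringMap φ d) (hω : IsPrimitiveRoot ω 3)
    (hact : ∀ (σ : Equiv.Perm (Fin 3)) (U : Y.Opens) (x : Γ(X, φ ⁻¹ᵁ U)),
      actFunction hρ U σ x = (matrixEnd s a b (permMatrix ω σ⁻¹)).app U x)
    (hM : IsLocallyFreeOfRank (power 2 M) 1) (H : Subgroup (Equiv.Perm (Fin 3)))
    (hH : Nat.card H = 3) :
    ∃ (Q : Scheme.{u}) (π : X ⟶ Q) (f : Q ⟶ Y), IsQuotientBy (ρ.comp H.subtype) π ∧ π ≫ f = φ ∧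
      IsCoveringMap f 2 ∧ ∃ i : power 2 M ⟶ directImage f, IsIso (biprod.desc (sharp f) i) := by
  have hcube (h : H) := perm_of_cube_eq_one h.1 (by
    have : h ^ Nat.card H = 1 := pow_card_eq_one'
    rw [hH] at this
    exact congr(($this).1))
  have : Nontrivial H := Finite.one_lt_card_iff_nontrivial.mp (by omega)
  obtain ⟨τ, hτ⟩ := exists_ne (1 : H)
  have hτ' := (hcube τ).2 fun h => hτ (Subtype.ext h)
  have hdesc : biprod.desc (sharp φ) (wedge a b) ≫ inv (decomposition a b) ≫
      biprod.desc biprod.inl (biprod.desc 0 (biprod.desc 0 biprod.inr)) =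
        𝟙 (structureSheaf Y ⊞ power 2 M) := by
    have h₁ : sharp φ = biprod.inl ≫ decomposition a b := by simp [decomposition]
    have h₂ : wedge a b = biprod.inr ≫ biprod.inr ≫ biprod.inr ≫ decomposition a b := by
      simp [decomposition]
    have e₁ : sharp φ ≫ inv (decomposition a b) = biprod.inl := by
      rw [IsIso.comp_inv_eq, ← h₁]
    have e₂ : wedge a b ≫ inv (decomposition a b) = biprod.inr ≫ biprod.inr ≫ biprod.inr := by
      rw [IsIso.comp_inv_eq, Category.assoc, Category.assoc, ← h₂]
    refine biprod.hom_ext' _ _ ?_ ?_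
    · rw [biprod.inl_desc_assoc, reassoc_of% e₁]
      simp
    · rw [biprod.inr_desc_assoc, reassoc_of% e₂]
      simp
  refine exists_quotient_of_retraction hφ (fun h : H => hρ h.1) _ _ hdesc hM fun U x => ?_
  constructor
  · intro hx
    obtain ⟨⟨r, m, n, o⟩, rfl⟩ := (decomposition_bijective a b U).2 x
    obtain ⟨rfl, rfl⟩ := (permMatrix_eq_self_iff_of_sign_one hω (hcube τ).1 hτ' r m n o).mp
      ((hact τ.1 U _).symm.trans (hx τ))
    refine ⟨r, o, (?_ : @Eq Γ(directImage φ, U) _ _)⟩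
    simp only [map_zero, zero_add]
  · rintro ⟨r, o, rfl⟩ h
    by_cases h1 : h = 1
    · subst h1
      refine (hact 1 U _).trans ?_
      rw [inv_one, permMatrix_one]
      exact matrixEnd_one s _
    · refine (hact h.1 U _).trans ?_
      have := (permMatrix_eq_self_iff_of_sign_one (s := s) (a := a) (b := b) hω (hcube h).1
        ((hcube h).2 fun h' => h1 (Subtype.ext h')) r 0 0 o).mpr ⟨rfl, rfl⟩
      simp only [map_zero, zero_add] at this
      exact this

end Action

end AlgCover

end

open AlgCover ExteriorSheaf in
theorem theorem3p5 {k : Type u} [Field k] [IsAlgClosed k] [CharZero k]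
    {X Y : Scheme.{u}} [Nonempty Y] (s : Y ⟶ Spec (.of k)) (φ : X ⟶ Y)
    (hφ : IsGorensteinCoveringMap φ 6)
    (M : Y.Modules) (hM : IsLocallyFreeOfRank M 2)
    (a b : M ⟶ directImage φ) (t : power 2 M ⟶ directImage φ)
    (hdec : IsIso (biprod.desc (sharp φ) (biprod.desc a (biprod.desc b t))))
    (e : Fin 4 → k) (he : discriminant e ≠ 0)
    (hlin : IsLinearCover s φ a b e) :
    ∃ ρ : Equiv.Perm (Fin 3) →* Aut X,
      IsGaloisBranchedCover ρ φ ∧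
      (∃ g : GL (Fin 2) k, ∀ (U : Y.Opens) (m : Fin 2 → Γ(M, U)) (c : Fin 4 → Γ(Y, U)),
        IsLinearChart s φ a b e U m c →
          IsPresentedBy (φ.app U).hom (changeCoordinates s φ g U (coordinates φ a b U m))
            (normalEquations (constants s U) c)) ∧
      (∀ H : Subgroup (Equiv.Perm (Fin 3)), Nat.card H = 2 →
        ∃ (Q : Scheme.{u}) (π : X ⟶ Q) (φ₂ : Q ⟶ Y),
          IsQuotientBy (ρ.comp H.subtype) π ∧ π ≫ φ₂ = φ ∧ IsCoveringMap φ₂ 3 ∧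
            ∃ i : M ⟶ directImage φ₂, IsIso (biprod.desc (sharp φ₂) i)) ∧
      (∀ H : Subgroup (Equiv.Perm (Fin 3)), Nat.card H = 3 →
        ∃ (Q : Scheme.{u}) (π : X ⟶ Q) (φ₃ : Q ⟶ Y),
          IsQuotientBy (ρ.comp H.subtype) π ∧ π ≫ φ₃ = φ ∧ IsCoveringMap φ₃ 2 ∧
            ∃ i : power 2 M ⟶ directImage φ₃, IsIso (biprod.desc (sharp φ₃) i)) := by
  have hφ' := hφ.toIsCoveringMap
  have := hφ'.finite
  obtain ⟨p, q, r, r', hdet, h₁, h₂, h₃, h₄, h₅, h₆⟩ := exists_diagonalization e he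
  have : NeZero (3 : k) := ⟨three_ne_zero⟩
  obtain ⟨ω, hω⟩ := HasEnoughRootsOfUnity.exists_primitiveRoot k 3
  let g : GL (Fin 2) k := Matrix.GeneralLinearGroup.mkOfDetNeZero !![p, q; r, r'] (by
    rwa [Matrix.det_fin_two_of])
  let a' := combination s a b p q
  let b' := combination s a b r r'
  have hbij (U : Y.Opens) := bijective_combination s
    ((bijective_biprod_desc_iff _ _ _ _ U).mp (isIso_iff_bijective.mp hdec U)) hdet
  have hchart (U : Y.Opens) (m : Fin 2 → Γ(M, U)) (c : Fin 4 → Γ(Y, U))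
      (h : IsLinearChart s φ a b e U m c) : IsPresentedBy (φ.app U).hom
        (coordinates φ a' b' U m) (normalEquations (constants s U) c) := by
    obtain ⟨-, hm, d, hd⟩ := h
    refine hd.normalEquations (constants s U) hdet h₁ h₂ h₃ h₄ h₅ h₆ (fun n => ?_)
      (independent_coordinates a' b' (hbij U) hm)
    exact congrFun (changeCoordinates_eq s g U m).symm n
  have hcov (y : Y) : ∃ (U : Y.Opens) (m : Fin 2 → Γ(M, U)) (c : Fin 4 → Γ(Y, U)),
      y ∈ U ∧ IsNormalChart s a' b' U m c := by
    obtain ⟨U, m, c, hyU, h⟩ := hlin y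
    exact ⟨U, m, c, hyU, h.1, h.2.1, hchart U m c h⟩
  -- Here the arbitrary embedding `t` is exchanged for the one by minors of the new coordinates; the
  -- given decomposition serves only as the comparison isomorphism.
  have : IsIso (decomposition a' b') := isIso_decomposition hcov
    (biprod.desc (sharp φ) (biprod.desc a (biprod.desc b t)))
  obtain ⟨ρ, hρ, hact⟩ := exists_symmetric_action hω.pow_eq_one hcov
  have hcard : Nat.card (Equiv.Perm (Fin 3)) = 6 := by
    rw [Nat.card_eq_fintype_card, Fintype.card_perm, Fintype.card_fin]
    rfl
  refine ⟨ρ, ⟨hcard.symm ▸ hφ', injective_of_actFunction_eq hω hcov hact,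
    isQuotientBy_of_actFunction_eq hω hact⟩, ⟨g, fun U m c h => ?_⟩,
    exists_quotient_of_card_two hφ' hω hact hM,
    exists_quotient_of_card_three hφ' hω hact (isLocallyFreeOfRank_power hcov hφ'.locallyFree)⟩
  rw [changeCoordinates_eq]
  exact hchart U m c h
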